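/- **Setting.** Let $\Omega\subset\mathbb R^2$ be a bounded open set whose boundary $\Gamma=\partial\Omega$ has finite length and, at almost every point with respect to arc length, an outward unit normal $\nu=(\nu_1,\nu_2)$. Let $\tau=(\tau_1,\tau_2)$ be the (measurable) unit tangent field of $\Gamma$ oriented so that $\nu=(\tau_2,-\tau_1)$. Let $k_v>0$, let the refractive index $n$ be a positive real number or a complex number with positive imaginary part, let $k=k_vn$, and let $\beta\in\mathbb R$ with $k^2\ne\beta^2$. Let $k_\beta=\sqrt{k^2-\beta^2}$ be the root with nonnegative imaginary part, taken positive if it is real. For points $P,Q$ of the plane put $G(P,Q)=\frac i4H_0^{(1)}(k_\beta|P-Q|)$, where $H_0^{(1)}$ is the Hankel function of the first kind of order zero. For $\sigma\in L^1(\Gamma)$ and $P\notin\Gamma$ define the single, double and anti-double layer potentials $$S[\sigma](P)=\int_\Gamma G(P,Q)\sigma(Q)\,ds_Q,\quad D[\sigma](P)=\int_\Gamma\frac{\partial G(P,Q)}{\partial\nu(Q)}\sigma(Q)\,ds_Q,\quad T[\sigma](P)=\int_\Gamma\frac{\partial G(P,Q)}{\partial\tau(Q)}\sigma(Q)\,ds_Q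 .$$ Let $J_\tau,J_z,M_\tau,M_z\in L^1(\Gamma)$ be complex-valued and define surface currents on the cylinder $\Gamma\times\mathbb R$ by $$\mathbf J(x,y,z)=(J_\tau\tau_1,\,J_\tau\tau_2,\,J_z)(x,y)\,e^{i\beta z},\qquad \mathbf M(x,y,z)=(M_\tau\tau_1,\,M_\tau\tau_2,\,M_z)(x,y)\,e^{i\beta z}.$$ For $\mathbf r\notin\Gamma\times\mathbb R$ let $$S^k[\mathbf J](\mathbf r)=\frac1{4\pi}\int_{\Gamma\times\mathbb R}\frac{e^{ik|\mathbf r-\mathbf r'|}}{|\mathbf r-\mathbf r'|}\,\mathbf J(\mathbf r')\,d\mathbf r',$$ understood as the improper integral that is the limit of the integrals over $\Gamma\times[a,b]$ as $a\to-\infty$ and $b\to\infty$ independently, and define $S^k[\mathbf M]$ in the same way. The dual Müller representation is $$\mathbf E=\frac1{ik_v}\nabla\times\nabla\times S^k[\mathbf J]-\nabla\times S^k[\mathbf M],\qquad \mathbf H=-\frac1{ik_v}\nabla\times\nabla\times S^k[\mathbf M]-\frac{k^2}{k_v^2}\nabla\times S^k[\mathbf J].$$ **Theorem.** The improper integrals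 $S^k[\mathbf J]$ and $S^k[\mathbf M]$ converge and are $C^2$ off $\Gamma\times\mathbb R$; for every $\sigma\in L^1(\Gamma)$ the integrals $S[\sigma],D[\sigma],T[\sigma]$ converge absolutely off $\Gamma$, and $S[\sigma],T[\sigma]$ are differentiable there. For all $(x,y)\notin\Gamma$ and $z\in\mathbb R$, $$\mathbf E(x,y,z)=(E_x,E_y,E_z)(x,y)\,e^{i\beta z},\qquad \mathbf H(x,y,z)=(H_x,H_y,H_z)(x,y)\,e^{i\beta z},$$ where $$\begin{aligned} E_x&=-\tfrac1{ik_v}\partial_xT[J_\tau]+\tfrac{\beta}{k_v}\partial_xS[J_z]+\tfrac{k^2}{ik_v}S[J_\tau\tau_1]-\partial_yS[M_z]+i\beta S[M_\tau\tau_2],\\ E_y&=-\tfrac1{ik_v}\partial_yT[J_\tau]+\tfrac{\beta}{k_v}\partial_yS[J_z]+\tfrac{k^2}{ik_v}S[J_\tau\tau_2]+\partial_xS[M_z]-i\beta S[M_\tau\tau_1],\\ E_z&=-\tfrac{\beta}{k_v}T[J_\tau]+\tfrac{k^2-\beta^2}{ik_v}S[J_z]+D[M_\tau],\\ H_x&=\tfrac1{ik_v}\partial_xT[M_\tau]-\tfrac{\beta}{k_v}\partial_xS[M_z]-\tfrac{k^2}{ik_v}S[M_\tau\tau_1]-\tfrac{k^2}{k_v^2}\partial_yS[J_z]+i\beta\tfrac{k^2}{k_v^2}S[J_\tau\tau_2],\\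 H_y&=\tfrac1{ik_v}\partial_yT[M_\tau]-\tfrac{\beta}{k_v}\partial_yS[M_z]-\tfrac{k^2}{ik_v}S[M_\tau\tau_2]+\tfrac{k^2}{k_v^2}\partial_xS[J_z]-i\beta\tfrac{k^2}{k_v^2}S[J_\tau\tau_1],\\ H_z&=\tfrac{\beta}{k_v}T[M_\tau]-\tfrac{k^2-\beta^2}{ik_v}S[M_z]+\tfrac{k^2}{k_v^2}D[J_\tau]. \end{aligned}$$ -/

import Mathlib

open MeasureTheory Filter Topology
open scoped ContDiff

noncomputable section

namespace Waveguide

/-- The `xy`-plane with its Euclidean norm. -/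
abbrev Plane : Type := EuclideanSpace ℝ (Fin 2)

/-- Three-dimensional space with its Euclidean norm. -/
abbrev Space : Type := EuclideanSpace ℝ (Fin 3)

/-- The projection `(x, y, z) ↦ (x, y)`. -/
def proj (r : Space) : Plane := !₂[r 0, r 1]

/-- The point `(x, y, z)` over `(x, y)` at height `z`. -/
def lift (Q : Plane) (z : ℝ) : Space := !₂[Q 0, Q 1, z]

/-! ### The Hankel function of the first kind and order zero -/

/-- The Bessel function `J₀`. -/
def besselJ0 (z : ℂ) : ℂ :=
  ∑' m : ℕ, (-1 : ℂ) ^ m * (z ^ 2 / 4) ^ m / ((m.factorial : ℂ) ^ 2)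

/-- The Bessel function of the second kind `Y₀` (principal branch). -/
def besselY0 (z : ℂ) : ℂ :=
  (2 / (Real.pi : ℂ)) * (Complex.log (z / 2) + (Real.eulerMascheroniConstant : ℂ)) * besselJ0 z
    - (2 / (Real.pi : ℂ)) *
      ∑' m : ℕ, (-1 : ℂ) ^ m * ((harmonic m : ℚ) : ℂ) * (z ^ 2 / 4) ^ m / ((m.factorial : ℂ) ^ 2)

/-- The Hankel function `H₀⁽¹⁾ = J₀ + i Y₀`. -/
def hankel0 (z : ℂ) : ℂ := besselJ0 z + Complex.I * besselY0 z

/-- The number lies in the open upper half plane or on the positive real axis. Of the two square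
roots of a nonzero complex number exactly one has this property: the one with nonnegative
imaginary part, taken positive when the roots are real. -/
def UpperBranch (w : ℂ) : Prop := 0 < w.im ∨ (w.im = 0 ∧ 0 < w.re)

/-! ### The cross section -/

/-- `ν` is the outward unit normal of `Ω` at the point `Q`: near `Q`, every cone around `ν` of
opening less than a half plane lies outside `Ω` and the opposite cone lies inside. -/
def IsOutwardUnitNormal (Ω : Set Plane) (Q ν : Plane) : Prop :=
  ‖ν‖ = 1 ∧ ∀ ε : ℝ, 0 < ε → ∀ᶠ x in 𝓝[≠] Q,
    (ε * ‖x - Q‖ ≤ inner ℝ (x - Q) ν → x ∉ Ω) ∧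
    (inner ℝ (x - Q) ν ≤ -(ε * ‖x - Q‖) → x ∈ Ω)

/-- The clockwise rotation `(τ₁, τ₂) ↦ (τ₂, -τ₁)`. -/
def rot (t : Plane) : Plane := !₂[t 1, -(t 0)]

/-- The cross section of a waveguide: a bounded open set `Ω` of the plane, whose boundary has
finite length, with the positively oriented unit tangent field `τ`. The tangent and the normal
need to exist only at almost every boundary point, so that corners are allowed. -/
structure CrossSection where
  Ω : Set Plane
  isOpen : IsOpen Ω
  isBounded : Bornology.IsBounded Ω
  finite_length : μH[1] (frontier Ω) < ⊤
  τ : Plane → Plane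
  measurable_τ : Measurable τ
  outward : ∀ᵐ Q ∂(μH[1].restrict (frontier Ω)), IsOutwardUnitNormal Ω Q (rot (τ Q))

namespace CrossSection

variable (C : CrossSection)

/-- The boundary curve. -/
def Γ : Set Plane := frontier C.Ω

/-- The outward unit normal `ν = (τ₂, -τ₁)`. -/
def ν (Q : Plane) : Plane := rot (C.τ Q)

/-- Arc length on the boundary curve. -/
def arc : Measure Plane := μH[1].restrict C.Γ

/-- Surface area on the cylinder `Γ × ℝ`, whose points are pairs `(Q, z)`. -/
def area : Measure (Plane × ℝ) := C.arc.prod volume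

/-- The complement of the cylinder `Γ × ℝ` in space. -/
def offCylinder : Set Space := {r | proj r ∉ C.Γ}

end CrossSection

/-! ### Layer potentials in the plane -/

/-- The Green's function of the two-dimensional Helmholtz equation. -/
def green (κ : ℂ) (P Q : Plane) : ℂ :=
  Complex.I / 4 * hankel0 (κ * (‖P - Q‖ : ℂ))

/-- The derivative of the Green's function with respect to its second point, in direction `v`. -/
def dGreen (κ : ℂ) (P Q v : Plane) : ℂ := fderiv ℝ (fun Q' => green κ P Q') Q v

/-- The single layer potential. -/
def single (C : CrossSection) (κ : ℂ) (σ : Plane → ℂ) (P : Plane) : ℂ :=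
  ∫ Q, green κ P Q * σ Q ∂C.arc

/-- The double layer potential. -/
def double (C : CrossSection) (κ : ℂ) (σ : Plane → ℂ) (P : Plane) : ℂ :=
  ∫ Q, dGreen κ P Q (C.ν Q) * σ Q ∂C.arc

/-- The anti-double layer potential. -/
def antiDouble (C : CrossSection) (κ : ℂ) (σ : Plane → ℂ) (P : Plane) : ℂ :=
  ∫ Q, dGreen κ P Q (C.τ Q) * σ Q ∂C.arc

/-- The partial derivative in the plane with respect to the `i`-th coordinate. -/
def pd2 (i : Fin 2) (f : Plane → ℂ) (P : Plane) : ℂ :=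
  fderiv ℝ f P (EuclideanSpace.single i 1)

/-! ### Layer potentials and fields in space -/

/-- The integrand of the three-dimensional Helmholtz single layer potential on the cylinder. -/
def kernel3 (k : ℂ) (σ : Space → ℂ) (r : Space) (p : Plane × ℝ) : ℂ :=
  1 / (4 * (Real.pi : ℂ)) *
    (Complex.exp (Complex.I * k * (‖r - lift p.1 p.2‖ : ℂ)) / (‖r - lift p.1 p.2‖ : ℂ)) *
    σ (lift p.1 p.2)

/-- The single layer integral over the part of the cylinder with heights in `[c.1, c.2]`. -/
def truncSingle3 (C : CrossSection) (k : ℂ) (σ : Space → ℂ) (r : Space) (c : ℝ × ℝ) : ℂ :=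
  ∫ p in Set.univ ×ˢ Set.Icc c.1 c.2, kernel3 k σ r p ∂C.area

/-- The single layer potential on the infinite cylinder, an improper integral (for real `k` it
does not converge absolutely): the two ends of the cylinder tend to infinity independently. -/
def single3 (C : CrossSection) (k : ℂ) (σ : Space → ℂ) (r : Space) : ℂ :=
  limUnder (atBot ×ˢ atTop) (truncSingle3 C k σ r)

/-- The improper integral defining the single layer potential converges at `r`. -/
def Converges3 (C : CrossSection) (k : ℂ) (σ : Space → ℂ) (r : Space) : Prop :=
  (∀ a b : ℝ, IntegrableOn (kernel3 k σ r) (Set.univ ×ˢ Set.Icc a b) C.area) ∧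
  Tendsto (truncSingle3 C k σ r) (atBot ×ˢ atTop) (𝓝 (single3 C k σ r))

/-- The single layer potential of a vector density, component by component. -/
def vecSingle3 (C : CrossSection) (k : ℂ) (F : Space → Fin 3 → ℂ) (r : Space) : Fin 3 → ℂ :=
  fun j => single3 C k (fun r' => F r' j) r

/-- The partial derivative in space with respect to the `i`-th coordinate. -/
def pd3 (i : Fin 3) (f : Space → ℂ) (r : Space) : ℂ :=
  fderiv ℝ f r (EuclideanSpace.single i 1)

/-- The curl of a vector field. -/
def curl (F : Space → Fin 3 → ℂ) (r : Space) : Fin 3 → ℂ :=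
  ![pd3 1 (fun q => F q 2) r - pd3 2 (fun q => F q 1) r,
    pd3 2 (fun q => F q 0) r - pd3 0 (fun q => F q 2) r,
    pd3 0 (fun q => F q 1) r - pd3 1 (fun q => F q 0) r]

/-- The surface current `(aτ τ + az k̂) e^{iβz}`. -/
def current (C : CrossSection) (β : ℝ) (aτ az : Plane → ℂ) (r : Space) : Fin 3 → ℂ :=
  Complex.exp (Complex.I * β * (r 2 : ℂ)) •
    ![aτ (proj r) * (C.τ (proj r) 0 : ℂ), aτ (proj r) * (C.τ (proj r) 1 : ℂ), az (proj r)]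

/-- The electric field of the dual Müller representation. -/
def mullerE (C : CrossSection) (kv : ℝ) (k : ℂ) (J M : Space → Fin 3 → ℂ) (r : Space) :
    Fin 3 → ℂ :=
  (1 / (Complex.I * kv)) • curl (curl (vecSingle3 C k J)) r - curl (vecSingle3 C k M) r

/-- The magnetic field of the dual Müller representation. -/
def mullerH (C : CrossSection) (kv : ℝ) (k : ℂ) (J M : Space → Fin 3 → ℂ) (r : Space) :
    Fin 3 → ℂ :=
  -((1 / (Complex.I * kv)) • curl (curl (vecSingle3 C k M)) r)
    - (k ^ 2 / (kv : ℂ) ^ 2) • curl (vecSingle3 C k J) r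

/-- The electric field `(E_x, E_y, E_z)` in terms of the layer potentials in the plane. -/
def modeE (C : CrossSection) (kv : ℝ) (k κ : ℂ) (β : ℝ) (Jτ Jz Mτ Mz : Plane → ℂ) (P : Plane) :
    Fin 3 → ℂ :=
  ![-(1 / (Complex.I * kv)) * pd2 0 (antiDouble C κ Jτ) P
      + (β / kv : ℂ) * pd2 0 (single C κ Jz) P
      + k ^ 2 / (Complex.I * kv) * single C κ (fun Q => Jτ Q * (C.τ Q 0 : ℂ)) P
      - pd2 1 (single C κ Mz) P
      + Complex.I * β * single C κ (fun Q => Mτ Q * (C.τ Q 1 : ℂ)) P,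
    -(1 / (Complex.I * kv)) * pd2 1 (antiDouble C κ Jτ) P
      + (β / kv : ℂ) * pd2 1 (single C κ Jz) P
      + k ^ 2 / (Complex.I * kv) * single C κ (fun Q => Jτ Q * (C.τ Q 1 : ℂ)) P
      + pd2 0 (single C κ Mz) P
      - Complex.I * β * single C κ (fun Q => Mτ Q * (C.τ Q 0 : ℂ)) P,
    -(β / kv : ℂ) * antiDouble C κ Jτ P
      + (k ^ 2 - (β : ℂ) ^ 2) / (Complex.I * kv) * single C κ Jz P
      + double C κ Mτ P]

/-- The magnetic field `(H_x, H_y, H_z)` in terms of the layer potentials in the plane. -/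
def modeH (C : CrossSection) (kv : ℝ) (k κ : ℂ) (β : ℝ) (Jτ Jz Mτ Mz : Plane → ℂ) (P : Plane) :
    Fin 3 → ℂ :=
  ![1 / (Complex.I * kv) * pd2 0 (antiDouble C κ Mτ) P
      - (β / kv : ℂ) * pd2 0 (single C κ Mz) P
      - k ^ 2 / (Complex.I * kv) * single C κ (fun Q => Mτ Q * (C.τ Q 0 : ℂ)) P
      - k ^ 2 / (kv : ℂ) ^ 2 * pd2 1 (single C κ Jz) P
      + Complex.I * β * (k ^ 2 / (kv : ℂ) ^ 2) * single C κ (fun Q => Jτ Q * (C.τ Q 1 : ℂ)) P,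
    1 / (Complex.I * kv) * pd2 1 (antiDouble C κ Mτ) P
      - (β / kv : ℂ) * pd2 1 (single C κ Mz) P
      - k ^ 2 / (Complex.I * kv) * single C κ (fun Q => Mτ Q * (C.τ Q 1 : ℂ)) P
      + k ^ 2 / (kv : ℂ) ^ 2 * pd2 0 (single C κ Jz) P
      - Complex.I * β * (k ^ 2 / (kv : ℂ) ^ 2) * single C κ (fun Q => Jτ Q * (C.τ Q 0 : ℂ)) P,
    (β / kv : ℂ) * antiDouble C κ Mτ P
      - (k ^ 2 - (β : ℂ) ^ 2) / (Complex.I * kv) * single C κ Mz P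
      + k ^ 2 / (kv : ℂ) ^ 2 * double C κ Jτ P]

end Waveguide

end

/-!
The potential in space of a density `e^{iβz} a(x, y)` on the cylinder is `e^{iβz}` times the single
layer potential of `a` in the plane with wave number `κ`, `κ² = k² - β²` (`single3_wave`). Once this
is known, everything takes place in the plane: off the curve `S[a]` is smooth and solves the
Helmholtz equation, `T` is minus a divergence and `D` minus a curl of single layer potentials
(`antiDouble_eq`, `double_eq`), and the formulas for the fields are the identity
`curl curl = grad div - Δ` for travelling waves.

By Fubini the reduction to the plane rests on the line integral
`∫ e^{ikR} / R e^{iβz} dz = iπ H₀⁽¹⁾(κρ)`, where `R = √(ρ² + z²)`. In the variable `s = ρ² / 4` the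
Bessel equation becomes `s f'' + f' + κ² f = 0`. The argument has two steps.

* For `Im k > 0` the integral converges absolutely. Differentiation under the integral sign and one
  integration by parts in `z` show that it solves the equation (`besselSol_lineIntegral`). A
  solution is determined by the constant in its expansion `-log s + c + o(1)` at `s = 0`, because its
  Wronskians with the regular and the singular solution, multiplied by `s`, are constant
  (`BesselSol.eq_hankelSol`). The constant of the line integral comes from integrating `1 / R` to `log (z + R)` and from the Laplace
  transform of the logarithm, whose value at `1` is `Γ'(1) = -γ`
  (`tendsto_halfLineIntegral_add_log`).
* For real `k` the integral converges only conditionally. Integrating the oscillating factors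
  `e^{i(k ± β)z}` bounds the truncation error by a multiple of the reciprocal height, uniformly for
  `Im k ≥ 0` in a neighbourhood of the given `k` and for bounded `ρ`, and the case of real `k`
  follows by vanishing absorption (`norm_truncLine_sub_le`). Here `k ≠ ± β` is used. The same bound lets the limit of the truncated
  integrals pass under the integral over the curve (`tendsto_truncSingle3`).
-/

noncomputable section

namespace Waveguide

/-! ### The Bessel equation and its solutions -/

/-- The coefficients decay so fast that the power series is an entire function. The class is
stable under termwise differentiation. -/
def FactorialDecay (c : ℕ → ℂ) : Prop :=
  ∃ A B : ℝ, 0 ≤ A ∧ 0 ≤ B ∧ ∀ m, ‖c m‖ ≤ A * B ^ m / m.factorial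

/-- The sum of the power series with coefficients `c`. -/
def powerSum (c : ℕ → ℂ) (w : ℂ) : ℂ := ∑' m, c m * w ^ m

/-- The coefficients of the termwise derivative. -/
def derivCoeff (c : ℕ → ℂ) (m : ℕ) : ℂ := (m + 1) * c (m + 1)

lemma norm_natCast_add_one (m : ℕ) : ‖((m : ℂ) + 1)‖ = (m : ℝ) + 1 := by
  rw [← Nat.cast_add_one, Complex.norm_natCast, Nat.cast_add_one]

lemma FactorialDecay.deriv {c : ℕ → ℂ} (hc : FactorialDecay c) :
    FactorialDecay (derivCoeff c) := by
  obtain ⟨A, B, hA, hB, h⟩ := hc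
  refine ⟨A * B, B, by positivity, hB, fun m => ?_⟩
  have h1 := h (m + 1)
  have h2 := norm_natCast_add_one m
  rw [derivCoeff, norm_mul, h2]
  calc ((m : ℝ) + 1) * ‖c (m + 1)‖ ≤ (m + 1) * (A * B ^ (m + 1) / (m + 1).factorial) := by gcongr
    _ = A * B * B ^ m / m.factorial := by
      rw [Nat.factorial_succ]; push_cast; field_simp; ring

lemma FactorialDecay.summable {c : ℕ → ℂ} (hc : FactorialDecay c) (w : ℂ) :
    Summable fun m => c m * w ^ m := by
  obtain ⟨A, B, hA, hB, h⟩ := hc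
  refine Summable.of_norm_bounded
    (g := fun m : ℕ => A * ((B * ‖w‖) ^ m / m.factorial))
    ((Real.summable_pow_div_factorial _).mul_left A) fun m => ?_
  rw [norm_mul, norm_pow]
  calc ‖c m‖ * ‖w‖ ^ m ≤ A * B ^ m / m.factorial * ‖w‖ ^ m := by gcongr; exact h m
    _ = _ := by rw [mul_pow]; ring

lemma FactorialDecay.hasDerivAt {c : ℕ → ℂ} (hc : FactorialDecay c) (w : ℂ) :
    HasDerivAt (powerSum c) (powerSum (derivCoeff c) w) w := by
  obtain ⟨A, B, hA, hB, h⟩ := hc.deriv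
  have key : ∀ m : ℕ, ∀ y : ℂ, y ∈ Metric.ball (0 : ℂ) (‖w‖ + 1) →
      HasDerivAt (fun z => c m * z ^ m) (c m * (m * y ^ (m - 1))) y := fun m y _ =>
    (hasDerivAt_pow m y).const_mul (c m)
  have hu : Summable fun m : ℕ => ‖c m‖ * (m * (‖w‖ + 1) ^ (m - 1)) := by
    rw [← summable_nat_add_iff 1]
    have := (hc.deriv.summable ((‖w‖ + 1 : ℝ) : ℂ)).norm
    refine this.congr fun m => ?_
    have h2 := norm_natCast_add_one m
    rw [derivCoeff, norm_mul, norm_mul, h2, norm_pow, Complex.norm_real,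
      Real.norm_of_nonneg (by positivity)]
    push_cast
    ring
  have hb : ∀ m : ℕ, ∀ y : ℂ, y ∈ Metric.ball (0 : ℂ) (‖w‖ + 1) →
      ‖c m * (m * y ^ (m - 1))‖ ≤ ‖c m‖ * (m * (‖w‖ + 1) ^ (m - 1)) := by
    intro m y hy
    rw [mem_ball_zero_iff] at hy
    rw [norm_mul, norm_mul, norm_pow, Complex.norm_natCast]
    gcongr
  have hw : w ∈ Metric.ball (0 : ℂ) (‖w‖ + 1) := by simp
  have := hasDerivAt_tsum_of_isPreconnected hu Metric.isOpen_ball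
    (convex_ball (0 : ℂ) (‖w‖ + 1)).isPreconnected key hb hw (hc.summable w) hw
  have hs : Summable fun m : ℕ => c m * (m * w ^ (m - 1)) :=
    Summable.of_norm_bounded hu fun m => hb m w hw
  refine this.congr_deriv ?_
  rw [hs.tsum_eq_zero_add]
  simp only [powerSum, derivCoeff]
  simp only [Nat.cast_zero, zero_mul, mul_zero, zero_add, Nat.cast_add, Nat.cast_one,
    Nat.add_sub_cancel]
  exact tsum_congr fun m => by ring

lemma powerSum_zero (c : ℕ → ℂ) : powerSum c 0 = c 0 := by
  rw [powerSum, tsum_eq_single 0 (fun m hm => by simp [hm])]; simp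

lemma FactorialDecay.contDiff {c : ℕ → ℂ} (hc : FactorialDecay c) :
    ContDiff ℂ ∞ (powerSum c) :=
  Differentiable.contDiff fun w => (hc.hasDerivAt w).differentiableAt

/-- The operator `w f'' + f'` multiplies the `m`-th coefficient of a power series by `m ^ 2` and
lowers the degree by one. -/
lemma FactorialDecay.bessel_operator {c d : ℕ → ℂ} (hc : FactorialDecay c)
    (hcd : ∀ m : ℕ, ((m : ℂ) + 1) ^ 2 * c (m + 1) = d m) (w : ℂ) :
    w * powerSum (derivCoeff (derivCoeff c)) w
      + powerSum (derivCoeff c) w = powerSum d w := by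
  have h1 := hc.deriv.summable w
  have h2 := hc.deriv.deriv.summable w
  have h3 : Summable fun m : ℕ => (m : ℂ) * derivCoeff c m * w ^ m := by
    rw [← summable_nat_add_iff 1]
    refine (h2.mul_left w).congr fun m => ?_
    simp only [derivCoeff]; push_cast; ring
  have h4 : w * powerSum (derivCoeff (derivCoeff c)) w
      = ∑' m : ℕ, (m : ℂ) * derivCoeff c m * w ^ m := by
    rw [h3.tsum_eq_zero_add, powerSum, ← tsum_mul_left]
    simp only [Nat.cast_zero, zero_mul, zero_add]
    refine tsum_congr fun m => ?_
    simp only [derivCoeff]; push_cast; ring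
  rw [h4, powerSum, powerSum, ← h3.tsum_add h1]
  refine tsum_congr fun m => ?_
  rw [← hcd m]
  simp only [derivCoeff]; ring

/-- The coefficients of `J₀(z)` in powers of `z ^ 2 / 4`. -/
def coeffJ (m : ℕ) : ℂ := (-1) ^ m / (m.factorial : ℂ) ^ 2

/-- The coefficients of the regular part of `Y₀(z)` in powers of `z ^ 2 / 4`. -/
def coeffY (m : ℕ) : ℂ := (-1) ^ m * ((harmonic m : ℚ) : ℂ) / (m.factorial : ℂ) ^ 2

lemma factorialDecay_coeffJ : FactorialDecay coeffJ := by
  refine ⟨1, 1, zero_le_one, zero_le_one, fun m => ?_⟩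
  have h1 : (1 : ℝ) ≤ m.factorial := by exact_mod_cast m.factorial_pos
  simp only [coeffJ, norm_div, norm_pow, norm_neg, norm_one, one_pow, Complex.norm_natCast, mul_one]
  gcongr
  nlinarith

lemma harmonic_le_self (m : ℕ) : harmonic m ≤ m := by
  induction m with
  | zero => simp
  | succ m ih =>
    rw [harmonic_succ]
    push_cast
    have : ((m : ℚ) + 1)⁻¹ ≤ 1 := inv_le_one_of_one_le₀ (by linarith [m.cast_nonneg (α := ℚ)])
    linarith

lemma factorialDecay_coeffY : FactorialDecay coeffY := by
  refine ⟨1, 1, zero_le_one, zero_le_one, fun m => ?_⟩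
  have h1 : (0 : ℝ) < m.factorial := by exact_mod_cast m.factorial_pos
  have h0 : 0 ≤ harmonic m := by
    rw [harmonic]; positivity
  have h2 : ((harmonic m : ℚ) : ℝ) ≤ m.factorial := by
    have := (harmonic_le_self m).trans (by exact_mod_cast m.self_le_factorial : (m : ℚ) ≤ m.factorial)
    exact_mod_cast this
  have h3 : ‖((harmonic m : ℚ) : ℂ)‖ = ((harmonic m : ℚ) : ℝ) := by
    have : ((harmonic m : ℚ) : ℂ) = (((harmonic m : ℚ) : ℝ) : ℂ) := by push_cast; rfl
    rw [this, Complex.norm_real, Real.norm_of_nonneg (by exact_mod_cast h0)]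
  simp only [coeffY, norm_div, norm_mul, norm_pow, norm_neg, norm_one, one_pow, Complex.norm_natCast,
    mul_one, one_mul, h3]
  rw [div_le_div_iff₀ (by positivity) h1]
  nlinarith

lemma bessel_coeffJ (w : ℂ) :
    w * powerSum (derivCoeff (derivCoeff coeffJ)) w + powerSum (derivCoeff coeffJ) w
      = - powerSum coeffJ w := by
  rw [factorialDecay_coeffJ.bessel_operator (d := fun m => - coeffJ m)]
  · simp only [powerSum, neg_mul, tsum_neg]
  · intro m
    have : ((m : ℂ) + 1) ≠ 0 := by exact_mod_cast m.succ_ne_zero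
    have h2 : (m.factorial : ℂ) ≠ 0 := by exact_mod_cast m.factorial_ne_zero
    simp only [coeffJ, Nat.factorial_succ, pow_succ]; push_cast; field_simp

lemma bessel_coeffY (w : ℂ) :
    w * powerSum (derivCoeff (derivCoeff coeffY)) w + powerSum (derivCoeff coeffY) w
      = powerSum (derivCoeff coeffJ) w - powerSum coeffY w := by
  rw [factorialDecay_coeffY.bessel_operator (d := fun m => derivCoeff coeffJ m - coeffY m)]
  · rw [powerSum, powerSum, powerSum, ← (factorialDecay_coeffJ.deriv.summable w).tsum_sub
      (factorialDecay_coeffY.summable w)]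
    exact tsum_congr fun m => by ring
  · intro m
    have : ((m : ℂ) + 1) ≠ 0 := by exact_mod_cast m.succ_ne_zero
    have h2 : (m.factorial : ℂ) ≠ 0 := by exact_mod_cast m.factorial_ne_zero
    simp only [coeffJ, coeffY, derivCoeff, Nat.factorial_succ, pow_succ, harmonic_succ]
    push_cast; field_simp; ring

lemma besselJ0_eq (z : ℂ) : besselJ0 z = powerSum coeffJ (z ^ 2 / 4) :=
  tsum_congr fun m => by rw [coeffJ]; ring

lemma besselY0_eq (z : ℂ) : besselY0 z =
    2 / (Real.pi : ℂ) * ((Complex.log (z / 2) + (Real.eulerMascheroniConstant : ℂ)) *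
      powerSum coeffJ (z ^ 2 / 4) - powerSum coeffY (z ^ 2 / 4)) := by
  have : (∑' m : ℕ, (-1 : ℂ) ^ m * ((harmonic m : ℚ) : ℂ) * (z ^ 2 / 4) ^ m
      / ((m.factorial : ℂ) ^ 2)) = powerSum coeffY (z ^ 2 / 4) :=
    tsum_congr fun m => by rw [coeffY]; ring
  rw [besselY0, this, besselJ0_eq]; ring

/-- The constant `iπ - 2γ - 2 log κ` in the expansion of `iπ H₀⁽¹⁾(κρ)` at `ρ = 0`. -/
def logConst (κ : ℂ) : ℂ :=
  Complex.I * Real.pi - 2 * (Real.eulerMascheroniConstant : ℂ) - 2 * Complex.log κ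

/-- The regular solution `J₀(κρ)` as a function of `s = ρ ^ 2 / 4`. -/
def regularSol (κ : ℂ) (s : ℝ) : ℂ := powerSum coeffJ (κ ^ 2 * s)

/-- The function `iπ H₀⁽¹⁾(κρ)` as a function of `s = ρ ^ 2 / 4`. In this variable the Bessel
equation reads `s f'' + f' + κ² f = 0`. -/
def hankelSol (κ : ℂ) (s : ℝ) : ℂ :=
  (logConst κ - Real.log s) * powerSum coeffJ (κ ^ 2 * s) + 2 * powerSum coeffY (κ ^ 2 * s)

/-- The logarithm splits without a branch correction because `ρ` is positive. -/
lemma hankel0_eq {κ : ℂ} (hκ : κ ≠ 0) {ρ : ℝ} (hρ : 0 < ρ) :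
    Complex.I * Real.pi * hankel0 (κ * ρ) = hankelSol κ (ρ ^ 2 / 4) := by
  have h1 : Complex.log (κ * ρ / 2) = Complex.log κ + ((Real.log (ρ ^ 2 / 4) / 2 : ℝ) : ℂ) := by
    have e : κ * ρ / 2 = ((ρ / 2 : ℝ) : ℂ) * κ := by push_cast; ring
    have e2 : Real.log (ρ ^ 2 / 4) / 2 = Real.log (ρ / 2) := by
      rw [show ρ ^ 2 / 4 = (ρ / 2) ^ 2 by ring, Real.log_pow]; push_cast; ring
    rw [e, Complex.log_ofReal_mul (by positivity) hκ, e2]; ring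
  have h2 : (κ * ρ) ^ 2 / 4 = κ ^ 2 * ((ρ ^ 2 / 4 : ℝ) : ℂ) := by push_cast; ring
  have hpi : (Real.pi : ℂ) ≠ 0 := by exact_mod_cast Real.pi_ne_zero
  rw [hankel0, besselY0_eq, besselJ0_eq, h1, h2, hankelSol, logConst]
  push_cast
  have hI : Complex.I ^ 2 = -1 := Complex.I_sq
  field_simp
  ring_nf
  simp only [hI]
  ring

/-- `s f'' + f' + κ² f = 0` on the half line, with `f₁` and `f₂` the first two derivatives. -/
structure BesselSol (κ : ℂ) (f f₁ f₂ : ℝ → ℂ) : Prop where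
  deriv : ∀ s, 0 < s → HasDerivAt f (f₁ s) s
  deriv₂ : ∀ s, 0 < s → HasDerivAt f₁ (f₂ s) s
  eq : ∀ s, 0 < s → s * f₂ s + f₁ s + κ ^ 2 * f s = 0

lemma FactorialDecay.hasDerivAt_scale {c : ℕ → ℂ} (hc : FactorialDecay c) (a : ℂ) (s : ℝ) :
    HasDerivAt (fun s : ℝ => powerSum c (a * s)) (a * powerSum (derivCoeff c) (a * s)) s := by
  have h : HasDerivAt (fun s : ℝ => a * (s : ℂ)) a s := by
    simpa using (Complex.ofRealCLM.hasDerivAt (x := s)).const_mul a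
  have := (hc.hasDerivAt (a * s)).comp s h
  rw [mul_comm]; exact this

lemma besselSol_regularSol (κ : ℂ) : BesselSol κ (regularSol κ)
    (fun s => κ ^ 2 * powerSum (derivCoeff coeffJ) (κ ^ 2 * s))
    (fun s => κ ^ 2 * (κ ^ 2 * powerSum (derivCoeff (derivCoeff coeffJ)) (κ ^ 2 * s))) where
  deriv s _ := factorialDecay_coeffJ.hasDerivAt_scale _ s
  deriv₂ s _ := (factorialDecay_coeffJ.deriv.hasDerivAt_scale _ s).const_mul _
  eq s _ := by
    have := bessel_coeffJ (κ ^ 2 * s)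
    rw [regularSol]
    linear_combination κ ^ 2 * this

/-- The derivative of `hankelSol κ`. -/
def hankelSol₁ (κ : ℂ) (s : ℝ) : ℂ :=
  -(s : ℂ)⁻¹ * powerSum coeffJ (κ ^ 2 * s)
    + (logConst κ - Real.log s) * (κ ^ 2 * powerSum (derivCoeff coeffJ) (κ ^ 2 * s))
    + 2 * (κ ^ 2 * powerSum (derivCoeff coeffY) (κ ^ 2 * s))

/-- The second derivative of `hankelSol κ`. -/
def hankelSol₂ (κ : ℂ) (s : ℝ) : ℂ :=
  ((s : ℂ) ^ 2)⁻¹ * powerSum coeffJ (κ ^ 2 * s)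
    - 2 * (s : ℂ)⁻¹ * (κ ^ 2 * powerSum (derivCoeff coeffJ) (κ ^ 2 * s))
    + (logConst κ - Real.log s) *
      (κ ^ 2 * (κ ^ 2 * powerSum (derivCoeff (derivCoeff coeffJ)) (κ ^ 2 * s)))
    + 2 * (κ ^ 2 * (κ ^ 2 * powerSum (derivCoeff (derivCoeff coeffY)) (κ ^ 2 * s)))

lemma besselSol_hankelSol (κ : ℂ) : BesselSol κ (hankelSol κ) (hankelSol₁ κ) (hankelSol₂ κ) where
  deriv s hs := by
    have hl : HasDerivAt (fun s : ℝ => logConst κ - (Real.log s : ℂ)) (-(s : ℂ)⁻¹) s := by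
      simpa using ((Real.hasDerivAt_log hs.ne').ofReal_comp).const_sub (logConst κ)
    have := (hl.mul (factorialDecay_coeffJ.hasDerivAt_scale (κ ^ 2) s)).add
      ((factorialDecay_coeffY.hasDerivAt_scale (κ ^ 2) s).const_mul 2)
    exact this
  deriv₂ s hs := by
    have hs' : (s : ℂ) ≠ 0 := by exact_mod_cast hs.ne'
    have hl : HasDerivAt (fun s : ℝ => logConst κ - (Real.log s : ℂ)) (-(s : ℂ)⁻¹) s := by
      simpa using ((Real.hasDerivAt_log hs.ne').ofReal_comp).const_sub (logConst κ)
    have hi : HasDerivAt (fun s : ℝ => -(s : ℂ)⁻¹) (((s : ℂ) ^ 2)⁻¹) s := by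
      have := ((hasDerivAt_inv hs.ne').ofReal_comp).neg
      simp only [Complex.ofReal_neg, Complex.ofReal_inv, Complex.ofReal_pow, neg_neg] at this
      exact this
    have := ((hi.mul (factorialDecay_coeffJ.hasDerivAt_scale (κ ^ 2) s)).add
      (hl.mul ((factorialDecay_coeffJ.deriv.hasDerivAt_scale (κ ^ 2) s).const_mul (κ ^ 2)))).add
      (((factorialDecay_coeffY.deriv.hasDerivAt_scale (κ ^ 2) s).const_mul (κ ^ 2)).const_mul 2)
    refine this.congr_deriv ?_
    simp only [hankelSol₂]; ring
  eq s hs := by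
    have hs' : (s : ℂ) ≠ 0 := by exact_mod_cast hs.ne'
    have h1 := bessel_coeffJ (κ ^ 2 * s)
    have h2 := bessel_coeffY (κ ^ 2 * s)
    rw [hankelSol, hankelSol₁, hankelSol₂]
    generalize powerSum coeffJ (κ ^ 2 * s) = j at *
    generalize powerSum coeffY (κ ^ 2 * s) = y at *
    generalize powerSum (derivCoeff coeffJ) (κ ^ 2 * s) = j1 at *
    generalize powerSum (derivCoeff coeffY) (κ ^ 2 * s) = y1 at *
    generalize powerSum (derivCoeff (derivCoeff coeffJ)) (κ ^ 2 * s) = j2 at *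
    generalize powerSum (derivCoeff (derivCoeff coeffY)) (κ ^ 2 * s) = y2 at *
    have e1 : (s : ℂ) * ((s : ℂ) ^ 2)⁻¹ = (s : ℂ)⁻¹ := by field_simp
    have e2 : (s : ℂ) * (s : ℂ)⁻¹ = 1 := by field_simp
    linear_combination (logConst κ - Real.log s) * κ ^ 2 * h1 + 2 * κ ^ 2 * h2 + j * e1
      - 2 * κ ^ 2 * j1 * e2

/-! ### Uniqueness for the Bessel equation -/

lemma hasDerivAt_ofReal (s : ℝ) : HasDerivAt (fun s : ℝ => (s : ℂ)) 1 s := by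
  simpa using (hasDerivAt_id s).ofReal_comp

lemma BesselSol.sub {κ : ℂ} {f f₁ f₂ g g₁ g₂ : ℝ → ℂ} (hf : BesselSol κ f f₁ f₂)
    (hg : BesselSol κ g g₁ g₂) :
    BesselSol κ (fun s => f s - g s) (fun s => f₁ s - g₁ s) (fun s => f₂ s - g₂ s) where
  deriv s hs := (hf.deriv s hs).sub (hg.deriv s hs)
  deriv₂ s hs := (hf.deriv₂ s hs).sub (hg.deriv₂ s hs)
  eq s hs := by linear_combination hf.eq s hs - hg.eq s hs

/-- The Wronskian of two solutions, multiplied by `s`, is constant. -/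
lemma BesselSol.exists_wronskian {κ : ℂ} {f f₁ f₂ g g₁ g₂ : ℝ → ℂ} (hf : BesselSol κ f f₁ f₂)
    (hg : BesselSol κ g g₁ g₂) :
    ∃ c : ℂ, ∀ s : ℝ, 0 < s → s * (f₁ s * g s - f s * g₁ s) = c := by
  have hd : ∀ s : ℝ, 0 < s →
      HasDerivAt (fun s : ℝ => (s : ℂ) * (f₁ s * g s - f s * g₁ s)) 0 s := by
    intro s hs
    have hid := hasDerivAt_ofReal s
    refine (hid.mul (((hf.deriv₂ s hs).mul (hg.deriv s hs)).sub
      ((hf.deriv s hs).mul (hg.deriv₂ s hs)))).congr_deriv ?_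
    simp only [Pi.mul_apply, Pi.sub_apply]
    linear_combination g s * hf.eq s hs - f s * hg.eq s hs
  obtain ⟨c, hc⟩ := isOpen_Ioi.exists_is_const_of_deriv_eq_zero isPreconnected_Ioi
    (fun s hs => (hd s hs).differentiableAt.differentiableWithinAt) (fun s hs => (hd s hs).deriv)
  exact ⟨c, fun s hs => hc s hs⟩

lemma FactorialDecay.tendsto_zero {c : ℕ → ℂ} (hc : FactorialDecay c) (a : ℂ) :
    Tendsto (fun s : ℝ => powerSum c (a * s)) (𝓝[>] 0) (𝓝 (c 0)) := by
  have := (hc.hasDerivAt_scale a 0).continuousAt.tendsto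
  simp only [Complex.ofReal_zero, mul_zero, powerSum_zero] at this
  exact this.mono_left nhdsWithin_le_nhds

lemma tendsto_ofReal_zero : Tendsto (fun s : ℝ => (s : ℂ)) (𝓝[>] 0) (𝓝 0) := by
  have : Tendsto (fun s : ℝ => (s : ℂ)) (𝓝 0) (𝓝 ((0 : ℝ) : ℂ)) :=
    Complex.continuous_ofReal.tendsto 0
  exact this.mono_left nhdsWithin_le_nhds

lemma tendsto_mul_log_zero :
    Tendsto (fun s : ℝ => (s : ℂ) * (Real.log s : ℂ)) (𝓝[>] 0) (𝓝 0) := by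
  have h := tendsto_log_mul_rpow_nhdsGT_zero (r := 1) zero_lt_one
  have := (Complex.continuous_ofReal.tendsto 0).comp h
  simp only [Complex.ofReal_zero] at this
  refine this.congr fun s => ?_
  simp [mul_comm]

lemma coeffJ_zero : coeffJ 0 = 1 := by simp [coeffJ]

lemma coeffY_zero : coeffY 0 = 0 := by simp [coeffY]

/-- The expansion of `iπ H₀⁽¹⁾` at the origin. -/
lemma tendsto_hankelSol_add_log (κ : ℂ) :
    Tendsto (fun s : ℝ => hankelSol κ s + Real.log s) (𝓝[>] 0) (𝓝 (logConst κ)) := by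
  have hJ := factorialDecay_coeffJ.tendsto_zero (κ ^ 2)
  have hY := factorialDecay_coeffY.tendsto_zero (κ ^ 2)
  rw [coeffJ_zero] at hJ
  rw [coeffY_zero] at hY
  -- the difference quotient of the regular solution controls `log s * (J - 1)`
  have hd := (factorialDecay_coeffJ.hasDerivAt_scale (κ ^ 2) 0).tendsto_slope_zero_right
  simp only [zero_add, Complex.ofReal_zero, mul_zero, powerSum_zero,
    coeffJ_zero] at hd
  have hlog := tendsto_mul_log_zero.mul hd
  have := ((hJ.const_mul (logConst κ)).sub hlog).add (hY.const_mul 2)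
  simp only [mul_one, zero_mul, sub_zero, mul_zero, add_zero] at this
  refine this.congr' ?_
  filter_upwards [self_mem_nhdsWithin] with s hs
  have hs' : (s : ℂ) ≠ 0 := by exact_mod_cast (ne_of_gt hs)
  simp only [Complex.real_smul, hankelSol, Complex.ofReal_inv]
  field_simp
  ring

/-- The Wronskian of the regular and the singular solution tends to a nonzero limit. -/
lemma tendsto_wronskian (κ : ℂ) :
    Tendsto (fun s : ℝ => (s : ℂ) * (κ ^ 2 * powerSum (derivCoeff coeffJ) (κ ^ 2 * s) *
      hankelSol κ s - regularSol κ s * hankelSol₁ κ s)) (𝓝[>] 0) (𝓝 1) := by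
  have hJ := factorialDecay_coeffJ.tendsto_zero (κ ^ 2)
  have hY := factorialDecay_coeffY.tendsto_zero (κ ^ 2)
  have hJ' := factorialDecay_coeffJ.deriv.tendsto_zero (κ ^ 2)
  have hY' := factorialDecay_coeffY.deriv.tendsto_zero (κ ^ 2)
  rw [coeffJ_zero] at hJ
  rw [coeffY_zero] at hY
  have h0 := tendsto_ofReal_zero
  have := ((h0.mul ((hJ'.const_mul (κ ^ 2)).mul (hY.const_mul 2))).add (hJ.mul hJ)).sub
    (h0.mul (hJ.mul ((hY'.const_mul (κ ^ 2)).const_mul 2)))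
  simp only [mul_one, zero_mul, sub_zero, mul_zero, zero_add] at this
  refine this.congr' ?_
  filter_upwards [self_mem_nhdsWithin] with s hs
  have hs' : (s : ℂ) ≠ 0 := by exact_mod_cast (ne_of_gt hs)
  simp only [hankelSol, hankelSol₁, regularSol]
  field_simp
  ring

/-- A solution of the Bessel equation that tends to zero at the origin vanishes. -/
lemma BesselSol.eq_zero {κ : ℂ} {u u₁ u₂ : ℝ → ℂ} (hu : BesselSol κ u u₁ u₂)
    (h0 : Tendsto u (𝓝[>] 0) (𝓝 0)) {s : ℝ} (hs : 0 < s) : u s = 0 := by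
  obtain ⟨c₁, h₁⟩ := hu.exists_wronskian (besselSol_regularSol κ)
  obtain ⟨c₂, h₂⟩ := hu.exists_wronskian (besselSol_hankelSol κ)
  obtain ⟨c₃, h₃⟩ := (besselSol_regularSol κ).exists_wronskian (besselSol_hankelSol κ)
  have hc₃ : c₃ = 1 := by
    refine tendsto_nhds_unique (Tendsto.congr' ?_ tendsto_const_nhds) (tendsto_wronskian κ)
    filter_upwards [self_mem_nhdsWithin] with s hs
    exact (h₃ s hs).symm
  subst hc₃
  have key : ∀ s : ℝ, 0 < s → u s = regularSol κ s * c₂ - hankelSol κ s * c₁ := by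
    intro s hs
    linear_combination (-u s) * h₃ s hs + regularSol κ s * h₂ s hs - hankelSol κ s * h₁ s hs
  have hJ : Tendsto (regularSol κ) (𝓝[>] 0) (𝓝 1) := by
    have := factorialDecay_coeffJ.tendsto_zero (κ ^ 2)
    rwa [coeffJ_zero] at this
  have hH := tendsto_hankelSol_add_log κ
  -- divided by the logarithm, the relation shows that the singular part is absent
  have hinv : Tendsto (fun s : ℝ => ((Real.log s : ℂ))⁻¹) (𝓝[>] 0) (𝓝 0) := by
    have := (Complex.continuous_ofReal.tendsto 0).comp
      (tendsto_inv_atBot_zero.comp Real.tendsto_log_nhdsGT_zero)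
    simp only [Complex.ofReal_zero] at this
    refine this.congr fun s => ?_
    simp
  have hc₁ : c₁ = 0 := by
    have h := (hinv.mul h0).sub ((hinv.mul (hJ.mul_const c₂)).sub
      ((hinv.mul hH).mul_const c₁))
    simp only [zero_mul, sub_zero] at h
    refine tendsto_nhds_unique (Tendsto.congr' ?_ (tendsto_const_nhds (x := c₁))) h
    filter_upwards [self_mem_nhdsWithin, Ioo_mem_nhdsGT (zero_lt_one' ℝ)] with s hs hs1
    have hl : (Real.log s : ℂ) ≠ 0 := by
      exact_mod_cast (Real.log_neg hs1.1 hs1.2).ne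
    rw [key s hs]
    field_simp
    ring
  subst hc₁
  have hc₂ : c₂ = 0 := by
    have h := hJ.mul_const c₂
    rw [one_mul] at h
    refine tendsto_nhds_unique (Tendsto.congr' ?_ h) h0
    filter_upwards [self_mem_nhdsWithin] with s hs
    rw [key s hs]; ring
  rw [key s hs, hc₂]; ring

/-- A solution of the Bessel equation with the expansion of `iπ H₀⁽¹⁾` at the origin is
`iπ H₀⁽¹⁾`. -/
lemma BesselSol.eq_hankelSol {κ : ℂ} {u u₁ u₂ : ℝ → ℂ} (hu : BesselSol κ u u₁ u₂)
    (h0 : Tendsto (fun s : ℝ => u s + Real.log s) (𝓝[>] 0) (𝓝 (logConst κ)))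
    {s : ℝ} (hs : 0 < s) : u s = hankelSol κ s := by
  have h := h0.sub (tendsto_hankelSol_add_log κ)
  rw [sub_self] at h
  refine sub_eq_zero.1 ((hu.sub (besselSol_hankelSol κ)).eq_zero (h.congr fun s => ?_) hs)
  ring

/-! ### The Fourier integral of the spherical wave solves the Bessel equation -/

/-- The function `e^{ikr} / r^m` in terms of `q = r ^ 2`. -/
def waveTerm (k : ℂ) (m : ℕ) (q : ℝ) : ℂ :=
  Complex.exp (Complex.I * k * (√q : ℝ)) / ((√q : ℝ) : ℂ) ^ m

lemma norm_exp_I_mul (k : ℂ) (r : ℝ) :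
    ‖Complex.exp (Complex.I * k * r)‖ = Real.exp (-(k.im * r)) := by
  rw [Complex.norm_exp]; congr 1; simp

lemma norm_exp_I_mul_real (β x : ℝ) : ‖Complex.exp (Complex.I * β * x)‖ = 1 := by
  rw [norm_exp_I_mul]; simp

lemma hasDerivAt_waveTerm (k : ℂ) (m : ℕ) {q : ℝ} (hq : 0 < q) :
    HasDerivAt (waveTerm k m)
      ((Complex.I * k * waveTerm k (m + 1) q - m * waveTerm k (m + 2) q) / 2) q := by
  have hr : 0 < √q := Real.sqrt_pos.2 hq
  have hr' : ((√q : ℝ) : ℂ) ≠ 0 := by exact_mod_cast hr.ne'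
  have h1 : HasDerivAt (fun q : ℝ => ((√q : ℝ) : ℂ)) (1 / (2 * ((√q : ℝ) : ℂ))) q := by
    simpa using (Real.hasDerivAt_sqrt hq.ne').ofReal_comp
  have h2 := ((h1.const_mul (Complex.I * k)).cexp).div (h1.pow m) (pow_ne_zero m hr')
  refine h2.congr_deriv ?_
  simp only [waveTerm, Pi.pow_apply]
  rcases m with _ | m
  · simp only [Nat.cast_zero, pow_zero, zero_mul, mul_zero, sub_zero, zero_add, pow_one]
    field_simp
  · simp only [Nat.add_sub_cancel, pow_succ]
    field_simp

lemma mul_waveTerm_add_two (k : ℂ) (m : ℕ) {q : ℝ} (hq : 0 < q) :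
    q * waveTerm k (m + 2) q = waveTerm k m q := by
  have hr : 0 < √q := Real.sqrt_pos.2 hq
  have hr' : ((√q : ℝ) : ℂ) ≠ 0 := by exact_mod_cast hr.ne'
  have h : (q : ℂ) = ((√q : ℝ) : ℂ) ^ 2 := by exact_mod_cast (Real.sq_sqrt hq.le).symm
  simp only [waveTerm]
  rw [h, pow_add]
  field_simp

lemma norm_waveTerm (k : ℂ) (m : ℕ) (q : ℝ) :
    ‖waveTerm k m q‖ = Real.exp (-(k.im * √q)) / (√q) ^ m := by
  rw [waveTerm, norm_div, norm_exp_I_mul, norm_pow, Complex.norm_real,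
    Real.norm_of_nonneg (Real.sqrt_nonneg q)]

lemma norm_waveTerm_le {k : ℂ} (hk : 0 ≤ k.im) (m : ℕ) {q₀ q z : ℝ} (hq₀ : 0 < q₀)
    (hq : q₀ ≤ q) (hz : z ^ 2 ≤ q) :
    ‖waveTerm k m q‖ ≤ 1 / (√q₀) ^ m * Real.exp (-(k.im * |z|)) := by
  have h0 : 0 < √q₀ := Real.sqrt_pos.2 hq₀
  rw [norm_waveTerm, div_eq_mul_inv, mul_comm, ← one_div]
  gcongr
  exact Real.abs_le_sqrt hz

lemma integrable_exp_neg_mul_abs {c : ℝ} (hc : 0 < c) :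
    Integrable fun z : ℝ => Real.exp (-(c * |z|)) := by
  rw [← integrableOn_univ, ← Set.Iic_union_Ioi (a := (0 : ℝ))]
  refine ((integrableOn_exp_mul_Iic hc 0).congr_fun (fun z hz => ?_) measurableSet_Iic).union
    ((integrableOn_exp_mul_Ioi (neg_lt_zero.2 hc) 0).congr_fun (fun z hz => ?_) measurableSet_Ioi)
  · simp only [abs_of_nonpos (Set.mem_Iic.1 hz), mul_neg, neg_neg]
  · simp only [abs_of_pos (Set.mem_Ioi.1 hz), neg_mul]

lemma continuous_waveTerm_line (k : ℂ) (m : ℕ) {s : ℝ} (hs : 0 < s) :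
    Continuous fun z : ℝ => waveTerm k m (4 * s + z ^ 2) := by
  refine continuous_iff_continuousAt.2 fun z => ?_
  have h := (hasDerivAt_waveTerm k m (q := 4 * s + z ^ 2) (by positivity)).continuousAt
  exact ContinuousAt.comp (f := fun z : ℝ => 4 * s + z ^ 2) h (by fun_prop)

lemma continuous_expLine (β : ℝ) : Continuous fun z : ℝ => Complex.exp (Complex.I * β * z) := by
  fun_prop

lemma integrable_waveTerm_line {k : ℂ} (hk : 0 < k.im) (m : ℕ) (β : ℝ) {s : ℝ} (hs : 0 < s) :
    Integrable fun z : ℝ => waveTerm k m (4 * s + z ^ 2) * Complex.exp (Complex.I * β * z) := by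
  refine ((integrable_exp_neg_mul_abs hk).const_mul (1 / (√(4 * s)) ^ m)).mono'
    ((continuous_waveTerm_line k m hs).mul (continuous_expLine β)).aestronglyMeasurable
    (ae_of_all _ fun z => ?_)
  rw [norm_mul, norm_exp_I_mul_real, mul_one]
  exact norm_waveTerm_le hk.le m (by positivity) (by nlinarith [sq_nonneg z]) (by nlinarith)

/-- The Fourier integral of `e^{ikr} / r^m` along the line at distance `2 √s` from the origin. -/
def lineIntegral (k : ℂ) (β : ℝ) (m : ℕ) (s : ℝ) : ℂ :=
  ∫ z : ℝ, waveTerm k m (4 * s + z ^ 2) * Complex.exp (Complex.I * β * z)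

lemma hasDerivAt_lineIntegral {k : ℂ} (hk : 0 < k.im) (β : ℝ) (m : ℕ) {s : ℝ} (hs : 0 < s) :
    HasDerivAt (lineIntegral k β m)
      (2 * (Complex.I * k * lineIntegral k β (m + 1) s - m * lineIntegral k β (m + 2) s)) s := by
  let F' : ℝ → ℝ → ℂ := fun s z =>
    2 * (Complex.I * k * waveTerm k (m + 1) (4 * s + z ^ 2)
      - m * waveTerm k (m + 2) (4 * s + z ^ 2)) * Complex.exp (Complex.I * β * z)
  let C : ℝ := 2 * (‖k‖ * (1 / (√(2 * s)) ^ (m + 1)) + m * (1 / (√(2 * s)) ^ (m + 2)))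
  have hmem : Set.Ioi (s / 2) ∈ 𝓝 s := Ioi_mem_nhds (by linarith)
  have h := hasDerivAt_integral_of_dominated_loc_of_deriv_le (μ := volume) (𝕜 := ℝ) (E := ℂ)
    (F := fun s z => waveTerm k m (4 * s + z ^ 2) * Complex.exp (Complex.I * β * z))
    (F' := F') (x₀ := s) (s := Set.Ioi (s / 2))
    (bound := fun z => C * Real.exp (-(k.im * |z|))) hmem ?_ ?_ ?_ ?_ ?_ ?_
  · refine h.2.congr_deriv ?_
    have i1 := (integrable_waveTerm_line hk (m + 1) β hs).const_mul (2 * (Complex.I * k))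
    have i2 := (integrable_waveTerm_line hk (m + 2) β hs).const_mul (2 * (m : ℂ))
    rw [lineIntegral, lineIntegral,
      show ∀ a b : ℂ, 2 * (Complex.I * k * a - m * b) = 2 * (Complex.I * k) * a - 2 * m * b by
        intros; ring,
      ← integral_const_mul, ← integral_const_mul, ← integral_sub i1 i2]
    refine integral_congr_ae (ae_of_all _ fun z => ?_)
    simp only [F']; ring
  · filter_upwards [hmem] with t ht
    have ht' : 0 < t := by have := Set.mem_Ioi.1 ht; linarith
    exact ((continuous_waveTerm_line k m ht').mul (continuous_expLine β)).aestronglyMeasurable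
  · exact integrable_waveTerm_line hk m β hs
  · exact ((((continuous_waveTerm_line k (m + 1) hs).const_mul _).sub
      ((continuous_waveTerm_line k (m + 2) hs).const_mul _)).const_mul 2).mul
      (continuous_expLine β) |>.aestronglyMeasurable
  · refine ae_of_all _ fun z t ht => ?_
    have ht' : s / 2 < t := ht
    have b1 := norm_waveTerm_le hk.le (m + 1) (q₀ := 2 * s) (q := 4 * t + z ^ 2) (z := z)
      (by linarith) (by nlinarith [sq_nonneg z]) (by nlinarith)
    have b2 := norm_waveTerm_le hk.le (m + 2) (q₀ := 2 * s) (q := 4 * t + z ^ 2) (z := z)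
      (by linarith) (by nlinarith [sq_nonneg z]) (by nlinarith)
    simp only [F']
    rw [norm_mul, norm_exp_I_mul_real, mul_one, norm_mul, Complex.norm_ofNat]
    calc 2 * ‖_ - _‖ ≤ 2 * (‖Complex.I * k * waveTerm k (m + 1) (4 * t + z ^ 2)‖
          + ‖(m : ℂ) * waveTerm k (m + 2) (4 * t + z ^ 2)‖) := by gcongr; exact norm_sub_le _ _
      _ ≤ 2 * (‖k‖ * (1 / (√(2 * s)) ^ (m + 1) * Real.exp (-(k.im * |z|)))
          + m * (1 / (√(2 * s)) ^ (m + 2) * Real.exp (-(k.im * |z|)))) := by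
        rw [norm_mul, norm_mul, norm_mul, Complex.norm_I, one_mul, Complex.norm_natCast]
        gcongr
      _ = C * Real.exp (-(k.im * |z|)) := by simp only [C]; ring
  · exact (integrable_exp_neg_mul_abs hk).const_mul C
  · refine ae_of_all _ fun z t ht => ?_
    have ht' : s / 2 < t := ht
    have hq : 0 < 4 * t + z ^ 2 := by nlinarith [sq_nonneg z]
    have hlin : HasDerivAt (fun t : ℝ => 4 * t + z ^ 2) 4 t := by
      simpa using ((hasDerivAt_id t).const_mul 4).add_const (z ^ 2)
    have := ((hasDerivAt_waveTerm k m hq).scomp t hlin).mul_const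
      (Complex.exp (Complex.I * β * z))
    refine this.congr_deriv ?_
    simp only [F', Complex.real_smul]; push_cast; ring

/-- The Helmholtz equation for `e^{ikr} / r`, integrated along the line: the second derivative in
`z` turns into multiplication by `-β²` upon integration by parts. -/
lemma lineIntegral_bessel {k : ℂ} (hk : 0 < k.im) (β : ℝ) {s : ℝ} (hs : 0 < s) :
    s * (4 * ((Complex.I * k) ^ 2 * lineIntegral k β 3 s - 3 * (Complex.I * k) * lineIntegral k β 4 s
      + 3 * lineIntegral k β 5 s))
    + 2 * (Complex.I * k * lineIntegral k β 2 s - lineIntegral k β 3 s)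
    + (k ^ 2 - β ^ 2) * lineIntegral k β 1 s = 0 := by
  let e : ℝ → ℂ := fun z => Complex.exp (Complex.I * β * z)
  let E : ℕ → ℝ → ℂ := fun m z => waveTerm k m (4 * s + z ^ 2)
  have hE : ∀ m z, HasDerivAt (E m) (z * (Complex.I * k * E (m + 1) z - m * E (m + 2) z)) z := by
    intro m z
    have hq : 0 < 4 * s + z ^ 2 := by positivity
    have hlin : HasDerivAt (fun z : ℝ => 4 * s + z ^ 2) (2 * z) z := by
      simpa using (hasDerivAt_pow 2 z).const_add (4 * s)
    refine ((hasDerivAt_waveTerm k m hq).scomp z hlin).congr_deriv ?_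
    simp only [E, Complex.real_smul]; push_cast; ring
  have he : ∀ z : ℝ, HasDerivAt e (Complex.I * β * e z) z := by
    intro z
    have h1 : HasDerivAt (fun z : ℝ => Complex.I * β * (z : ℂ)) (Complex.I * β) z := by
      simpa using (hasDerivAt_ofReal z).const_mul (Complex.I * β)
    refine h1.cexp.congr_deriv ?_
    simp only [e]; ring
  have hint : ∀ m, Integrable fun z => E m z * e z := fun m => integrable_waveTerm_line hk m β hs
  have hq : ∀ m (z : ℝ), (4 * s + z ^ 2 : ℂ) * E (m + 2) z = E m z := by
    intro m z
    have := mul_waveTerm_add_two k m (q := 4 * s + z ^ 2) (by positivity)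
    push_cast at this
    exact this
  let g : ℝ → ℂ := fun z =>
    ((z : ℂ) * (Complex.I * k * E 2 z - E 3 z) - Complex.I * β * E 1 z) * e z
  let g' : ℝ → ℂ := fun z =>
    -(k ^ 2 - β ^ 2) * (E 1 z * e z) - 2 * (Complex.I * k) * (E 2 z * e z) + 2 * (E 3 z * e z)
      - 4 * s * ((Complex.I * k) ^ 2 * (E 3 z * e z)) + 4 * s * (3 * (Complex.I * k) * (E 4 z * e z))
      - 4 * s * (3 * (E 5 z * e z))
  have hg : ∀ z, HasDerivAt g (g' z) z := by
    intro z
    have hid := hasDerivAt_ofReal z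
    have h := ((hid.mul (((hE 2 z).const_mul (Complex.I * k)).sub (hE 3 z))).sub
      ((hE 1 z).const_mul (Complex.I * β))).mul (he z)
    refine h.congr_deriv ?_
    simp only [g', Pi.mul_apply, Pi.sub_apply, Nat.reduceAdd, Nat.cast_ofNat, Nat.cast_one]
    have h1 := hq 1 z
    have h2 := hq 2 z
    have h3 := hq 3 z
    simp only [Nat.reduceAdd] at h1 h2 h3
    have hI : Complex.I ^ 2 = -1 := Complex.I_sq
    linear_combination e z * ((Complex.I * k) ^ 2 * h1 - 3 * Complex.I * k * h2 + 3 * h3)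
      + (k ^ 2 * E 1 z * e z - β ^ 2 * E 1 z * e z) * hI
  have hgint : Integrable g := by
    have hz : ∀ m, Integrable fun z : ℝ => (z : ℂ) * E (m + 1) z * e z := by
      intro m
      refine ((integrable_exp_neg_mul_abs hk).const_mul (1 / (√(4 * s)) ^ m)).mono' ?_
        (ae_of_all _ fun z => ?_)
      · exact ((Complex.continuous_ofReal.mul (continuous_waveTerm_line k (m + 1) hs)).mul
          (continuous_expLine β)).aestronglyMeasurable
      · have hqp : 0 < 4 * s + z ^ 2 := by positivity
        have hr : 0 < √(4 * s + z ^ 2) := Real.sqrt_pos.2 hqp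
        rw [norm_mul, norm_exp_I_mul_real, mul_one, norm_mul, Complex.norm_real, Real.norm_eq_abs]
        calc |z| * ‖E (m + 1) z‖ ≤ √(4 * s + z ^ 2) * ‖E (m + 1) z‖ := by
              gcongr; exact Real.abs_le_sqrt (by linarith)
          _ = ‖E m z‖ := by
              simp only [E, norm_waveTerm, pow_succ]; field_simp
          _ ≤ _ := norm_waveTerm_le hk.le m (by positivity) (by nlinarith [sq_nonneg z])
              (by nlinarith)
    refine ((((hz 1).const_mul (Complex.I * k)).sub (hz 2)).sub
      ((hint 1).const_mul (Complex.I * β))).congr (ae_of_all _ fun z => ?_)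
    simp only [g, Pi.sub_apply, Nat.reduceAdd]; ring
  have j1 := (hint 1).const_mul (-(k ^ 2 - (β : ℂ) ^ 2))
  have j2 := (hint 2).const_mul (2 * (Complex.I * k))
  have j3 := (hint 3).const_mul 2
  have j4 := ((hint 3).const_mul ((Complex.I * k) ^ 2)).const_mul (4 * (s : ℂ))
  have j5 := ((hint 4).const_mul (3 * (Complex.I * k))).const_mul (4 * (s : ℂ))
  have j6 := ((hint 5).const_mul 3).const_mul (4 * (s : ℂ))
  have hzero := integral_eq_zero_of_hasDerivAt_of_integrable hg
    (((((j1.sub j2).add j3).sub j4).add j5).sub j6) hgint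
  have hsum := integral_sub' ((((j1.sub j2).add j3).sub j4).add j5) j6
  rw [integral_add' (((j1.sub j2).add j3).sub j4) j5, integral_sub' ((j1.sub j2).add j3) j4,
    integral_add' (j1.sub j2) j3, integral_sub' j1 j2] at hsum
  replace hzero := hsum.symm.trans hzero
  simp only [integral_const_mul] at hzero
  simp only [lineIntegral]
  linear_combination -hzero

lemma besselSol_lineIntegral {k κ : ℂ} (hk : 0 < k.im) {β : ℝ} (hκ : κ ^ 2 = k ^ 2 - (β : ℂ) ^ 2) :
    BesselSol κ (lineIntegral k β 1)
      (fun s => 2 * (Complex.I * k * lineIntegral k β 2 s - lineIntegral k β 3 s))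
      (fun s => 4 * ((Complex.I * k) ^ 2 * lineIntegral k β 3 s
        - 3 * (Complex.I * k) * lineIntegral k β 4 s + 3 * lineIntegral k β 5 s)) where
  deriv s hs := by simpa using hasDerivAt_lineIntegral hk β 1 hs
  deriv₂ s hs := by
    refine ((((hasDerivAt_lineIntegral hk β 2 hs).const_mul (Complex.I * k)).sub
      (hasDerivAt_lineIntegral hk β 3 hs)).const_mul 2).congr_deriv ?_
    push_cast; ring
  eq s hs := by rw [hκ]; exact lineIntegral_bessel hk β hs

/-! ### The logarithmic singularity of the Fourier integral -/

/-- The Laplace transform of the logarithm at a positive real number, from `Γ'(1) = -γ`. -/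
lemma integral_log_mul_exp_real {a : ℝ} (ha : 0 < a) :
    IntegrableOn (fun t : ℝ => (Real.log t : ℂ) * Complex.exp (-(a * t))) (Set.Ioi 0) ∧
    ∫ t in Set.Ioi (0 : ℝ), (Real.log t : ℂ) * Complex.exp (-(a * t))
      = 1 / a * (-(Real.eulerMascheroniConstant : ℂ) - Complex.log a) := by
  have ha0 : (a : ℂ) ≠ 0 := by exact_mod_cast ha.ne'
  have hcont : Continuous fun t : ℝ => Complex.exp (-(a * t)) := by fun_prop
  have hnorm : ∀ t : ℝ, ‖Complex.exp (-(a * t))‖ = Real.exp (-a * t) := by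
    intro t; rw [Complex.norm_exp]; congr 1; simp
  obtain ⟨hconv, hderiv⟩ := mellin_hasDerivAt_of_isBigO_rpow (a := 2) (b := 0) (s := 1)
    (f := fun t : ℝ => Complex.exp (-(a * t)))
    (hcont.locallyIntegrable.locallyIntegrableOn _)
    (((isLittleO_exp_neg_mul_rpow_atTop ha (-2)).isBigO).congr_left
      (fun t => (hnorm t).symm) |>.of_norm_left)
    (by simp)
    (by
      simp only [neg_zero, Real.rpow_zero]
      exact (hcont.tendsto 0).isBigO_one ℝ |>.mono nhdsWithin_le_nhds)
    (by simp)
  have hev : mellin (fun t : ℝ => Complex.exp (-(a * t))) =ᶠ[𝓝 1]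
      fun s => (1 / (a : ℂ)) ^ s * Complex.Gamma s := by
    have : {s : ℂ | 0 < s.re} ∈ 𝓝 (1 : ℂ) :=
      (isOpen_lt continuous_const Complex.continuous_re).mem_nhds (by simp)
    filter_upwards [this] with s hs
    rw [← Complex.integral_cpow_mul_exp_neg_mul_Ioi hs ha, mellin]
    simp only [smul_eq_mul]
  have hone : (1 / (a : ℂ)) ≠ 0 := one_div_ne_zero ha0
  have hpow : HasDerivAt (fun s : ℂ => (1 / (a : ℂ)) ^ s)
      ((1 / (a : ℂ)) ^ (1 : ℂ) * Complex.log (1 / a)) 1 := by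
    simpa using (hasDerivAt_id (1 : ℂ)).const_cpow (Or.inl hone)
  have h1 := hderiv.unique ((hpow.mul Complex.hasDerivAt_Gamma_one).congr_of_eventuallyEq hev)
  have hfun : ∀ t : ℝ, ((t : ℂ) ^ ((1 : ℂ) - 1)) • (Real.log t • Complex.exp (-(a * t)))
      = (Real.log t : ℂ) * Complex.exp (-(a * t)) := by
    intro t; simp [Complex.real_smul]
  constructor
  · have := hconv
    simp only [MellinConvergent, hfun] at this
    exact this
  · have hl : Complex.log (1 / a) = - Complex.log a := by
      rw [one_div, Complex.log_inv]
      rw [Complex.arg_ofReal_of_nonneg ha.le]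
      exact Real.pi_ne_zero.symm
    simp only [mellin, hfun] at h1
    rw [h1, hl, Complex.cpow_one, Complex.Gamma_one]
    ring

lemma integrableOn_log_mul_exp {a : ℂ} (ha : 0 < a.re) :
    IntegrableOn (fun t : ℝ => (Real.log t : ℂ) * Complex.exp (-(a * t))) (Set.Ioi 0) := by
  refine Integrable.mono (integral_log_mul_exp_real ha).1 ?_ (ae_of_all _ fun t => ?_)
  · exact ((Complex.measurable_ofReal.comp Real.measurable_log).mul
      (by fun_prop : Continuous fun t : ℝ => Complex.exp (-(a * t))).measurable).aestronglyMeasurable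
  · rw [norm_mul, norm_mul, Complex.norm_exp, Complex.norm_exp]
    simp

/-- The Laplace transform of the logarithm in the right half plane, by the identity theorem. -/
lemma integral_log_mul_exp {a : ℂ} (ha : 0 < a.re) :
    ∫ t in Set.Ioi (0 : ℝ), (Real.log t : ℂ) * Complex.exp (-(a * t))
      = 1 / a * (-(Real.eulerMascheroniConstant : ℂ) - Complex.log a) := by
  let U : Set ℂ := {a | 0 < a.re}
  have hU : IsOpen U := isOpen_lt continuous_const Complex.continuous_re
  have hF : DifferentiableOn ℂ (fun a : ℂ => ∫ t in Set.Ioi (0 : ℝ),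
      (Real.log t : ℂ) * Complex.exp (-(a * t))) U := by
    intro a ha
    have ha : 0 < a.re := ha
    have hV : {w : ℂ | a.re / 2 < w.re} ∈ 𝓝 a :=
      (isOpen_lt continuous_const Complex.continuous_re).mem_nhds (by simpa using ha)
    have hmeas : ∀ w : ℂ, AEStronglyMeasurable (fun t : ℝ => (Real.log t : ℂ) *
        Complex.exp (-(w * t))) (volume.restrict (Set.Ioi 0)) := fun w =>
      ((Complex.measurable_ofReal.comp Real.measurable_log).mul
        (by fun_prop : Continuous fun t : ℝ => Complex.exp (-(w * t))).measurable).aestronglyMeasurable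
    refine (hasDerivAt_integral_of_dominated_loc_of_deriv_le (𝕜 := ℂ)
      (μ := volume.restrict (Set.Ioi (0 : ℝ)))
      (F := fun w t => (Real.log t : ℂ) * Complex.exp (-(w * t)))
      (F' := fun w t => (-t : ℂ) * ((Real.log t : ℂ) * Complex.exp (-(w * t))))
      (bound := fun t : ℝ => 4 / a.re *
        ‖(Real.log t : ℂ) * Complex.exp (-(((a.re / 4 : ℝ) : ℂ) * t))‖) hV
      (Eventually.of_forall hmeas) (integrableOn_log_mul_exp ha) ?_ ?_ ?_ ?_
        ).2.differentiableAt.differentiableWithinAt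
    · exact Complex.continuous_ofReal.neg.aestronglyMeasurable.mul (hmeas a)
    · filter_upwards [ae_restrict_mem measurableSet_Ioi] with t ht w hw
      have ht : 0 < t := ht
      have hw : a.re / 2 < w.re := hw
      have h1 : a.re / 4 * t ≤ Real.exp (a.re / 4 * t) := by
        linarith [Real.add_one_le_exp (a.re / 4 * t)]
      have h2 : t ≤ 4 / a.re * Real.exp (a.re / 4 * t) := by
        rw [div_mul_eq_mul_div, le_div_iff₀ ha]; linarith
      have h3 : Real.exp (-(w.re * t)) ≤ Real.exp (-(a.re / 2 * t)) := by
        gcongr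
      rw [norm_mul, norm_mul, norm_mul, Complex.norm_exp, Complex.norm_exp, norm_neg,
        Complex.norm_real, Complex.norm_real, Real.norm_of_nonneg ht.le]
      have e1 : (-(w * (t : ℂ))).re = -(w.re * t) := by simp
      have e2 : (-(((a.re / 4 : ℝ) : ℂ) * (t : ℂ))).re = -(a.re / 4 * t) := by
        rw [← Complex.ofReal_mul, ← Complex.ofReal_neg, Complex.ofReal_re]
      rw [e1, e2]
      have e3 : Real.exp (-(a.re / 4 * t))
          = Real.exp (a.re / 4 * t) * Real.exp (-(a.re / 2 * t)) := by
        rw [← Real.exp_add]; congr 1; ring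
      rw [e3]
      calc t * (‖Real.log t‖ * Real.exp (-(w.re * t)))
          ≤ (4 / a.re * Real.exp (a.re / 4 * t)) *
            (‖Real.log t‖ * Real.exp (-(a.re / 2 * t))) := by gcongr
        _ = _ := by ring
    · refine ((integrableOn_log_mul_exp (a := ((a.re / 4 : ℝ) : ℂ)) ?_).norm).const_mul _
      rw [Complex.ofReal_re]; positivity
    · refine ae_of_all _ fun t w _ => ?_
      have h1 : HasDerivAt (fun w : ℂ => -(w * (t : ℂ))) (-(t : ℂ)) w := by
        exact (hasDerivAt_mul_const (t : ℂ)).neg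
      refine (h1.cexp.const_mul (Real.log t : ℂ)).congr_deriv ?_
      ring
  have hG : DifferentiableOn ℂ (fun a : ℂ => 1 / a *
      (-(Real.eulerMascheroniConstant : ℂ) - Complex.log a)) U := by
    intro a ha
    have ha0 : a ≠ 0 := by rintro rfl; simp [U] at ha
    refine DifferentiableAt.differentiableWithinAt (DifferentiableAt.mul ?_ ?_)
    · exact (differentiableAt_const 1).div differentiableAt_id ha0
    · exact (Complex.differentiableAt_log (Or.inl ha)).const_sub _
  have hUc : IsPreconnected U := (convex_halfSpace_re_gt 0).isPreconnected
  have hfreq : ∃ᶠ z : ℂ in 𝓝[≠] ((1 : ℝ) : ℂ),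
      ∫ t in Set.Ioi (0 : ℝ), (Real.log t : ℂ) * Complex.exp (-(z * t))
        = 1 / z * (-(Real.eulerMascheroniConstant : ℂ) - Complex.log z) := by
    have ht : Tendsto (fun x : ℝ => (x : ℂ)) (𝓝[>] (1 : ℝ)) (𝓝[≠] ((1 : ℝ) : ℂ)) := by
      refine tendsto_nhdsWithin_iff.2
        ⟨(Complex.continuous_ofReal.tendsto 1).mono_left nhdsWithin_le_nhds, ?_⟩
      filter_upwards [self_mem_nhdsWithin] with x hx
      simpa using (ne_of_gt hx)
    refine ht.frequently (Eventually.frequently ?_)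
    filter_upwards [self_mem_nhdsWithin] with x hx
    exact (integral_log_mul_exp_real (zero_lt_one.trans hx)).2
  exact (hF.analyticOnNhd hU).eqOn_of_preconnected_of_frequently_eq (hG.analyticOnNhd hU) hUc
    (by simp [U]) hfreq ha

lemma exp_I_mul_eq (k : ℂ) (β z : ℝ) :
    Complex.exp (Complex.I * k * z) * Complex.exp (Complex.I * β * z)
      = Complex.exp (-(-Complex.I * (k + β) * z)) := by
  rw [← Complex.exp_add]; congr 1; ring

/-- The part of the integrand that remains after `1 / r` has been integrated to
`log (z + r)`. -/
def logTerm (k : ℂ) (β : ℝ) (s z : ℝ) : ℂ :=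
  (Real.log (z + √(4 * s + z ^ 2)) : ℂ) *
    ((Complex.I * k * (z * waveTerm k 1 (4 * s + z ^ 2))
        + Complex.I * β * waveTerm k 0 (4 * s + z ^ 2)) * Complex.exp (Complex.I * β * z))

lemma norm_waveTerm_zero_le {k : ℂ} (hk : 0 ≤ k.im) (s : ℝ) (hs : 0 ≤ s) (z : ℝ) :
    ‖waveTerm k 0 (4 * s + z ^ 2)‖ ≤ Real.exp (-(k.im * z)) := by
  rw [norm_waveTerm, pow_zero, div_one]
  gcongr
  exact Real.le_sqrt_of_sq_le (by linarith)

lemma norm_mul_waveTerm_one_le {k : ℂ} (hk : 0 ≤ k.im) (s : ℝ) (hs : 0 ≤ s) (z : ℝ) (hz : 0 < z) :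
    ‖(z : ℂ) * waveTerm k 1 (4 * s + z ^ 2)‖ ≤ Real.exp (-(k.im * z)) := by
  have hr : 0 < √(4 * s + z ^ 2) := Real.sqrt_pos.2 (by positivity)
  rw [norm_mul, Complex.norm_real, Real.norm_of_nonneg hz.le]
  calc z * ‖waveTerm k 1 (4 * s + z ^ 2)‖
      ≤ √(4 * s + z ^ 2) * ‖waveTerm k 1 (4 * s + z ^ 2)‖ := by
        gcongr; exact Real.le_sqrt_of_sq_le (by linarith)
    _ = ‖waveTerm k 0 (4 * s + z ^ 2)‖ := by
        rw [norm_waveTerm, norm_waveTerm]; field_simp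
    _ ≤ _ := norm_waveTerm_zero_le hk s hs z

lemma abs_log_add_sqrt_le {s z : ℝ} (hs' : s ≤ 1 / 4) (hz : 0 < z) :
    |Real.log (z + √(4 * s + z ^ 2))| ≤ |Real.log z| + 2 * z := by
  have hr : 0 ≤ √(4 * s + z ^ 2) := Real.sqrt_nonneg _
  have h1 : Real.log z ≤ Real.log (z + √(4 * s + z ^ 2)) := Real.log_le_log hz (by linarith)
  have h2 : √(4 * s + z ^ 2) ≤ z + 1 := Real.sqrt_le_iff.2 ⟨by linarith, by nlinarith⟩
  have h3 := Real.log_le_sub_one_of_pos (show 0 < z + √(4 * s + z ^ 2) by linarith)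
  have h4 := neg_abs_le (Real.log z)
  have h5 := abs_nonneg (Real.log z)
  rw [abs_le]
  constructor <;> linarith

/-- The integrable majorant of `logTerm`. -/
def logMajorant (k : ℂ) (β : ℝ) (z : ℝ) : ℝ :=
  (|Real.log z| + 2 * z) * ((‖k‖ + |β|) * Real.exp (-(k.im * z)))

lemma integrableOn_logMajorant {k : ℂ} (hk : 0 < k.im) (β : ℝ) :
    IntegrableOn (logMajorant k β) (Set.Ioi 0) := by
  have h1 : IntegrableOn (fun z : ℝ => |Real.log z| * Real.exp (-(k.im * z))) (Set.Ioi 0) := by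
    refine ((integrableOn_log_mul_exp (a := (k.im : ℂ)) (by simpa)).norm).congr
      (ae_of_all _ fun z => ?_)
    simp only [norm_mul, Complex.norm_real, Real.norm_eq_abs, Complex.norm_exp]
    simp
  have h2 : IntegrableOn (fun z : ℝ => z * Real.exp (-(k.im * z))) (Set.Ioi 0) := by
    have := integrableOn_rpow_mul_exp_neg_mul_rpow (p := 1) (s := 1) (b := k.im) (by norm_num)
      zero_lt_one hk
    simpa using this
  refine ((h1.add (h2.const_mul 2)).mul_const (‖k‖ + |β|)).congr (ae_of_all _ fun z => ?_)
  simp only [logMajorant, Pi.add_apply]; ring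

lemma norm_logTerm_le {k : ℂ} (hk : 0 ≤ k.im) (β : ℝ) {s z : ℝ} (hs : 0 ≤ s) (hs' : s ≤ 1 / 4)
    (hz : 0 < z) : ‖logTerm k β s z‖ ≤ logMajorant k β z := by
  rw [logTerm, logMajorant, norm_mul, norm_mul, norm_exp_I_mul_real, mul_one, Complex.norm_real,
    Real.norm_eq_abs]
  gcongr
  · exact abs_log_add_sqrt_le hs' hz
  · calc _ ≤ ‖Complex.I * k * (z * waveTerm k 1 (4 * s + z ^ 2))‖
          + ‖Complex.I * β * waveTerm k 0 (4 * s + z ^ 2)‖ := norm_add_le _ _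
      _ = ‖k‖ * ‖(z : ℂ) * waveTerm k 1 (4 * s + z ^ 2)‖ + |β| * ‖waveTerm k 0 (4 * s + z ^ 2)‖ := by
        simp only [norm_mul, Complex.norm_I, one_mul, Complex.norm_real, Real.norm_eq_abs]
      _ ≤ ‖k‖ * Real.exp (-(k.im * z)) + |β| * Real.exp (-(k.im * z)) := by
        gcongr
        · exact norm_mul_waveTerm_one_le hk s hs z hz
        · exact norm_waveTerm_zero_le hk s hs z
      _ = _ := by ring

lemma continuousOn_logTerm (k : ℂ) (β : ℝ) {s : ℝ} (hs : 0 < s) :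
    ContinuousOn (logTerm k β s) (Set.Ioi 0) := by
  have h0 := continuous_waveTerm_line k 0 hs
  have h1 := continuous_waveTerm_line k 1 hs
  have hl : ContinuousOn (fun z : ℝ => Real.log (z + √(4 * s + z ^ 2))) (Set.Ioi 0) := by
    refine ContinuousOn.log (by fun_prop) fun z hz => ?_
    have := Real.sqrt_nonneg (4 * s + z ^ 2)
    have : 0 < z := hz
    positivity
  exact (Complex.continuous_ofReal.comp_continuousOn hl).mul
    (((continuous_const.mul (Complex.continuous_ofReal.mul h1)).add
      (continuous_const.mul h0)).mul (continuous_expLine β)).continuousOn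

lemma tendsto_logTerm (k : ℂ) (β : ℝ) {z : ℝ} (hz : 0 < z) :
    Tendsto (fun s => logTerm k β s z) (𝓝[>] 0)
      (𝓝 ((Real.log (2 * z) : ℂ) *
        (Complex.I * (k + β) * Complex.exp (-(-Complex.I * (k + β) * z))))) := by
  have hzz : 0 < z ^ 2 := by positivity
  have hlin : Tendsto (fun s : ℝ => 4 * s + z ^ 2) (𝓝[>] 0) (𝓝 (z ^ 2)) := by
    have : Continuous fun s : ℝ => 4 * s + z ^ 2 := by fun_prop
    simpa using (this.tendsto 0).mono_left nhdsWithin_le_nhds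
  have hsq : Tendsto (fun s : ℝ => √(4 * s + z ^ 2)) (𝓝[>] 0) (𝓝 z) := by
    have := (Real.continuous_sqrt.tendsto (z ^ 2)).comp hlin
    rwa [Real.sqrt_sq hz.le] at this
  have hl : Tendsto (fun s : ℝ => (Real.log (z + √(4 * s + z ^ 2)) : ℂ)) (𝓝[>] 0)
      (𝓝 (Real.log (2 * z) : ℂ)) := by
    refine (Complex.continuous_ofReal.tendsto _).comp (Tendsto.log ?_ (by positivity))
    rw [two_mul]
    exact hsq.const_add z
  have h0 := (hasDerivAt_waveTerm k 0 hzz).continuousAt.tendsto.comp hlin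
  have h1 := (hasDerivAt_waveTerm k 1 hzz).continuousAt.tendsto.comp hlin
  have := hl.mul ((((h1.const_mul (z : ℂ)).const_mul (Complex.I * k)).add
    (h0.const_mul (Complex.I * β))).mul_const (Complex.exp (Complex.I * β * z)))
  refine this.congr' (Eventually.of_forall fun s => rfl) |>.trans_eq ?_
  congr 1
  have hz' : (z : ℂ) ≠ 0 := by exact_mod_cast hz.ne'
  rw [← exp_I_mul_eq, waveTerm, waveTerm, Real.sqrt_sq hz.le]
  field_simp

/-- The Fourier integral of `e^{ikr} / r` along the half line. -/
def halfLineIntegral (k : ℂ) (β : ℝ) (s : ℝ) : ℂ :=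
  ∫ z in Set.Ioi (0 : ℝ), waveTerm k 1 (4 * s + z ^ 2) * Complex.exp (Complex.I * β * z)

/-- The term `1 / r` is integrated to `log (z + r)`; the boundary term carries the singularity at
`s = 0`. -/
lemma halfLineIntegral_eq {k : ℂ} (hk : 0 < k.im) (β : ℝ) {s : ℝ} (hs : 0 < s) (hs' : s ≤ 1 / 4) :
    halfLineIntegral k β s = -(Real.log (2 * √s) * Complex.exp (Complex.I * k * (2 * √s : ℝ)))
      - ∫ z in Set.Ioi (0 : ℝ), logTerm k β s z := by
  have i1 : IntegrableOn (fun z : ℝ => waveTerm k 1 (4 * s + z ^ 2) *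
      Complex.exp (Complex.I * β * z)) (Set.Ioi 0) :=
    (integrable_waveTerm_line hk 1 β hs).integrableOn
  have i2 : IntegrableOn (logTerm k β s) (Set.Ioi 0) := by
    refine (integrableOn_logMajorant hk β).mono'
      ((continuousOn_logTerm k β hs).aestronglyMeasurable measurableSet_Ioi) ?_
    filter_upwards [ae_restrict_mem measurableSet_Ioi] with z hz
    exact norm_logTerm_le hk.le β hs.le hs' hz
  let H : ℝ → ℂ := fun z => (Real.log (z + √(4 * s + z ^ 2)) : ℂ) *
    (waveTerm k 0 (4 * s + z ^ 2) * Complex.exp (Complex.I * β * z))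
  have hH : ∀ z ∈ Set.Ici (0 : ℝ), HasDerivAt H (waveTerm k 1 (4 * s + z ^ 2) *
      Complex.exp (Complex.I * β * z) + logTerm k β s z) z := by
    intro z hz
    have hz : 0 ≤ z := hz
    have hq : 0 < 4 * s + z ^ 2 := by positivity
    have hr : 0 < √(4 * s + z ^ 2) := Real.sqrt_pos.2 hq
    have hlin : HasDerivAt (fun z : ℝ => 4 * s + z ^ 2) (2 * z) z := by
      simpa using (hasDerivAt_pow 2 z).const_add (4 * s)
    have hlog := (((hasDerivAt_id z).add (hlin.sqrt hq.ne')).log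
      (add_pos_of_nonneg_of_pos hz hr).ne').ofReal_comp
    have hw := (hasDerivAt_waveTerm k 0 hq).scomp z hlin
    have h1 : HasDerivAt (fun z : ℝ => Complex.I * β * (z : ℂ)) (Complex.I * β) z := by
      simpa using (hasDerivAt_ofReal z).const_mul (Complex.I * β)
    refine (hlog.mul (hw.mul h1.cexp)).congr_deriv ?_
    have hr' : ((√(4 * s + z ^ 2) : ℝ) : ℂ) ≠ 0 := by exact_mod_cast hr.ne'
    have hzr : (z : ℂ) + ((√(4 * s + z ^ 2) : ℝ) : ℂ) ≠ 0 := by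
      exact_mod_cast (show 0 < z + √(4 * s + z ^ 2) by positivity).ne'
    have e1 : waveTerm k 1 (4 * s + z ^ 2) * ((√(4 * s + z ^ 2) : ℝ) : ℂ)
        = waveTerm k 0 (4 * s + z ^ 2) := by
      simp only [waveTerm, pow_one, pow_zero]; field_simp
    simp only [logTerm, Pi.add_apply, Pi.mul_apply, Function.comp_apply, id_eq,
      Complex.real_smul, ← e1, zero_add, Nat.cast_zero, zero_mul, sub_zero]
    push_cast
    field_simp
    ring
  have htop : Tendsto H atTop (𝓝 0) := by
    have hlim : Tendsto (fun z : ℝ => 4 * (z * Real.exp (-(k.im * z)))) atTop (𝓝 0) := by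
      have := (isLittleO_exp_neg_mul_rpow_atTop hk (-1)).tendsto_div_nhds_zero
      have h2 := this.const_mul 4
      rw [mul_zero] at h2
      refine h2.congr' ?_
      filter_upwards [eventually_gt_atTop 0] with z hz
      rw [Real.rpow_neg_one, div_inv_eq_mul, neg_mul]; ring
    refine squeeze_zero_norm' ?_ hlim
    filter_upwards [eventually_ge_atTop 1] with z hz
    have hz0 : 0 < z := by linarith
    have h1 := abs_log_add_sqrt_le hs' hz0
    have h2 : |Real.log z| ≤ z := by
      rw [abs_of_nonneg (Real.log_nonneg hz)]
      linarith [Real.log_le_sub_one_of_pos hz0]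
    simp only [H]
    rw [norm_mul, norm_mul, norm_exp_I_mul_real, mul_one, Complex.norm_real, Real.norm_eq_abs,
      ← mul_assoc]
    gcongr
    · linarith
    · exact norm_waveTerm_zero_le hk.le s hs.le z
  have h := integral_Ioi_of_hasDerivAt_of_tendsto' hH (i1.add i2) htop
  rw [integral_add i1 i2] at h
  have h4 : √(4 * s) = 2 * √s := by
    rw [Real.sqrt_mul (by norm_num), show (4 : ℝ) = 2 ^ 2 by norm_num, Real.sqrt_sq (by norm_num)]
  have hH0 : H 0 = Real.log (2 * √s) * Complex.exp (Complex.I * k * (2 * √s : ℝ)) := by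
    simp [H, waveTerm, h4]
  rw [halfLineIntegral, eq_sub_iff_add_eq, h, hH0]; ring

lemma tendsto_halfLineIntegral_add_log {k : ℂ} (hk : 0 < k.im) (β : ℝ) :
    Tendsto (fun s : ℝ => halfLineIntegral k β s + Real.log s / 2) (𝓝[>] 0)
      (𝓝 (-(Real.eulerMascheroniConstant : ℂ) - Complex.log (-Complex.I * (k + β)))) := by
  let a : ℂ := -Complex.I * (k + β)
  have ha : 0 < a.re := by simpa [a] using hk
  have ha0 : a ≠ 0 := by intro h; rw [h] at ha; simp at ha
  have hsmall : ∀ᶠ s : ℝ in 𝓝[>] 0, s ∈ Set.Ioo (0 : ℝ) (1 / 4) :=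
    Ioo_mem_nhdsGT (by norm_num)
  have hDCT : Tendsto (fun s => ∫ z in Set.Ioi (0 : ℝ), logTerm k β s z) (𝓝[>] 0)
      (𝓝 (∫ z in Set.Ioi (0 : ℝ), (Real.log (2 * z) : ℂ) *
        (Complex.I * (k + β) * Complex.exp (-(a * z))))) := by
    refine tendsto_integral_filter_of_dominated_convergence (logMajorant k β) ?_ ?_
      (integrableOn_logMajorant hk β) ?_
    · filter_upwards [hsmall] with s hs
      exact (continuousOn_logTerm k β hs.1).aestronglyMeasurable measurableSet_Ioi
    · filter_upwards [hsmall] with s hs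
      filter_upwards [ae_restrict_mem measurableSet_Ioi] with z hz
      exact norm_logTerm_le hk.le β hs.1.le hs.2.le hz
    · filter_upwards [ae_restrict_mem measurableSet_Ioi] with z hz
      exact tendsto_logTerm k β hz
  have hi := integrableOn_log_mul_exp ha
  have hval := integral_log_mul_exp ha
  have hi2 : IntegrableOn (fun t : ℝ => Complex.exp (-(a * t))) (Set.Ioi 0) := by
    have := integrableOn_exp_mul_complex_Ioi (a := -a) (by simpa using ha) 0
    simpa using this
  have hval2 : ∫ t in Set.Ioi (0 : ℝ), Complex.exp (-(a * t)) = 1 / a := by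
    have := integral_exp_mul_complex_Ioi (a := -a) (by simpa using ha) 0
    simpa using this
  have hK : ∫ z in Set.Ioi (0 : ℝ), (Real.log (2 * z) : ℂ) *
        (Complex.I * (k + β) * Complex.exp (-(a * z)))
      = -(Real.log 2 : ℂ) + (Real.eulerMascheroniConstant : ℂ) + Complex.log a := by
    have : ∀ z ∈ Set.Ioi (0 : ℝ), (Real.log (2 * z) : ℂ) *
        (Complex.I * (k + β) * Complex.exp (-(a * z)))
        = (-a * Real.log 2) * Complex.exp (-(a * z))
          + (-a) * ((Real.log z : ℂ) * Complex.exp (-(a * z))) := by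
      intro z hz
      rw [Real.log_mul (by norm_num) (ne_of_gt hz)]
      push_cast
      have : Complex.I * (k + β) = -a := by simp only [a]; ring
      rw [this]; ring
    rw [setIntegral_congr_fun measurableSet_Ioi this,
      integral_add (hi2.const_mul _) (hi.const_mul _), integral_const_mul, integral_const_mul, hval,
      hval2]
    field_simp
    ring
  rw [hK] at hDCT
  have hsqrt : Tendsto (fun s : ℝ => √s) (𝓝[>] 0) (𝓝[>] 0) := by
    refine tendsto_nhdsWithin_iff.2 ⟨?_, ?_⟩
    · have := Real.continuous_sqrt.tendsto 0
      rw [Real.sqrt_zero] at this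
      exact this.mono_left nhdsWithin_le_nhds
    · filter_upwards [self_mem_nhdsWithin] with s hs
      exact Real.sqrt_pos.2 hs
  have hexp : HasDerivAt (fun t : ℝ => Complex.exp (Complex.I * k * (2 * t : ℝ)))
      (2 * (Complex.I * k)) 0 := by
    have h1 : HasDerivAt (fun t : ℝ => Complex.I * k * ((2 * t : ℝ) : ℂ)) (Complex.I * k * 2) 0 := by
      have := (((hasDerivAt_id (0 : ℝ)).const_mul 2).ofReal_comp).const_mul (Complex.I * k)
      simpa using this
    refine h1.cexp.congr_deriv ?_
    simp [mul_comm]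
  have hlog0 : Tendsto (fun t : ℝ => (Real.log t : ℂ) *
      (Complex.exp (Complex.I * k * (2 * t : ℝ)) - 1)) (𝓝[>] 0) (𝓝 0) := by
    have := tendsto_mul_log_zero.mul hexp.tendsto_slope_zero_right
    rw [zero_mul] at this
    refine this.congr' ?_
    filter_upwards [self_mem_nhdsWithin] with t ht
    have ht' : (t : ℂ) ≠ 0 := by exact_mod_cast (ne_of_gt ht)
    simp only [Complex.real_smul, zero_add, mul_zero, Complex.ofReal_zero, Complex.exp_zero,
      Complex.ofReal_inv]
    field_simp
  have hexp0 : Tendsto (fun t : ℝ => Complex.exp (Complex.I * k * (2 * t : ℝ))) (𝓝[>] 0)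
      (𝓝 1) := by
    have := hexp.continuousAt.tendsto
    simp only [mul_zero, Complex.ofReal_zero, Complex.exp_zero] at this
    exact this.mono_left nhdsWithin_le_nhds
  have hfin := (((hlog0.comp hsqrt).neg).sub ((hexp0.comp hsqrt).const_mul (Real.log 2 : ℂ))).sub
    hDCT
  have hlim : -(0 : ℂ) - (Real.log 2 : ℂ) * 1
      - (-(Real.log 2 : ℂ) + (Real.eulerMascheroniConstant : ℂ) + Complex.log a)
      = -(Real.eulerMascheroniConstant : ℂ) - Complex.log a := by ring
  rw [hlim] at hfin
  refine hfin.congr' ?_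
  filter_upwards [hsmall] with s hs
  have hs0 : 0 < √s := Real.sqrt_pos.2 hs.1
  have hl : Real.log s = 2 * Real.log (√s) := by rw [Real.log_sqrt hs.1.le]; ring
  rw [halfLineIntegral_eq hk β hs.1 hs.2.le, Real.log_mul (by norm_num) hs0.ne', hl]
  simp only [Function.comp_apply]
  push_cast
  ring

lemma lineIntegral_eq_add {k : ℂ} (hk : 0 < k.im) (β : ℝ) {s : ℝ} (hs : 0 < s) :
    lineIntegral k β 1 s = halfLineIntegral k β s + halfLineIntegral k (-β) s := by
  have hi := integrable_waveTerm_line hk 1 β hs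
  rw [lineIntegral, ← intervalIntegral.integral_Iic_add_Ioi (b := 0) hi.integrableOn
    hi.integrableOn, add_comm, halfLineIntegral, halfLineIntegral]
  congr 1
  have := integral_comp_neg_Ioi (0 : ℝ)
    (fun z : ℝ => waveTerm k 1 (4 * s + z ^ 2) * Complex.exp (Complex.I * β * z))
  rw [neg_zero] at this
  rw [← this]
  simp

/-- No multiple of `2πi` appears, because all arguments lie in the right half plane. -/
lemma log_add_log_eq {k κ : ℂ} (hk : 0 < k.im) {β : ℝ} (hκ : κ ^ 2 = k ^ 2 - (β : ℂ) ^ 2)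
    (hκ' : 0 < κ.im) :
    Complex.log (-Complex.I * (k + β)) + Complex.log (-Complex.I * (k + (-β : ℝ)))
      = 2 * Complex.log κ - Complex.I * Real.pi := by
  have hpos : ∀ w : ℂ, 0 < w.re → w ≠ 0 ∧ -(Real.pi / 2) < w.arg ∧ w.arg < Real.pi / 2 := by
    intro w hw
    refine ⟨by rintro rfl; simp at hw, abs_lt.1 (Complex.abs_arg_lt_pi_div_two_iff.2 (Or.inl hw))⟩
  have hmul : ∀ v w : ℂ, 0 < v.re → 0 < w.re →
      Complex.log v + Complex.log w = Complex.log (v * w) := by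
    intro v w hv hw
    obtain ⟨hv0, hv1, hv2⟩ := hpos v hv
    obtain ⟨hw0, hw1, hw2⟩ := hpos w hw
    exact (Complex.log_mul hv0 hw0 ⟨by linarith, by linarith⟩).symm
  have hκ0 : κ ≠ 0 := by rintro rfl; simp at hκ'
  have hκr : 0 < (-Complex.I * κ).re := by simpa using hκ'
  have h1 : Complex.log (-Complex.I * κ) = Complex.log κ - Complex.I * (Real.pi / 2) := by
    have hI : Complex.log (-Complex.I) = -(Complex.I * (Real.pi / 2)) := by
      rw [Complex.log_neg_I]; ring
    have harg0 : 0 ≤ κ.arg := Complex.arg_nonneg_iff.2 hκ'.le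
    have harg1 := Complex.arg_le_pi κ
    rw [Complex.log_mul (neg_ne_zero.2 Complex.I_ne_zero) hκ0, hI]
    · ring
    · rw [Complex.arg_neg_I]
      constructor <;> linarith [Real.pi_pos]
  rw [hmul _ _ (by simpa using hk) (by simpa using hk)]
  have e : -Complex.I * (k + β) * (-Complex.I * (k + (-β : ℝ)))
      = -Complex.I * κ * (-Complex.I * κ) := by
    push_cast
    linear_combination (-Complex.I ^ 2) * hκ
  rw [e, ← hmul _ _ hκr hκr, h1]; ring

/-- The Fourier integral of the spherical wave along a line is the cylindrical wave, for
absorbing media. -/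
lemma lineIntegral_eq_hankelSol {k κ : ℂ} (hk : 0 < k.im) {β : ℝ}
    (hκ : κ ^ 2 = k ^ 2 - (β : ℂ) ^ 2) (hκ' : 0 < κ.im) {s : ℝ} (hs : 0 < s) :
    lineIntegral k β 1 s = hankelSol κ s := by
  refine (besselSol_lineIntegral hk hκ).eq_hankelSol ?_ hs
  have h := (tendsto_halfLineIntegral_add_log hk β).add (tendsto_halfLineIntegral_add_log hk (-β))
  have hlim : -(Real.eulerMascheroniConstant : ℂ) - Complex.log (-Complex.I * (k + β))
      + (-(Real.eulerMascheroniConstant : ℂ) - Complex.log (-Complex.I * (k + (-β : ℝ))))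
      = logConst κ := by
    rw [logConst]; linear_combination -(log_add_log_eq hk hκ hκ')
  rw [hlim] at h
  refine h.congr' ?_
  filter_upwards [self_mem_nhdsWithin] with s hs
  rw [lineIntegral_eq_add hk β hs]; ring

/-! ### Truncation errors and real wave numbers -/

/-- The truncated Fourier integral of the spherical wave along a line at distance `2 √s` from the
source. -/
def truncLine (k : ℂ) (β s a b : ℝ) : ℂ :=
  ∫ z in a..b, waveTerm k 1 (4 * s + z ^ 2) * Complex.exp (Complex.I * β * z)

lemma intervalIntegrable_truncLine (k : ℂ) (β : ℝ) {s : ℝ} (hs : 0 < s) (a b : ℝ) :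
    IntervalIntegrable (fun z : ℝ => waveTerm k 1 (4 * s + z ^ 2) *
      Complex.exp (Complex.I * β * z)) volume a b :=
  ((continuous_waveTerm_line k 1 hs).mul (continuous_expLine β)).intervalIntegrable a b

lemma truncLine_neg (k : ℂ) (β s a b : ℝ) :
    truncLine k β s (-b) (-a) = truncLine k (-β) s a b := by
  have := intervalIntegral.integral_comp_neg (a := a) (b := b)
    (fun z : ℝ => waveTerm k 1 (4 * s + z ^ 2) * Complex.exp (Complex.I * β * z))
  rw [truncLine, ← this, truncLine]
  simp

/-- The tails of the Fourier integral are small uniformly up to the real axis: the oscillating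
factor `e^{i(k+β)z}` is integrated, the remaining amplitude has an integrable derivative. -/
lemma norm_truncLine_tail_le {k : ℂ} (hk : 0 ≤ k.im) {β : ℝ} (hkβ : k + β ≠ 0) {s : ℝ} (hs : 0 < s)
    {a b : ℝ} (ha : 1 ≤ a) (hab : a ≤ b) :
    ‖truncLine k β s a b‖ ≤ (3 + 4 * s * ‖k‖) * (1 / (‖k + β‖ * a)) := by
  let R : ℝ → ℝ := fun z => √(4 * s + z ^ 2)
  -- `e^{ikR + iβz} / R = u' h`, where `R - z = O(1 / z)` makes the amplitude `h` vary slowly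
  let h : ℝ → ℂ := fun z => Complex.exp (Complex.I * k * (R z - z : ℝ)) / (R z : ℂ)
  let h' : ℝ → ℂ := fun z => Complex.exp (Complex.I * k * (R z - z : ℝ)) *
    (Complex.I * k * ((z / R z - 1 : ℝ) : ℂ) / (R z : ℂ) - (z : ℂ) / (R z : ℂ) ^ 3)
  let u : ℝ → ℂ := fun z => Complex.exp (Complex.I * (k + β) * z) / (Complex.I * (k + β))
  let u' : ℝ → ℂ := fun z => Complex.exp (Complex.I * (k + β) * z)
  have hI : Complex.I * (k + β) ≠ 0 := mul_ne_zero Complex.I_ne_zero hkβ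
  have hn : 0 < ‖k + β‖ := norm_pos_iff.2 hkβ
  have hR : ∀ z, 0 < R z := fun z => Real.sqrt_pos.2 (by positivity)
  have hRz : ∀ z, 0 < z → z ≤ R z := fun z hz => Real.le_sqrt_of_sq_le (by linarith)
  have hRsq : ∀ z, R z ^ 2 = 4 * s + z ^ 2 := fun z => Real.sq_sqrt (by positivity)
  have hRd : ∀ z, HasDerivAt R (z / R z) z := by
    intro z
    have hlin : HasDerivAt (fun z : ℝ => 4 * s + z ^ 2) (2 * z) z := by
      simpa using (hasDerivAt_pow 2 z).const_add (4 * s)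
    refine (hlin.sqrt (by positivity)).congr_deriv ?_
    have := (hR z).ne'
    simp only [R] at this ⊢
    field_simp
  have hRc : Continuous R := continuous_iff_continuousAt.2 fun z => (hRd z).continuousAt
  have hu : ∀ z, HasDerivAt u (u' z) z := by
    intro z
    have h1 : HasDerivAt (fun z : ℝ => Complex.I * (k + β) * (z : ℂ)) (Complex.I * (k + β)) z := by
      simpa using (hasDerivAt_ofReal z).const_mul (Complex.I * (k + β))
    refine (h1.cexp.div_const _).congr_deriv ?_
    simp only [u']
    field_simp
  have hh : ∀ z, HasDerivAt h (h' z) z := by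
    intro z
    have hR0 : (R z : ℂ) ≠ 0 := by exact_mod_cast (hR z).ne'
    have h1 := (((hRd z).sub (hasDerivAt_id z)).ofReal_comp.const_mul (Complex.I * k)).cexp
    refine (h1.div (hRd z).ofReal_comp hR0).congr_deriv ?_
    simp only [h', Pi.sub_apply, id_eq]
    push_cast
    field_simp
  have hRcc : Continuous fun z => (R z : ℂ) := Complex.continuous_ofReal.comp hRc
  have hR0 : ∀ z, (R z : ℂ) ≠ 0 := fun z => by exact_mod_cast (hR z).ne'
  have hh'c : Continuous h' := by
    refine Continuous.mul (by fun_prop) (Continuous.sub ?_ ?_)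
    · refine Continuous.div (continuous_const.mul (Complex.continuous_ofReal.comp ?_)) hRcc hR0
      exact (continuous_id.div hRc fun z => (hR z).ne').sub continuous_const
    · exact Complex.continuous_ofReal.div (hRcc.pow 3) fun z => pow_ne_zero 3 (hR0 z)
  have hu'c : Continuous u' := by fun_prop
  have huc : Continuous u := continuous_iff_continuousAt.2 fun z => (hu z).continuousAt
  -- size of the amplitude, of its derivative, and of the oscillating factor
  have hexp : ∀ z, 0 < z → ‖Complex.exp (Complex.I * k * (R z - z : ℝ))‖ ≤ 1 := by
    intro z hz
    rw [norm_exp_I_mul, Real.exp_le_one_iff]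
    have := mul_nonneg hk (sub_nonneg.2 (hRz z hz))
    linarith
  have hub : ∀ z, 0 < z → ‖u z‖ ≤ 1 / ‖k + β‖ := by
    intro z hz
    simp only [u]
    rw [norm_div, norm_exp_I_mul, norm_mul, Complex.norm_I, one_mul]
    gcongr
    rw [Real.exp_le_one_iff]
    simp only [Complex.add_im, Complex.ofReal_im, add_zero]
    have := mul_nonneg hk hz.le
    linarith
  have hhb : ∀ z, 0 < z → ‖h z‖ ≤ 1 / z := by
    intro z hz
    simp only [h]
    rw [norm_div, Complex.norm_real, Real.norm_of_nonneg (hR z).le]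
    exact div_le_div₀ zero_le_one (hexp z hz) hz (hRz z hz)
  have hh'b : ∀ z, 1 ≤ z → ‖h' z‖ ≤ (4 * s * ‖k‖ + 1) * (z ^ 2)⁻¹ := by
    intro z hz1
    have hz : 0 < z := by linarith
    have hr := hR z
    have hrz := hRz z hz
    have b1 : ‖z / R z - 1‖ ≤ 4 * s * (z ^ 2)⁻¹ := by
      rw [Real.norm_eq_abs, abs_sub_comm, abs_of_nonneg (by
        rw [sub_nonneg, div_le_one hr]; exact hrz), one_sub_div hr.ne', ← div_eq_mul_inv,
        div_le_div_iff₀ hr (by positivity)]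
      have e : (R z - z) * (R z + z) = 4 * s := by nlinarith [hRsq z]
      rw [← e]
      have : z ^ 2 ≤ (R z + z) * R z := by nlinarith
      have := mul_le_mul_of_nonneg_left this (sub_nonneg.2 hrz)
      linarith
    have b2 : z / R z ^ 3 ≤ (z ^ 2)⁻¹ := by
      rw [← one_div, div_le_div_iff₀ (by positivity) (by positivity), one_mul]
      calc z * z ^ 2 = z ^ 3 := by ring
        _ ≤ R z ^ 3 := by gcongr
    have hr1 : 1 ≤ R z := hz1.trans hrz
    simp only [h']
    calc _ ≤ 1 * ‖Complex.I * k * ((z / R z - 1 : ℝ) : ℂ) / (R z : ℂ) - (z : ℂ) / (R z : ℂ) ^ 3‖ := by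
          rw [norm_mul]; gcongr; exact hexp z hz
      _ ≤ ‖Complex.I * k * ((z / R z - 1 : ℝ) : ℂ) / (R z : ℂ)‖ + ‖(z : ℂ) / (R z : ℂ) ^ 3‖ := by
          rw [one_mul]; exact norm_sub_le _ _
      _ = ‖k‖ * ‖z / R z - 1‖ / R z + z / R z ^ 3 := by
          simp only [norm_mul, norm_div, norm_pow, Complex.norm_I, one_mul, Complex.norm_real]
          rw [Real.norm_of_nonneg hr.le, Real.norm_of_nonneg hz.le]
      _ ≤ ‖k‖ * (4 * s * (z ^ 2)⁻¹) / 1 + (z ^ 2)⁻¹ := by gcongr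
      _ = _ := by ring
  have hsplit : truncLine k β s a b = h b * u b - h a * u a - ∫ z in a..b, h' z * u z := by
    rw [← intervalIntegral.integral_mul_deriv_eq_deriv_mul (fun z _ => hh z) (fun z _ => hu z)
      (hh'c.intervalIntegrable a b) (hu'c.intervalIntegrable a b), truncLine]
    refine intervalIntegral.integral_congr fun z _ => ?_
    simp only [h, u', waveTerm, pow_one, R]
    rw [div_mul_eq_mul_div, div_mul_eq_mul_div, ← Complex.exp_add, ← Complex.exp_add]
    congr 2
    push_cast
    ring
  have ha0 : 0 < a := by linarith
  have hb0 : 0 < b := by linarith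
  have hint : ‖∫ z in a..b, h' z * u z‖ ≤ (4 * s * ‖k‖ + 1) / ‖k + β‖ * (1 / a) := by
    have hd : ∀ z ∈ Set.uIcc a b, HasDerivAt (fun z : ℝ => -((4 * s * ‖k‖ + 1) / ‖k + β‖) * z⁻¹)
        ((4 * s * ‖k‖ + 1) / ‖k + β‖ * (z ^ 2)⁻¹) z := by
      intro z hz
      rw [Set.uIcc_of_le hab] at hz
      have hz0 : z ≠ 0 := (ha0.trans_le hz.1).ne'
      refine ((hasDerivAt_inv hz0).const_mul _).congr_deriv ?_
      ring
    have hci : IntervalIntegrable (fun z : ℝ => (4 * s * ‖k‖ + 1) / ‖k + β‖ * (z ^ 2)⁻¹)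
        volume a b := by
      refine ContinuousOn.intervalIntegrable fun z hz => ?_
      rw [Set.uIcc_of_le hab] at hz
      have hz0 : z ^ 2 ≠ 0 := pow_ne_zero 2 (ha0.trans_le hz.1).ne'
      exact (continuousAt_const.mul ((continuousAt_id.pow 2).inv₀ hz0)).continuousWithinAt
    refine (intervalIntegral.norm_integral_le_of_norm_le hab (ae_of_all _ fun z hz => ?_)
      hci).trans ?_
    · have hz1 : 1 ≤ z := ha.trans hz.1.le
      rw [norm_mul]
      calc ‖h' z‖ * ‖u z‖ ≤ (4 * s * ‖k‖ + 1) * (z ^ 2)⁻¹ * (1 / ‖k + β‖) := by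
            gcongr
            · exact hh'b z hz1
            · exact hub z (by linarith)
        _ = _ := by ring
    · rw [intervalIntegral.integral_eq_sub_of_hasDerivAt hd hci]
      have : 0 ≤ (4 * s * ‖k‖ + 1) / ‖k + β‖ * b⁻¹ := by positivity
      rw [one_div]
      linarith
  have hba : 1 / b ≤ 1 / a := one_div_le_one_div_of_le ha0 hab
  rw [hsplit]
  calc _ ≤ ‖h b‖ * ‖u b‖ + ‖h a‖ * ‖u a‖ + ‖∫ z in a..b, h' z * u z‖ := by
        refine (norm_sub_le _ _).trans ?_
        gcongr
        refine (norm_sub_le _ _).trans ?_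
        rw [norm_mul, norm_mul]
    _ ≤ 1 / a * (1 / ‖k + β‖) + 1 / a * (1 / ‖k + β‖)
        + (4 * s * ‖k‖ + 1) / ‖k + β‖ * (1 / a) := by
        gcongr
        · exact (hhb b hb0).trans hba
        · exact hub b hb0
        · exact hhb a ha0
        · exact hub a ha0
    _ = _ := by field_simp; ring

/-- The error made by truncating the Fourier integral, for absorbing media. -/
lemma norm_truncLine_sub_le_of_im_pos {k κ : ℂ} (hk : 0 < k.im) {β : ℝ}
    (hκ : κ ^ 2 = k ^ 2 - (β : ℂ) ^ 2) (hκ' : 0 < κ.im) {s : ℝ} (hs : 0 < s) {a b : ℝ}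
    (ha : 1 ≤ a) (hb : 1 ≤ b) :
    ‖truncLine k β s (-a) b - hankelSol κ s‖
      ≤ (3 + 4 * s * ‖k‖) * (1 / (‖k - β‖ * a) + 1 / (‖k + β‖ * b)) := by
  have hne : ∀ x : ℝ, k + x ≠ 0 := by
    intro x h
    have := congrArg Complex.im h
    simp at this
    linarith
  have hlim : Tendsto (fun x : ℝ => truncLine k β s (-x) x) atTop (𝓝 (hankelSol κ s)) := by
    rw [← lineIntegral_eq_hankelSol hk hκ hκ' hs]
    exact intervalIntegral_tendsto_integral (integrable_waveTerm_line hk 1 β hs)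
      tendsto_neg_atTop_atBot tendsto_id
  refine le_of_tendsto (hlim.const_sub (truncLine k β s (-a) b)).norm ?_
  filter_upwards [eventually_ge_atTop a, eventually_ge_atTop b] with x hxa hxb
  have hi := intervalIntegrable_truncLine k β hs
  have e1 : truncLine k β s (-x) x
      = truncLine k β s (-x) (-a) + truncLine k β s (-a) b + truncLine k β s b x := by
    simp only [truncLine]
    rw [intervalIntegral.integral_add_adjacent_intervals (hi _ _) (hi _ _),
      intervalIntegral.integral_add_adjacent_intervals (hi _ _) (hi _ _)]
  have t1 := norm_truncLine_tail_le hk.le (hne (-β)) hs ha hxa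
  have t2 := norm_truncLine_tail_le hk.le (hne β) hs hb hxb
  rw [← truncLine_neg] at t1
  have e3 : k + ((-β : ℝ) : ℂ) = k - β := by push_cast; ring
  rw [e3] at t1
  have e2 : truncLine k β s (-a) b - truncLine k β s (-x) x
      = -(truncLine k β s (-x) (-a) + truncLine k β s b x) := by rw [e1]; ring
  rw [e2, norm_neg, mul_add]
  exact (norm_add_le _ _).trans (add_le_add t1 t2)

lemma continuous_truncLine (β : ℝ) {s : ℝ} (hs : 0 < s) (a b : ℝ) :
    Continuous fun k => truncLine k β s a b := by
  refine intervalIntegral.continuous_parametric_intervalIntegral_of_continuous'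
    (f := fun (k : ℂ) (z : ℝ) => waveTerm k 1 (4 * s + z ^ 2) *
      Complex.exp (Complex.I * β * z)) ?_ a b
  have hR : ∀ z : ℝ, ((√(4 * s + z ^ 2) : ℝ) : ℂ) ≠ 0 := fun z => by
    exact_mod_cast (Real.sqrt_pos.2 (by positivity : 0 < 4 * s + z ^ 2)).ne'
  simp only [Function.uncurry_def, waveTerm, pow_one]
  exact Continuous.mul (Continuous.div (by fun_prop) (by fun_prop) fun p => hR p.2) (by fun_prop)

lemma UpperBranch.ne_zero {w : ℂ} (hw : UpperBranch w) : w ≠ 0 := by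
  rintro rfl
  rcases hw with h | h
  · simp at h
  · simp at h

lemma UpperBranch.im_nonneg {w : ℂ} (hw : UpperBranch w) : 0 ≤ w.im := by
  rcases hw with h | h
  · exact h.le
  · exact h.1.ge

lemma continuousAt_hankelSol {κ : ℂ} (hκ : UpperBranch κ) (s : ℝ) :
    ContinuousAt (fun κ => hankelSol κ s) κ := by
  have hslit : κ ∈ Complex.slitPlane := by
    rcases hκ with h | h
    · exact Or.inr h.ne'
    · exact Or.inl h.2
  have hlog : ContinuousAt logConst κ :=
    continuousAt_const.sub (continuousAt_const.mul (continuousAt_clog hslit))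
  have hc : ∀ c, FactorialDecay c → ContinuousAt (fun κ : ℂ => powerSum c (κ ^ 2 * s)) κ := by
    intro c hc
    exact (hc.contDiff.continuous.comp
      (by fun_prop : Continuous fun κ : ℂ => κ ^ 2 * (s : ℂ))).continuousAt
  exact ((hlog.sub continuousAt_const).mul (hc _ factorialDecay_coeffJ)).add
    (continuousAt_const.mul (hc _ factorialDecay_coeffY))

/-- A complex number in the upper half plane has a square root in the first quadrant. -/
lemma exists_sqrt_of_im_pos {w : ℂ} (hw : 0 < w.im) : ∃ z : ℂ, z ^ 2 = w ∧ 0 < z.re ∧ 0 < z.im := by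
  obtain ⟨z, hz⟩ := IsAlgClosed.exists_pow_nat_eq w (n := 2) (by norm_num)
  have him : 0 < z.re * z.im := by
    have := congrArg Complex.im hz
    simp only [pow_two, Complex.mul_im] at this
    nlinarith
  rcases mul_pos_iff.1 him with h | h
  · exact ⟨z, hz, h.1, h.2⟩
  · exact ⟨-z, by rw [neg_sq, hz], by simpa using h.1, by simpa using h.2⟩

/-- For points of the closed first quadrant, closeness of the squares implies closeness. -/
lemma norm_sub_le_of_quadrant {z w : ℂ} (hz : 0 ≤ z.re ∧ 0 ≤ z.im) (hw : 0 ≤ w.re ∧ 0 ≤ w.im)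
    (hw0 : w ≠ 0) : ‖z - w‖ ≤ ‖z ^ 2 - w ^ 2‖ / ‖w‖ := by
  have h1 : ‖w‖ ≤ ‖z + w‖ := by
    rw [← sq_le_sq₀ (norm_nonneg _) (norm_nonneg _), ← Complex.normSq_eq_norm_sq,
      ← Complex.normSq_eq_norm_sq, Complex.normSq_apply, Complex.normSq_apply, Complex.add_re,
      Complex.add_im]
    nlinarith [mul_nonneg hz.1 hw.1, mul_nonneg hz.2 hw.2]
  rw [le_div_iff₀ (norm_pos_iff.2 hw0), sq_sub_sq, norm_mul, mul_comm]
  gcongr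

/-- A real `κ` would make `k²` a positive real number, although `Im k > 0`. -/
lemma im_pos_of_sq_eq {k κ : ℂ} (hk : 0 < k.im) {β : ℝ} (hκ : κ ^ 2 = k ^ 2 - (β : ℂ) ^ 2)
    (hκ' : UpperBranch κ) : 0 < κ.im := by
  rcases hκ' with h | ⟨h, h'⟩
  · exact h
  · exfalso
    have e1 := congrArg Complex.re hκ
    have e2 := congrArg Complex.im hκ
    simp only [pow_two, Complex.mul_re, Complex.mul_im, Complex.sub_re, Complex.sub_im,
      Complex.ofReal_re, Complex.ofReal_im, h] at e1 e2
    have h3 : k.re = 0 := by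
      have : k.re * k.im = 0 := by linarith
      exact (mul_eq_zero.1 this).resolve_right hk.ne'
    rw [h3] at e1
    nlinarith [sq_nonneg β]

/-- The Fourier integral of the spherical wave along a line converges to the cylindrical wave, with
an explicit rate. For real wave numbers this is the limit of vanishing absorption. -/
lemma norm_truncLine_sub_le {k κ : ℂ} (hk : UpperBranch k) {β : ℝ}
    (hκ : κ ^ 2 = k ^ 2 - (β : ℂ) ^ 2) (hκ' : UpperBranch κ) {s : ℝ} (hs : 0 < s) {a b : ℝ}
    (ha : 1 ≤ a) (hb : 1 ≤ b) :
    ‖truncLine k β s (-a) b - hankelSol κ s‖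
      ≤ (3 + 4 * s * ‖k‖) * (1 / (‖k - β‖ * a) + 1 / (‖k + β‖ * b)) := by
  rcases hk with hk | ⟨hk0, hk1⟩
  · exact norm_truncLine_sub_le_of_im_pos hk hκ (im_pos_of_sq_eq hk hκ hκ') hs ha hb
  let kε : ℝ → ℂ := fun ε => k + Complex.I * ε
  have him : ∀ ε : ℝ, 0 < ε → 0 < (kε ε ^ 2 - (β : ℂ) ^ 2).im := by
    intro ε hε
    simp [kε, pow_two, hk0]
    positivity
  have hex : ∀ ε : ℝ, ∃ z : ℂ, 0 < ε → z ^ 2 = kε ε ^ 2 - (β : ℂ) ^ 2 ∧ 0 < z.re ∧ 0 < z.im := by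
    intro ε
    by_cases hε : 0 < ε
    · obtain ⟨z, hz⟩ := exists_sqrt_of_im_pos (him ε hε)
      exact ⟨z, fun _ => hz⟩
    · exact ⟨0, fun h => absurd h hε⟩
  choose κε hκε using hex
  have hkc : Tendsto kε (𝓝[>] 0) (𝓝 k) := by
    have : Continuous kε := by fun_prop
    simpa [kε] using (this.tendsto 0).mono_left nhdsWithin_le_nhds
  have hκq : 0 ≤ κ.re ∧ 0 ≤ κ.im := by
    refine ⟨?_, hκ'.im_nonneg⟩
    rcases hκ' with h | h
    · have e2 := congrArg Complex.im hκ
      simp only [pow_two, Complex.mul_im, Complex.sub_im, Complex.ofReal_re, Complex.ofReal_im,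
        hk0] at e2
      have : κ.re * κ.im = 0 := by linarith
      exact ((mul_eq_zero.1 this).resolve_right h.ne').ge
    · exact h.2.le
  have hκ0 := hκ'.ne_zero
  have hκc : Tendsto κε (𝓝[>] 0) (𝓝 κ) := by
    rw [tendsto_iff_norm_sub_tendsto_zero]
    have h1 : Tendsto (fun ε => ‖kε ε ^ 2 - k ^ 2‖ / ‖κ‖) (𝓝[>] 0) (𝓝 0) := by
      have := (((hkc.pow 2).sub_const (k ^ 2)).norm).div_const ‖κ‖
      simpa using this
    refine squeeze_zero' (Eventually.of_forall fun _ => norm_nonneg _) ?_ h1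
    filter_upwards [self_mem_nhdsWithin] with ε hε
    obtain ⟨h2, h3, h4⟩ := hκε ε hε
    have := norm_sub_le_of_quadrant ⟨h3.le, h4.le⟩ hκq hκ0
    rwa [h2, hκ, sub_sub_sub_cancel_right] at this
  have hprod : (k - β) * (k + β) ≠ 0 := by
    have : (k - β) * (k + β) = κ ^ 2 := by rw [hκ]; ring
    rw [this]; exact pow_ne_zero 2 hκ0
  have hm := left_ne_zero_of_mul hprod
  have hp := right_ne_zero_of_mul hprod
  have hL := (((continuous_truncLine β hs (-a) b).tendsto k).comp hkc).sub
    ((continuousAt_hankelSol hκ' s).tendsto.comp hκc)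
  have hRm := ((hkc.sub_const (β : ℂ)).norm.mul_const a)
  have hRp := ((hkc.add_const (β : ℂ)).norm.mul_const b)
  have hR := ((hkc.norm.const_mul (4 * s)).const_add 3).mul
    (((tendsto_const_nhds (x := (1 : ℝ))).div hRm
      (mul_ne_zero (norm_ne_zero_iff.2 hm) (by linarith))).add
      ((tendsto_const_nhds (x := (1 : ℝ))).div hRp
        (mul_ne_zero (norm_ne_zero_iff.2 hp) (by linarith))))
  refine le_of_tendsto_of_tendsto hL.norm hR ?_
  filter_upwards [self_mem_nhdsWithin] with ε hε
  obtain ⟨h2, h3, h4⟩ := hκε ε hε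
  refine norm_truncLine_sub_le_of_im_pos ?_ h2 h4 hs ha hb
  simp [kε, hk0]
  exact hε

/-! ### Layer potentials with smooth kernels in the plane -/

lemma CrossSection.isClosed_Γ (C : CrossSection) : IsClosed C.Γ := isClosed_frontier

lemma CrossSection.isBounded_Γ (C : CrossSection) : Bornology.IsBounded C.Γ :=
  C.isBounded.closure.subset frontier_subset_closure

lemma CrossSection.ae_mem_Γ (C : CrossSection) : ∀ᵐ Q ∂C.arc, Q ∈ C.Γ :=
  ae_restrict_mem C.isClosed_Γ.measurableSet

instance CrossSection.isFiniteMeasure_arc (C : CrossSection) : IsFiniteMeasure C.arc :=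
  ⟨by rw [CrossSection.arc, Measure.restrict_apply_univ]; exact C.finite_length⟩

/-- Near a point off the curve, the distance to the curve is bounded from above and from below. -/
lemma CrossSection.exists_dist_bounds (C : CrossSection) {P : Plane} (hP : P ∉ C.Γ) :
    ∃ d D : ℝ, 0 < d ∧ ∀ P' ∈ Metric.ball P d, ∀ Q ∈ C.Γ, d ≤ ‖P' - Q‖ ∧ ‖P' - Q‖ ≤ D := by
  obtain ⟨ε, hε, hball⟩ := Metric.isOpen_iff.1 C.isClosed_Γ.isOpen_compl P hP
  obtain ⟨B, hB⟩ := C.isBounded_Γ.exists_norm_le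
  refine ⟨ε / 2, ‖P‖ + ε / 2 + B, by positivity, fun P' hP' Q hQ => ?_⟩
  have h1 : ε ≤ dist Q P := by
    by_contra h
    exact hball (Metric.mem_ball.2 (not_le.1 h)) hQ
  have h2 : ‖P' - P‖ < ε / 2 := by rwa [mem_ball_iff_norm] at hP'
  rw [dist_eq_norm] at h1
  constructor
  · have h3 : ‖Q - P‖ ≤ ‖P' - Q‖ + ‖P' - P‖ := by
      have : Q - P = -(P' - Q) + (P' - P) := by abel
      rw [this]
      exact (norm_add_le _ _).trans (by rw [norm_neg])
    linarith
  · have h3 : ‖P' - Q‖ ≤ ‖P' - P‖ + ‖P‖ + ‖Q‖ := by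
      have : P' - Q = (P' - P) + P - Q := by abel
      rw [this]
      exact (norm_sub_le _ _).trans (by gcongr; exact norm_add_le _ _)
    linarith [hB Q hQ]

/-- The layer potential with convolution kernel `K`. -/
def potential (C : CrossSection) (K σ : Plane → ℂ) (P : Plane) : ℂ :=
  ∫ Q, K (P - Q) * σ Q ∂C.arc

/-- The points `P' - Q` stay in a compact annulus, on which the kernel is bounded. -/
lemma exists_kernel_bound (C : CrossSection) {E : Type*} [NormedAddCommGroup E] {K : Plane → E}
    (hK : ContinuousOn K {0}ᶜ) {P : Plane} (hP : P ∉ C.Γ) :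
    ∃ d B : ℝ, 0 < d ∧ ∀ P' ∈ Metric.ball P d, ∀ Q ∈ C.Γ, ‖K (P' - Q)‖ ≤ B := by
  obtain ⟨d, D, hd, h⟩ := C.exists_dist_bounds hP
  have hcomp : IsCompact (Metric.closedBall (0 : Plane) D \ Metric.ball 0 d) :=
    (isCompact_closedBall 0 D).diff Metric.isOpen_ball
  obtain ⟨B, hB⟩ := hcomp.exists_bound_of_continuousOn (hK.mono (fun x hx h0 => by
    rw [Set.mem_singleton_iff.1 h0] at hx
    exact hx.2 (Metric.mem_ball_self hd)))
  refine ⟨d, B, hd, fun P' hP' Q hQ => hB _ ⟨?_, ?_⟩⟩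
  · simpa using (h P' hP' Q hQ).2
  · simpa using (h P' hP' Q hQ).1

lemma aestronglyMeasurable_kernel (C : CrossSection) {E : Type*} [NormedAddCommGroup E]
    [SecondCountableTopology E] {K : Plane → E}
    (hK : ContinuousOn K {0}ᶜ) {P : Plane} (hP : P ∉ C.Γ) :
    AEStronglyMeasurable (fun Q => K (P - Q)) C.arc := by
  refine ContinuousOn.aestronglyMeasurable (s := C.Γ) ?_ C.isClosed_Γ.measurableSet
  refine hK.comp (by fun_prop) fun Q hQ h0 => ?_
  exact hP ((sub_eq_zero.1 (Set.mem_singleton_iff.1 h0)) ▸ hQ)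

lemma integrable_kernel_mul (C : CrossSection) {K : Plane → ℂ} (hK : ContinuousOn K {0}ᶜ)
    {σ : Plane → ℂ} (hσ : Integrable σ C.arc) {P : Plane} (hP : P ∉ C.Γ) :
    Integrable (fun Q => K (P - Q) * σ Q) C.arc := by
  obtain ⟨d, B, hd, hB⟩ := exists_kernel_bound C hK hP
  refine hσ.bdd_mul (c := B) (aestronglyMeasurable_kernel C hK hP) ?_
  filter_upwards [C.ae_mem_Γ] with Q hQ
  exact hB P (Metric.mem_ball_self hd) Q hQ

/-- The kernel is smooth away from the origin. -/
abbrev SmoothOffZero (K : Plane → ℂ) : Prop := ContDiffOn ℝ ∞ K {0}ᶜ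

lemma SmoothOffZero.continuousOn_fderiv {K : Plane → ℂ} (hK : SmoothOffZero K) :
    ContinuousOn (fderiv ℝ K) {0}ᶜ :=
  hK.continuousOn_fderiv_of_isOpen isOpen_compl_singleton (by simp)

lemma SmoothOffZero.differentiableAt {K : Plane → ℂ} (hK : SmoothOffZero K) {x : Plane}
    (hx : x ≠ 0) : DifferentiableAt ℝ K x :=
  (hK.contDiffAt (isOpen_compl_singleton.mem_nhds hx)).differentiableAt (by simp)

lemma SmoothOffZero.pd2 {K : Plane → ℂ} (hK : SmoothOffZero K) (i : Fin 2) :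
    SmoothOffZero (pd2 i K) := by
  have := hK.fderiv_of_isOpen (m := ∞) isOpen_compl_singleton (by simp)
  exact this.clm_apply contDiffOn_const

lemma hasFDerivAt_potential (C : CrossSection) {K : Plane → ℂ} (hK : SmoothOffZero K)
    {σ : Plane → ℂ} (hσ : Integrable σ C.arc) {P : Plane} (hP : P ∉ C.Γ) :
    Integrable (fun Q => σ Q • fderiv ℝ K (P - Q)) C.arc ∧
    HasFDerivAt (potential C K σ) (∫ Q, σ Q • fderiv ℝ K (P - Q) ∂C.arc) P := by
  obtain ⟨d, B, hd, hB⟩ := exists_kernel_bound C hK.continuousOn_fderiv hP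
  obtain ⟨d', D, hd', hD⟩ := C.exists_dist_bounds hP
  have hmeas : AEStronglyMeasurable (fun Q => σ Q • fderiv ℝ K (P - Q)) C.arc :=
    hσ.aestronglyMeasurable.smul (aestronglyMeasurable_kernel C hK.continuousOn_fderiv hP)
  have hbound : ∀ᵐ Q ∂C.arc, ∀ P' ∈ Metric.ball P (min d d'),
      ‖σ Q • fderiv ℝ K (P' - Q)‖ ≤ B * ‖σ Q‖ := by
    filter_upwards [C.ae_mem_Γ] with Q hQ P' hP'
    rw [norm_smul, mul_comm]
    gcongr
    exact hB P' (Metric.ball_subset_ball (min_le_left _ _) hP') Q hQ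
  have hmem : Metric.ball P (min d d') ∈ 𝓝 P := Metric.ball_mem_nhds P (lt_min hd hd')
  refine ⟨(hσ.norm.const_mul B).mono' hmeas ?_, ?_⟩
  · filter_upwards [hbound] with Q hQ
    exact hQ P (mem_of_mem_nhds hmem)
  refine hasFDerivAt_integral_of_dominated_of_fderiv_le (bound := fun Q => B * ‖σ Q‖)
    (F := fun P Q => K (P - Q) * σ Q) (F' := fun P Q => σ Q • fderiv ℝ K (P - Q))
    hmem ?_ (integrable_kernel_mul C hK.continuousOn hσ hP) hmeas hbound (hσ.norm.const_mul B) ?_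
  · filter_upwards [C.isClosed_Γ.isOpen_compl.mem_nhds hP] with P' hP'
    exact (integrable_kernel_mul C hK.continuousOn hσ hP').aestronglyMeasurable
  · filter_upwards [C.ae_mem_Γ] with Q hQ P' hP'
    have hne : P' - Q ≠ 0 := by
      have := (hD P' (Metric.ball_subset_ball (min_le_right _ _) hP') Q hQ).1
      intro h0
      rw [h0, norm_zero] at this
      linarith
    have h1 : HasFDerivAt (fun P' => K (P' - Q)) (fderiv ℝ K (P' - Q)) P' :=
      (hK.differentiableAt hne).hasFDerivAt.comp P' ((hasFDerivAt_id P').sub_const Q)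
    exact h1.mul_const (σ Q)

lemma pd2_potential (C : CrossSection) {K : Plane → ℂ} (hK : SmoothOffZero K)
    {σ : Plane → ℂ} (hσ : Integrable σ C.arc) {P : Plane} (hP : P ∉ C.Γ) (i : Fin 2) :
    pd2 i (potential C K σ) P = potential C (pd2 i K) σ P := by
  obtain ⟨h1, h2⟩ := hasFDerivAt_potential C hK hσ hP
  rw [pd2, h2.fderiv, ContinuousLinearMap.integral_apply h1]
  refine integral_congr_ae (ae_of_all _ fun Q => ?_)
  simp [pd2, mul_comm]

lemma pd2_congr {U : Set Plane} (hU : IsOpen U) {f g : Plane → ℂ} (h : Set.EqOn f g U) (i : Fin 2) :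
    Set.EqOn (pd2 i f) (pd2 i g) U := fun P hP => by
  rw [pd2, pd2, (h.eventuallyEq_of_mem (hU.mem_nhds hP)).fderiv_eq]

lemma pd2_pd2_potential (C : CrossSection) {K : Plane → ℂ} (hK : SmoothOffZero K)
    {σ : Plane → ℂ} (hσ : Integrable σ C.arc) {P : Plane} (hP : P ∉ C.Γ) (i j : Fin 2) :
    pd2 i (pd2 j (potential C K σ)) P = potential C (pd2 i (pd2 j K)) σ P := by
  rw [pd2_congr C.isClosed_Γ.isOpen_compl (fun P hP => pd2_potential C hK hσ hP j) i hP,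
    pd2_potential C (hK.pd2 j) hσ hP]

lemma plane_eq (v : Plane) :
    v = v 0 • EuclideanSpace.single 0 1 + v 1 • EuclideanSpace.single 1 1 := by
  ext i; fin_cases i <;> simp

lemma fderiv_eq_pd2 (f : Plane → ℂ) (P v : Plane) :
    fderiv ℝ f P v = v 0 * pd2 0 f P + v 1 * pd2 1 f P := by
  conv_lhs => rw [plane_eq v]
  simp [pd2]

lemma contDiffOn_potential (C : CrossSection) {σ : Plane → ℂ} (hσ : Integrable σ C.arc) (n : ℕ) :
    ∀ {K : Plane → ℂ}, SmoothOffZero K → ContDiffOn ℝ n (potential C K σ) C.Γᶜ := by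
  have hopen : IsOpen C.Γᶜ := C.isClosed_Γ.isOpen_compl
  have hdiff : ∀ {K : Plane → ℂ}, SmoothOffZero K →
      DifferentiableOn ℝ (potential C K σ) C.Γᶜ := fun hK P hP =>
    (hasFDerivAt_potential C hK hσ hP).2.differentiableAt.differentiableWithinAt
  induction n with
  | zero => exact fun hK => contDiffOn_zero.2 (hdiff hK).continuousOn
  | succ n ih =>
    intro K hK
    push_cast
    rw [contDiffOn_succ_iff_fderiv_of_isOpen hopen]
    refine ⟨hdiff hK, by simp, ?_⟩
    -- the derivative is assembled from the potentials of the partial derivatives of the kernel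
    have e : Set.EqOn (fderiv ℝ (potential C K σ))
        (fun P => potential C (pd2 0 K) σ P •
            (Complex.ofRealCLM.comp (EuclideanSpace.proj (𝕜 := ℝ) (0 : Fin 2)))
          + potential C (pd2 1 K) σ P •
            (Complex.ofRealCLM.comp (EuclideanSpace.proj (𝕜 := ℝ) (1 : Fin 2)))) C.Γᶜ := by
      intro P hP
      ext v
      rw [fderiv_eq_pd2, pd2_potential C hK hσ hP, pd2_potential C hK hσ hP]
      simp [mul_comm]
    refine ContDiffOn.congr ?_ e
    exact ((ih (hK.pd2 0)).smul contDiffOn_const).add ((ih (hK.pd2 1)).smul contDiffOn_const)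

/-- The Green's function as a convolution kernel. -/
def greenKernel (κ : ℂ) (x : Plane) : ℂ := hankelSol κ (‖x‖ ^ 2 / 4) / (4 * Real.pi)

/-- On the diagonal both sides are junk values and need not agree. -/
lemma green_eq {κ : ℂ} (hκ : κ ≠ 0) {P Q : Plane} (h : P ≠ Q) :
    green κ P Q = greenKernel κ (P - Q) := by
  have hpi : (Real.pi : ℂ) ≠ 0 := by exact_mod_cast Real.pi_ne_zero
  rw [greenKernel, ← hankel0_eq hκ (norm_pos_iff.2 (sub_ne_zero.2 h)), green]
  field_simp

lemma FactorialDecay.contDiff_scale {c : ℕ → ℂ} (hc : FactorialDecay c) (a : ℂ) :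
    ContDiff ℝ ∞ fun s : ℝ => powerSum c (a * s) :=
  (hc.contDiff.restrict_scalars ℝ).comp (contDiff_const.mul Complex.ofRealCLM.contDiff)

lemma contDiffOn_hankelSol (κ : ℂ) : ContDiffOn ℝ ∞ (hankelSol κ) (Set.Ioi 0) := by
  have hlog : ContDiffOn ℝ ∞ (fun s : ℝ => (Real.log s : ℂ)) (Set.Ioi 0) :=
    Complex.ofRealCLM.contDiff.comp_contDiffOn
      (contDiffOn_id.log fun s hs => (ne_of_gt hs))
  exact ((contDiffOn_const.sub hlog).mul (factorialDecay_coeffJ.contDiff_scale _).contDiffOn).add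
    (contDiffOn_const.mul (factorialDecay_coeffY.contDiff_scale _).contDiffOn)

lemma smoothOffZero_greenKernel (κ : ℂ) : SmoothOffZero (greenKernel κ) := by
  refine ContDiffOn.div_const ((contDiffOn_hankelSol κ).comp
    ((contDiff_norm_sq ℝ).div_const 4).contDiffOn fun x hx => ?_) _
  have : 0 < ‖x‖ := norm_pos_iff.2 hx
  exact Set.mem_Ioi.2 (by positivity)

lemma pd2_comp_normSq {f : ℝ → ℂ} {f' : ℂ} {x : Plane}
    (hf : HasDerivAt f f' (‖x‖ ^ 2 / 4)) :
    DifferentiableAt ℝ (fun x : Plane => f (‖x‖ ^ 2 / 4)) x ∧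
    ∀ i, pd2 i (fun x : Plane => f (‖x‖ ^ 2 / 4)) x = f' * (x i / 2) := by
  have h1 : HasFDerivAt (fun x : Plane => ‖x‖ ^ 2 / 4) ((1 / 4 : ℝ) • (2 • innerSL ℝ x)) x := by
    have := (hasStrictFDerivAt_norm_sq x).hasFDerivAt.const_mul (1 / 4 : ℝ)
    refine this.congr_of_eventuallyEq (Eventually.of_forall fun y => ?_)
    simp only; ring
  have h2 := hf.hasFDerivAt.comp x h1
  refine ⟨h2.differentiableAt, fun i => ?_⟩
  have h3 : fderiv ℝ (fun x : Plane => f (‖x‖ ^ 2 / 4)) x = _ := h2.fderiv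
  rw [pd2, h3]
  simp [EuclideanSpace.inner_single_right]
  ring

lemma pd2_greenKernel (κ : ℂ) {x : Plane} (hx : x ≠ 0) (i : Fin 2) :
    pd2 i (greenKernel κ) x = hankelSol₁ κ (‖x‖ ^ 2 / 4) * (x i / 2) / (4 * Real.pi) := by
  have hpos : 0 < ‖x‖ ^ 2 / 4 := by have := norm_pos_iff.2 hx; positivity
  have h := ((besselSol_hankelSol κ).deriv _ hpos).div_const (4 * (Real.pi : ℂ))
  have := (pd2_comp_normSq h).2 i
  rw [show greenKernel κ = fun x => hankelSol κ (‖x‖ ^ 2 / 4) / (4 * Real.pi) from rfl, this]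
  ring

lemma pd2_pd2_greenKernel (κ : ℂ) {x : Plane} (hx : x ≠ 0) (i j : Fin 2) :
    pd2 i (pd2 j (greenKernel κ)) x =
      (hankelSol₂ κ (‖x‖ ^ 2 / 4) * (x i / 2) * (x j / 2)
        + hankelSol₁ κ (‖x‖ ^ 2 / 4) * (if i = j then 1 / 2 else 0)) / (4 * Real.pi) := by
  have hpos : 0 < ‖x‖ ^ 2 / 4 := by have := norm_pos_iff.2 hx; positivity
  have h := ((besselSol_hankelSol κ).deriv₂ _ hpos)
  obtain ⟨hd, hp⟩ := pd2_comp_normSq h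
  rw [pd2_congr isOpen_compl_singleton (fun x hx => pd2_greenKernel κ hx j) i hx]
  have hc : HasFDerivAt (fun x : Plane => ((x j : ℂ) / 2) / (4 * Real.pi))
      ((1 / (2 * (4 * Real.pi)) : ℂ) • Complex.ofRealCLM.comp (EuclideanSpace.proj (𝕜 := ℝ) j)) x := by
    have := (Complex.ofRealCLM.comp (EuclideanSpace.proj (𝕜 := ℝ) j)).hasFDerivAt (x := x)
    have h2 := this.const_mul (1 / (2 * (4 * Real.pi)) : ℂ)
    refine h2.congr_of_eventuallyEq (Eventually.of_forall fun y => ?_)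
    simp
    ring
  have hm := hd.hasFDerivAt.mul hc
  have e : (fun x : Plane => hankelSol₁ κ (‖x‖ ^ 2 / 4) * (x j / 2) / (4 * Real.pi))
      = (fun x : Plane => hankelSol₁ κ (‖x‖ ^ 2 / 4)) * fun x => ((x j : ℂ) / 2) / (4 * Real.pi) := by
    funext y; simp only [Pi.mul_apply]; ring
  rw [pd2, e, hm.fderiv]
  have hp' := hp i
  rw [pd2] at hp'
  have hproj : EuclideanSpace.proj (𝕜 := ℝ) j (EuclideanSpace.single i (1 : ℝ) : Plane)
      = if j = i then 1 else 0 := by simp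
  simp only [add_apply, smul_apply, hp', smul_eq_mul, ContinuousLinearMap.comp_apply,
    Complex.ofRealCLM_apply, hproj]
  by_cases hij : i = j
  · subst hij; simp; ring
  · simp [hij, Ne.symm hij]; ring

/-- The Helmholtz equation for the Green's function. -/
lemma helmholtz_greenKernel (κ : ℂ) {x : Plane} (hx : x ≠ 0) :
    pd2 0 (pd2 0 (greenKernel κ)) x + pd2 1 (pd2 1 (greenKernel κ)) x
      = -κ ^ 2 * greenKernel κ x := by
  have hpos : 0 < ‖x‖ ^ 2 / 4 := by have := norm_pos_iff.2 hx; positivity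
  have h := (besselSol_hankelSol κ).eq _ hpos
  have hn : ‖x‖ ^ 2 = x 0 ^ 2 + x 1 ^ 2 := by
    rw [EuclideanSpace.norm_sq_eq, Fin.sum_univ_two]; simp
  have hn' : ((‖x‖ ^ 2 / 4 : ℝ) : ℂ) = ((x 0 : ℂ) ^ 2 + (x 1 : ℂ) ^ 2) / 4 := by
    rw [hn]; push_cast; ring
  rw [pd2_pd2_greenKernel κ hx, pd2_pd2_greenKernel κ hx, greenKernel]
  rw [hn'] at h
  simp only [if_true]
  linear_combination h / (4 * Real.pi)

/-! ### The single, double and anti-double layer potentials -/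

lemma norm_rot (t : Plane) : ‖rot t‖ = ‖t‖ := by
  rw [EuclideanSpace.norm_eq, EuclideanSpace.norm_eq]
  simp [rot, Fin.sum_univ_two, add_comm]

lemma CrossSection.ae_norm_τ (C : CrossSection) : ∀ᵐ Q ∂C.arc, ‖C.τ Q‖ = 1 := by
  have h : ∀ᵐ Q ∂C.arc, IsOutwardUnitNormal C.Ω Q (rot (C.τ Q)) := C.outward
  filter_upwards [h] with Q hQ
  rw [← norm_rot]
  exact hQ.1

lemma CrossSection.integrable_mul_τ (C : CrossSection) {σ : Plane → ℂ} (hσ : Integrable σ C.arc)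
    (i : Fin 2) : Integrable (fun Q => σ Q * (C.τ Q i : ℂ)) C.arc := by
  have hm : Measurable fun Q => (C.τ Q i : ℂ) :=
    Complex.measurable_ofReal.comp
      ((EuclideanSpace.proj (𝕜 := ℝ) i).continuous.measurable.comp C.measurable_τ)
  refine hσ.mul_bdd (c := 1) hm.aestronglyMeasurable ?_
  filter_upwards [C.ae_norm_τ] with Q hQ
  rw [Complex.norm_real, ← hQ]
  exact PiLp.norm_apply_le _ i

lemma CrossSection.ne_of_mem (C : CrossSection) {P Q : Plane} (hP : P ∉ C.Γ) (hQ : Q ∈ C.Γ) :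
    P ≠ Q := fun h => hP (h ▸ hQ)

section

variable {C : CrossSection} {κ : ℂ} {σ : Plane → ℂ} {P : Plane}

lemma integrable_green (hκ : κ ≠ 0) (hσ : Integrable σ C.arc) (hP : P ∉ C.Γ) :
    Integrable (fun Q => green κ P Q * σ Q) C.arc := by
  refine (integrable_kernel_mul C (smoothOffZero_greenKernel κ).continuousOn hσ hP).congr ?_
  filter_upwards [C.ae_mem_Γ] with Q hQ
  rw [green_eq hκ (C.ne_of_mem hP hQ)]

lemma single_eq_potential (hκ : κ ≠ 0) (σ : Plane → ℂ) (hP : P ∉ C.Γ) :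
    single C κ σ P = potential C (greenKernel κ) σ P := by
  refine integral_congr_ae ?_
  filter_upwards [C.ae_mem_Γ] with Q hQ
  rw [green_eq hκ (C.ne_of_mem hP hQ)]

lemma dGreen_eq (hκ : κ ≠ 0) {Q : Plane} (h : P ≠ Q) (v : Plane) :
    dGreen κ P Q v =
      -(v 0 * pd2 0 (greenKernel κ) (P - Q) + v 1 * pd2 1 (greenKernel κ) (P - Q)) := by
  have hev : (fun Q' => green κ P Q') =ᶠ[𝓝 Q] fun Q' => greenKernel κ (P - Q') := by
    filter_upwards [isOpen_compl_singleton.mem_nhds (Ne.symm h : Q ∈ ({P} : Set Plane)ᶜ)] with Q' hQ'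
    exact green_eq hκ (Ne.symm hQ')
  have h1 := ((smoothOffZero_greenKernel κ).differentiableAt (sub_ne_zero.2 h)).hasFDerivAt.comp Q
    ((hasFDerivAt_id Q).const_sub P)
  rw [dGreen, hev.fderiv_eq]
  have h2 : fderiv ℝ (fun Q' => greenKernel κ (P - Q')) Q = _ := h1.fderiv
  rw [h2, ← fderiv_eq_pd2]
  simp

lemma integrable_dGreen (hκ : κ ≠ 0) (hP : P ∉ C.Γ) {v : Plane → Plane}
    (h0 : Integrable (fun Q => σ Q * (v Q 0 : ℂ)) C.arc)
    (h1 : Integrable (fun Q => σ Q * (v Q 1 : ℂ)) C.arc) :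
    Integrable (fun Q => dGreen κ P Q (v Q) * σ Q) C.arc ∧
    ∫ Q, dGreen κ P Q (v Q) * σ Q ∂C.arc =
      -(pd2 0 (single C κ fun Q => σ Q * (v Q 0 : ℂ)) P
        + pd2 1 (single C κ fun Q => σ Q * (v Q 1 : ℂ)) P) := by
  have hK := smoothOffZero_greenKernel κ
  have i0 := integrable_kernel_mul C (hK.pd2 0).continuousOn h0 hP
  have i1 := integrable_kernel_mul C (hK.pd2 1).continuousOn h1 hP
  have e : (fun Q => dGreen κ P Q (v Q) * σ Q) =ᵐ[C.arc] fun Q =>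
      -(pd2 0 (greenKernel κ) (P - Q) * (σ Q * (v Q 0 : ℂ))
        + pd2 1 (greenKernel κ) (P - Q) * (σ Q * (v Q 1 : ℂ))) := by
    filter_upwards [C.ae_mem_Γ] with Q hQ
    rw [dGreen_eq hκ (C.ne_of_mem hP hQ)]; ring
  refine ⟨(i0.add i1).neg.congr e.symm, ?_⟩
  have hs : ∀ τ : Plane → ℂ, Set.EqOn (single C κ τ) (potential C (greenKernel κ) τ) C.Γᶜ :=
    fun τ P hP => single_eq_potential hκ τ hP
  have hopen := C.isClosed_Γ.isOpen_compl
  rw [integral_congr_ae e, integral_neg, integral_add i0 i1, pd2_congr hopen (hs _) 0 hP,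
    pd2_congr hopen (hs _) 1 hP, pd2_potential C hK h0 hP, pd2_potential C hK h1 hP]
  rfl

lemma integrable_double (hκ : κ ≠ 0) (hσ : Integrable σ C.arc) (hP : P ∉ C.Γ) :
    Integrable (fun Q => dGreen κ P Q (C.ν Q) * σ Q) C.arc := by
  refine (integrable_dGreen hκ hP ?_ ?_).1
  · simpa [CrossSection.ν, rot] using C.integrable_mul_τ hσ 1
  · simpa [CrossSection.ν, rot] using (C.integrable_mul_τ hσ 0).neg

lemma integrable_antiDouble (hκ : κ ≠ 0) (hσ : Integrable σ C.arc) (hP : P ∉ C.Γ) :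
    Integrable (fun Q => dGreen κ P Q (C.τ Q) * σ Q) C.arc :=
  (integrable_dGreen hκ hP (C.integrable_mul_τ hσ 0) (C.integrable_mul_τ hσ 1)).1

/-- The anti-double layer potential is minus a divergence of single layer potentials. -/
lemma antiDouble_eq (hκ : κ ≠ 0) (hσ : Integrable σ C.arc) (hP : P ∉ C.Γ) :
    antiDouble C κ σ P = -(pd2 0 (single C κ fun Q => σ Q * (C.τ Q 0 : ℂ)) P
        + pd2 1 (single C κ fun Q => σ Q * (C.τ Q 1 : ℂ)) P) :=
  (integrable_dGreen hκ hP (C.integrable_mul_τ hσ 0) (C.integrable_mul_τ hσ 1)).2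

/-- The double layer potential is minus a plane curl of single layer potentials. -/
lemma double_eq (hκ : κ ≠ 0) (hσ : Integrable σ C.arc) (hP : P ∉ C.Γ) :
    double C κ σ P = -(pd2 0 (single C κ fun Q => σ Q * (C.τ Q 1 : ℂ)) P
        - pd2 1 (single C κ fun Q => σ Q * (C.τ Q 0 : ℂ)) P) := by
  have h := (integrable_dGreen (κ := κ) (v := C.ν) (σ := σ) hκ hP
    (by simpa [CrossSection.ν, rot] using C.integrable_mul_τ hσ 1)
    (by simpa [CrossSection.ν, rot] using (C.integrable_mul_τ hσ 0).neg)).2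
  have e : (single C κ fun Q => σ Q * (C.ν Q 1 : ℂ))
      = -(single C κ fun Q => σ Q * (C.τ Q 0 : ℂ)) := by
    funext P
    simp only [single, Pi.neg_apply, ← integral_neg]
    refine integral_congr_ae (ae_of_all _ fun Q => ?_)
    simp [CrossSection.ν, rot]
  have e' : pd2 1 (-(single C κ fun Q => σ Q * (C.τ Q 0 : ℂ))) P
      = - pd2 1 (single C κ fun Q => σ Q * (C.τ Q 0 : ℂ)) P := by
    rw [pd2, fderiv_neg]; rfl
  rw [double, h, e, e']
  simp only [CrossSection.ν, rot]
  simp [sub_eq_add_neg]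

lemma contDiffOn_single (hκ : κ ≠ 0) (hσ : Integrable σ C.arc) (n : ℕ) :
    ContDiffOn ℝ n (single C κ σ) C.Γᶜ :=
  (contDiffOn_potential C hσ n (smoothOffZero_greenKernel κ)).congr
    fun _ hP => single_eq_potential hκ σ hP

lemma differentiableOn_pd2_of_contDiffOn {U : Set Plane} (hU : IsOpen U) {f : Plane → ℂ}
    (hf : ContDiffOn ℝ 2 f U) (i : Fin 2) : DifferentiableOn ℝ (pd2 i f) U := by
  have : ContDiffOn ℝ 1 (fderiv ℝ f) U := hf.fderiv_of_isOpen hU (by norm_num)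
  exact (this.differentiableOn (by simp)).clm_apply (differentiableOn_const _)

lemma differentiableOn_pd2_single (hκ : κ ≠ 0) (hσ : Integrable σ C.arc) (i : Fin 2) :
    DifferentiableOn ℝ (pd2 i (single C κ σ)) C.Γᶜ :=
  differentiableOn_pd2_of_contDiffOn C.isClosed_Γ.isOpen_compl (contDiffOn_single hκ hσ 2) i

lemma differentiableOn_single (hκ : κ ≠ 0) (hσ : Integrable σ C.arc) :
    DifferentiableOn ℝ (single C κ σ) C.Γᶜ :=
  (contDiffOn_single hκ hσ 1).differentiableOn (by simp)

lemma differentiableOn_antiDouble (hκ : κ ≠ 0) (hσ : Integrable σ C.arc) :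
    DifferentiableOn ℝ (antiDouble C κ σ) C.Γᶜ :=
  ((differentiableOn_pd2_single hκ (C.integrable_mul_τ hσ 0) 0).add
    (differentiableOn_pd2_single hκ (C.integrable_mul_τ hσ 1) 1)).neg.congr
    fun _ hP => antiDouble_eq hκ hσ hP

lemma pd2_pd2_single (hκ : κ ≠ 0) (hσ : Integrable σ C.arc) (hP : P ∉ C.Γ) (i j : Fin 2) :
    pd2 i (pd2 j (single C κ σ)) P = potential C (pd2 i (pd2 j (greenKernel κ))) σ P := by
  have hopen := C.isClosed_Γ.isOpen_compl
  have hs : Set.EqOn (single C κ σ) (potential C (greenKernel κ) σ) C.Γᶜ :=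
    fun P hP => single_eq_potential hκ σ hP
  rw [pd2_congr hopen (pd2_congr hopen hs j) i hP,
    pd2_pd2_potential C (smoothOffZero_greenKernel κ) hσ hP]

lemma pd2_comm_single (hκ : κ ≠ 0) (hσ : Integrable σ C.arc) (hP : P ∉ C.Γ) :
    pd2 0 (pd2 1 (single C κ σ)) P = pd2 1 (pd2 0 (single C κ σ)) P := by
  rw [pd2_pd2_single hκ hσ hP, pd2_pd2_single hκ hσ hP]
  refine integral_congr_ae ?_
  filter_upwards [C.ae_mem_Γ] with Q hQ
  have hne := sub_ne_zero.2 (C.ne_of_mem hP hQ)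
  simp only [pd2_pd2_greenKernel κ hne, zero_ne_one, one_ne_zero, if_false]
  ring

/-- The Helmholtz equation for the single layer potential. -/
lemma helmholtz_single (hκ : κ ≠ 0) (hσ : Integrable σ C.arc) (hP : P ∉ C.Γ) :
    pd2 0 (pd2 0 (single C κ σ)) P + pd2 1 (pd2 1 (single C κ σ)) P = -κ ^ 2 * single C κ σ P := by
  have hK := smoothOffZero_greenKernel κ
  rw [pd2_pd2_single hκ hσ hP, pd2_pd2_single hκ hσ hP, single_eq_potential hκ σ hP, potential,
    potential, potential, ← integral_const_mul, ← integral_add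
      (integrable_kernel_mul C ((hK.pd2 0).pd2 0).continuousOn hσ hP)
      (integrable_kernel_mul C ((hK.pd2 1).pd2 1).continuousOn hσ hP)]
  refine integral_congr_ae ?_
  filter_upwards [C.ae_mem_Γ] with Q hQ
  have := helmholtz_greenKernel κ (sub_ne_zero.2 (C.ne_of_mem hP hQ))
  linear_combination σ Q * this

end

/-! ### Potentials of travelling waves in space -/

lemma norm_sub_lift (r : Space) (Q : Plane) (z : ℝ) :
    ‖r - lift Q z‖ = √(4 * (‖proj r - Q‖ ^ 2 / 4) + (z - r 2) ^ 2) := by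
  have h : 4 * (‖proj r - Q‖ ^ 2 / 4) = ‖proj r - Q‖ ^ 2 := by ring
  rw [h, EuclideanSpace.norm_sq_eq, EuclideanSpace.norm_eq]
  congr 1
  simp [Fin.sum_univ_two, Fin.sum_univ_three, proj, lift]
  ring

/-- The function `e^{iβz} u(x, y)` in space. -/
def wave (β : ℝ) (u : Plane → ℂ) (r : Space) : ℂ :=
  Complex.exp (Complex.I * β * (r 2 : ℂ)) * u (proj r)

lemma kernel3_wave (k : ℂ) (β : ℝ) (a : Plane → ℂ) (r : Space) (Q : Plane) (z : ℝ) :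
    kernel3 k (wave β a) r (Q, z) =
      1 / (4 * (Real.pi : ℂ)) * waveTerm k 1 (4 * (‖proj r - Q‖ ^ 2 / 4) + (z - r 2) ^ 2) *
        (a Q * Complex.exp (Complex.I * β * z)) := by
  have h1 : proj (lift Q z) = Q := by
    ext i; fin_cases i <;> simp [proj, lift]
  have h2 : (lift Q z) 2 = z := by simp [lift]
  rw [kernel3, wave, h1, h2, norm_sub_lift, waveTerm, pow_one]
  ring

lemma measurable_waveTerm (k : ℂ) (m : ℕ) : Measurable (waveTerm k m) := by
  unfold waveTerm
  fun_prop

lemma restrict_area (C : CrossSection) (a b : ℝ) :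
    C.area.restrict (Set.univ ×ˢ Set.Icc a b) = C.arc.prod (volume.restrict (Set.Icc a b)) := by
  rw [CrossSection.area, ← Measure.prod_restrict, Measure.restrict_univ]

lemma integrableOn_kernel3 (C : CrossSection) {k : ℂ} (hk : 0 ≤ k.im) (β : ℝ) {a : Plane → ℂ}
    (ha : Integrable a C.arc) {r : Space} (hr : proj r ∉ C.Γ) (c₁ c₂ : ℝ) :
    IntegrableOn (kernel3 k (wave β a) r) (Set.univ ×ˢ Set.Icc c₁ c₂) C.area := by
  obtain ⟨d, D, hd, hdD⟩ := C.exists_dist_bounds hr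
  rw [IntegrableOn, restrict_area]
  have h1 : Integrable (fun z : ℝ => Complex.exp (Complex.I * β * z))
      (volume.restrict (Set.Icc c₁ c₂)) :=
    (continuous_expLine β).continuousOn.integrableOn_Icc
  have h2 := ha.mul_prod h1
  have hmeas : Measurable fun p : Plane × ℝ =>
      1 / (4 * (Real.pi : ℂ)) * waveTerm k 1 (4 * (‖proj r - p.1‖ ^ 2 / 4) + (p.2 - r 2) ^ 2) :=
    ((measurable_waveTerm k 1).comp (by fun_prop)).const_mul _
  have hint := h2.bdd_mul (c := ‖1 / (4 * (Real.pi : ℂ))‖ * (1 / √(d ^ 2)))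
    hmeas.aestronglyMeasurable (by
      have hΓ : ∀ᵐ p ∂(C.arc.prod (volume.restrict (Set.Icc c₁ c₂))), p.1 ∈ C.Γ :=
        Measure.quasiMeasurePreserving_fst.ae C.ae_mem_Γ
      filter_upwards [hΓ] with p hp
      have hlow := (hdD _ (Metric.mem_ball_self hd) p.1 hp).1
      rw [norm_mul]
      gcongr
      have := norm_waveTerm_le hk 1 (q₀ := d ^ 2) (z := 0)
        (q := 4 * (‖proj r - p.1‖ ^ 2 / 4) + (p.2 - r 2) ^ 2) (by positivity)
        (by nlinarith [sq_nonneg (p.2 - r 2)])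
        (by rw [zero_pow two_ne_zero]; positivity)
      simpa using this)
  exact hint.congr (ae_of_all _ fun p => (kernel3_wave k β a r p.1 p.2).symm)

lemma truncSingle3_eq (C : CrossSection) {k : ℂ} (hk : 0 ≤ k.im) (β : ℝ) {a : Plane → ℂ}
    (ha : Integrable a C.arc) {r : Space} (hr : proj r ∉ C.Γ) {c : ℝ × ℝ} (hc : c.1 ≤ c.2) :
    Integrable (fun Q => Complex.exp (Complex.I * β * (r 2 : ℂ)) * (1 / (4 * (Real.pi : ℂ)) *
        truncLine k β (‖proj r - Q‖ ^ 2 / 4) (c.1 - r 2) (c.2 - r 2) * a Q)) C.arc ∧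
    truncSingle3 C k (wave β a) r c =
      ∫ Q, Complex.exp (Complex.I * β * (r 2 : ℂ)) * (1 / (4 * (Real.pi : ℂ)) *
        truncLine k β (‖proj r - Q‖ ^ 2 / 4) (c.1 - r 2) (c.2 - r 2) * a Q) ∂C.arc := by
  have hint := integrableOn_kernel3 C hk β ha hr c.1 c.2
  rw [IntegrableOn, restrict_area] at hint
  have e : ∀ Q, ∫ z in Set.Icc c.1 c.2, kernel3 k (wave β a) r (Q, z)
      = Complex.exp (Complex.I * β * (r 2 : ℂ)) * (1 / (4 * (Real.pi : ℂ)) *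
        truncLine k β (‖proj r - Q‖ ^ 2 / 4) (c.1 - r 2) (c.2 - r 2) * a Q) := by
    intro Q
    have hsh := intervalIntegral.integral_comp_sub_right (a := c.1) (b := c.2)
      (fun z : ℝ => waveTerm k 1 (4 * (‖proj r - Q‖ ^ 2 / 4) + z ^ 2) *
        Complex.exp (Complex.I * β * z)) (r 2)
    have hcomm : ∀ x y I : ℂ, x * (y * I * a Q) = (x * y * a Q) * I := fun x y I => by ring
    rw [integral_Icc_eq_integral_Ioc, ← intervalIntegral.integral_of_le hc, truncLine, ← hsh,
      hcomm, ← intervalIntegral.integral_const_mul]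
    refine intervalIntegral.integral_congr fun z _ => ?_
    have hexp : Complex.exp (Complex.I * β * z) = Complex.exp (Complex.I * β * (r 2 : ℂ)) *
        Complex.exp (Complex.I * β * ((z - r 2 : ℝ) : ℂ)) := by
      rw [← Complex.exp_add]; congr 1; push_cast; ring
    simp only [kernel3_wave, hexp]
    ring
  refine ⟨hint.integral_prod_left.congr (ae_of_all _ e), ?_⟩
  rw [truncSingle3, restrict_area, integral_prod _ hint]
  exact integral_congr_ae (ae_of_all _ e)

/-- The truncated potentials of a travelling wave converge to the plane single layer potential. The
truncation error of the line integrals is uniform along the curve. -/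
lemma tendsto_truncSingle3 (C : CrossSection) {k κ : ℂ} (hk : UpperBranch k) {β : ℝ}
    (hκ : κ ^ 2 = k ^ 2 - (β : ℂ) ^ 2) (hκ' : UpperBranch κ) {a : Plane → ℂ}
    (ha : Integrable a C.arc) {r : Space} (hr : proj r ∉ C.Γ) :
    Tendsto (truncSingle3 C k (wave β a) r) (atBot ×ˢ atTop)
      (𝓝 (wave β (single C κ a) r)) := by
  obtain ⟨d, D, hd, hdD⟩ := C.exists_dist_bounds hr
  let err : ℝ × ℝ → ℝ := fun c => (3 + D ^ 2 * ‖k‖) *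
    (1 / (‖k - β‖ * (r 2 - c.1)) + 1 / (‖k + β‖ * (c.2 - r 2))) * ∫ Q, ‖a Q‖ ∂C.arc
  have hprod : (k - β) * (k + β) ≠ 0 := by
    have : (k - β) * (k + β) = κ ^ 2 := by rw [hκ]; ring
    rw [this]; exact pow_ne_zero 2 hκ'.ne_zero
  have hm := norm_pos_iff.2 (left_ne_zero_of_mul hprod)
  have hp := norm_pos_iff.2 (right_ne_zero_of_mul hprod)
  have herr : Tendsto err (atBot ×ˢ atTop) (𝓝 0) := by
    have h1 : Tendsto (fun c : ℝ × ℝ => 1 / (‖k - β‖ * (r 2 - c.1))) (atBot ×ˢ atTop) (𝓝 0) := by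
      refine Tendsto.div_atTop tendsto_const_nhds (Tendsto.const_mul_atTop hm ?_)
      have : Tendsto (fun x : ℝ => r 2 - x) atBot atTop := by
        simpa [sub_eq_add_neg] using tendsto_atTop_add_const_left atBot (r 2) tendsto_neg_atBot_atTop
      exact this.comp tendsto_fst
    have h2 : Tendsto (fun c : ℝ × ℝ => 1 / (‖k + β‖ * (c.2 - r 2))) (atBot ×ˢ atTop) (𝓝 0) := by
      refine Tendsto.div_atTop tendsto_const_nhds (Tendsto.const_mul_atTop hp ?_)
      exact (tendsto_atTop_add_const_right atTop (-(r 2)) tendsto_id).comp tendsto_snd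
    have := ((h1.add h2).const_mul (3 + D ^ 2 * ‖k‖)).mul_const (∫ Q, ‖a Q‖ ∂C.arc)
    simpa [err] using this
  rw [tendsto_iff_norm_sub_tendsto_zero]
  refine squeeze_zero' (Eventually.of_forall fun _ => norm_nonneg _) ?_ herr
  have hev : ∀ᶠ c : ℝ × ℝ in atBot ×ˢ atTop, c.1 ≤ r 2 - 1 ∧ r 2 + 1 ≤ c.2 :=
    (eventually_le_atBot _).prod_mk (eventually_ge_atTop _)
  filter_upwards [hev] with c hc
  obtain ⟨hi, heq⟩ := truncSingle3_eq C hk.im_nonneg β ha hr (c := c) (by linarith [hc.1, hc.2])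
  have hi2 := (integrable_kernel_mul C (smoothOffZero_greenKernel κ).continuousOn ha hr).const_mul
    (Complex.exp (Complex.I * β * (r 2 : ℂ)))
  rw [heq, wave, single_eq_potential hκ'.ne_zero a hr, potential, ← integral_const_mul,
    ← integral_sub hi hi2]
  simp only [err]
  rw [← integral_const_mul]
  refine norm_integral_le_of_norm_le (ha.norm.const_mul _) ?_
  filter_upwards [C.ae_mem_Γ] with Q hQ
  obtain ⟨hlo, hhi⟩ := hdD _ (Metric.mem_ball_self hd) Q hQ
  have hs : 0 < ‖proj r - Q‖ ^ 2 / 4 := by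
    have : 0 < ‖proj r - Q‖ := hd.trans_le hlo
    positivity
  have hb := norm_truncLine_sub_le hk hκ hκ' hs (a := r 2 - c.1) (b := c.2 - r 2)
    (by linarith [hc.1]) (by linarith [hc.2])
  rw [neg_sub] at hb
  have hpi : ‖(1 / (4 * (Real.pi : ℂ)))‖ ≤ 1 := by
    rw [norm_div, norm_one, norm_mul, Complex.norm_real, Complex.norm_ofNat,
      Real.norm_of_nonneg Real.pi_pos.le, div_le_one (by positivity)]
    linarith [Real.pi_gt_three]
  have e : Complex.exp (Complex.I * β * (r 2 : ℂ)) * (1 / (4 * (Real.pi : ℂ)) *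
        truncLine k β (‖proj r - Q‖ ^ 2 / 4) (c.1 - r 2) (c.2 - r 2) * a Q)
      - Complex.exp (Complex.I * β * (r 2 : ℂ)) * (greenKernel κ (proj r - Q) * a Q)
      = Complex.exp (Complex.I * β * (r 2 : ℂ)) * ((1 / (4 * (Real.pi : ℂ))) *
        (truncLine k β (‖proj r - Q‖ ^ 2 / 4) (c.1 - r 2) (c.2 - r 2)
          - hankelSol κ (‖proj r - Q‖ ^ 2 / 4)) * a Q) := by
    rw [greenKernel]; ring
  rw [e, norm_mul, norm_exp_I_mul_real, one_mul, norm_mul, norm_mul]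
  have hc1 : 0 < r 2 - c.1 := by linarith [hc.1]
  have hc2 : 0 < c.2 - r 2 := by linarith [hc.2]
  have hbr : 0 ≤ 1 / (‖k - β‖ * (r 2 - c.1)) + 1 / (‖k + β‖ * (c.2 - r 2)) := by positivity
  refine mul_le_mul_of_nonneg_right ?_ (norm_nonneg _)
  calc _ ≤ 1 * ((3 + 4 * (‖proj r - Q‖ ^ 2 / 4) * ‖k‖) *
          (1 / (‖k - β‖ * (r 2 - c.1)) + 1 / (‖k + β‖ * (c.2 - r 2)))) := by gcongr
    _ ≤ _ := by
      rw [one_mul]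
      gcongr
      have : ‖proj r - Q‖ ^ 2 ≤ D ^ 2 := by gcongr
      linarith

/-- The potential of a travelling wave in space is the travelling wave of the plane potential. -/
lemma single3_wave (C : CrossSection) {k κ : ℂ} (hk : UpperBranch k) {β : ℝ}
    (hκ : κ ^ 2 = k ^ 2 - (β : ℂ) ^ 2) (hκ' : UpperBranch κ) {a : Plane → ℂ}
    (ha : Integrable a C.arc) {r : Space} (hr : proj r ∉ C.Γ) :
    single3 C k (wave β a) r = wave β (single C κ a) r ∧ Converges3 C k (wave β a) r := by
  have h := tendsto_truncSingle3 C hk hκ hκ' ha hr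
  have e : single3 C k (wave β a) r = wave β (single C κ a) r := h.limUnder_eq
  exact ⟨e, fun c₁ c₂ => integrableOn_kernel3 C hk.im_nonneg β ha hr c₁ c₂, e ▸ h⟩

/-- The projection to the plane as a linear map. -/
def projL : Space →L[ℝ] Plane :=
  (EuclideanSpace.equiv (Fin 2) ℝ).symm.toContinuousLinearMap.comp
    (ContinuousLinearMap.pi ![EuclideanSpace.proj (𝕜 := ℝ) (0 : Fin 3), EuclideanSpace.proj 1])

lemma projL_apply (r : Space) : projL r = proj r := by
  ext i; fin_cases i <;> rfl

lemma proj_eq_projL : proj = projL := funext fun r => (projL_apply r).symm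

lemma isOpen_offCylinder (C : CrossSection) : IsOpen C.offCylinder := by
  have : C.offCylinder = projL ⁻¹' C.Γᶜ := by
    ext r; simp [CrossSection.offCylinder, projL_apply]
  rw [this]
  exact C.isClosed_Γ.isOpen_compl.preimage projL.continuous

lemma contDiffOn_wave (C : CrossSection) (β : ℝ) {u : Plane → ℂ} {n : WithTop ℕ∞}
    (hu : ContDiffOn ℝ n u C.Γᶜ) : ContDiffOn ℝ n (wave β u) C.offCylinder := by
  have h1 : ContDiff ℝ n fun r : Space => Complex.exp (Complex.I * β * (r 2 : ℂ)) :=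
    (contDiff_const.mul (Complex.ofRealCLM.comp (EuclideanSpace.proj (2 : Fin 3))).contDiff).cexp
  have h2 : ContDiffOn ℝ n (fun r => u (proj r)) C.offCylinder := by
    rw [proj_eq_projL]
    exact hu.comp projL.contDiff.contDiffOn fun r hr => by
      rw [projL_apply]; exact hr
  exact h1.contDiffOn.mul h2

lemma hasFDerivAt_wave (β : ℝ) {u : Plane → ℂ} {r : Space} (hu : DifferentiableAt ℝ u (proj r)) :
    HasFDerivAt (wave β u)
      (Complex.exp (Complex.I * β * (r 2 : ℂ)) • (fderiv ℝ u (proj r)).comp projL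
        + u (proj r) • (Complex.exp (Complex.I * β * (r 2 : ℂ)) • ((Complex.I * β) •
          Complex.ofRealCLM.comp (EuclideanSpace.proj (𝕜 := ℝ) (2 : Fin 3))))) r := by
  have h1 : HasFDerivAt (fun r : Space => Complex.I * β * (r 2 : ℂ)) ((Complex.I * β) •
      Complex.ofRealCLM.comp (EuclideanSpace.proj (𝕜 := ℝ) (2 : Fin 3))) r :=
    (Complex.ofRealCLM.comp (EuclideanSpace.proj (𝕜 := ℝ) (2 : Fin 3))).hasFDerivAt.const_mul _
  rw [← projL_apply] at hu ⊢
  have h2 := hu.hasFDerivAt.comp r projL.hasFDerivAt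
  have h3 := h1.cexp.mul h2
  refine h3.congr_of_eventuallyEq (Eventually.of_forall fun r' => ?_)
  simp [wave, projL_apply]

lemma pd3_wave (β : ℝ) {u : Plane → ℂ} {r : Space} (hu : DifferentiableAt ℝ u (proj r)) :
    pd3 0 (wave β u) r = wave β (pd2 0 u) r ∧ pd3 1 (wave β u) r = wave β (pd2 1 u) r ∧
    pd3 2 (wave β u) r = Complex.I * β * wave β u r := by
  have hp0 : projL (EuclideanSpace.single 0 1) = EuclideanSpace.single 0 1 := by
    rw [projL_apply]; ext i; fin_cases i <;> simp [proj]
  have hp1 : projL (EuclideanSpace.single 1 1) = EuclideanSpace.single 1 1 := by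
    rw [projL_apply]; ext i; fin_cases i <;> simp [proj]
  have hp2 : projL (EuclideanSpace.single 2 1) = 0 := by
    rw [projL_apply]; ext i; fin_cases i <;> simp [proj]
  have h := (hasFDerivAt_wave β hu).fderiv
  refine ⟨?_, ?_, ?_⟩
  · simp [pd3, h, hp0, wave, pd2]
  · simp [pd3, h, hp1, wave, pd2]
  · simp [pd3, h, hp2, wave]; ring

/-- The curl of a travelling wave, without the factor `e^{iβz}`. -/
def planeCurl (β : ℝ) (u : Fin 3 → Plane → ℂ) : Fin 3 → Plane → ℂ :=
  ![fun P => pd2 1 (u 2) P - Complex.I * β * u 1 P,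
    fun P => Complex.I * β * u 0 P - pd2 0 (u 2) P,
    fun P => pd2 0 (u 1) P - pd2 1 (u 0) P]

lemma pd3_congr {U : Set Space} (hU : IsOpen U) {f g : Space → ℂ} (h : Set.EqOn f g U) (i : Fin 3)
    {r : Space} (hr : r ∈ U) : pd3 i f r = pd3 i g r := by
  rw [pd3, pd3, (h.eventuallyEq_of_mem (hU.mem_nhds hr)).fderiv_eq]

lemma curl_wave (C : CrossSection) (β : ℝ) {F : Space → Fin 3 → ℂ} {u : Fin 3 → Plane → ℂ}
    (hF : ∀ r ∈ C.offCylinder, ∀ j, F r j = wave β (u j) r)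
    (hu : ∀ j, DifferentiableOn ℝ (u j) C.Γᶜ) :
    ∀ r ∈ C.offCylinder, ∀ j, curl F r j = wave β (planeCurl β u j) r := by
  intro r hr j
  have hd : ∀ j, DifferentiableAt ℝ (u j) (proj r) := fun j =>
    (hu j).differentiableAt (C.isClosed_Γ.isOpen_compl.mem_nhds hr)
  have hc : ∀ i j, pd3 i (fun q => F q j) r = pd3 i (wave β (u j)) r := fun i j =>
    pd3_congr (isOpen_offCylinder C) (fun q hq => hF q hq j) i hr
  have h := fun j => pd3_wave β (hd j)
  fin_cases j
  · simp only [curl, planeCurl, hc, (h _).1, (h _).2.1, (h _).2.2]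
    simp [wave]; ring
  · simp only [curl, planeCurl, hc, (h _).1, (h _).2.1, (h _).2.2]
    simp [wave]; ring
  · simp only [curl, planeCurl, hc, (h _).1, (h _).2.1, (h _).2.2]
    simp [wave]; ring

/-! ### The fields of the dual Müller representation -/

lemma pd2_add {f g : Plane → ℂ} {P : Plane} (hf : DifferentiableAt ℝ f P)
    (hg : DifferentiableAt ℝ g P) (i : Fin 2) :
    pd2 i (fun P => f P + g P) P = pd2 i f P + pd2 i g P := by
  simp only [pd2, fderiv_fun_add hf hg, add_apply]

lemma pd2_sub {f g : Plane → ℂ} {P : Plane} (hf : DifferentiableAt ℝ f P)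
    (hg : DifferentiableAt ℝ g P) (i : Fin 2) :
    pd2 i (fun P => f P - g P) P = pd2 i f P - pd2 i g P := by
  simp only [pd2, fderiv_fun_sub hf hg, sub_apply]

lemma pd2_const_mul {f : Plane → ℂ} {P : Plane} (hf : DifferentiableAt ℝ f P) (c : ℂ) (i : Fin 2) :
    pd2 i (fun P => c * f P) P = c * pd2 i f P := by
  simp only [pd2, fderiv_const_mul hf c, smul_apply, smul_eq_mul]

/-- The components of the current `aτ τ + az k̂`, without the factor `e^{iβz}`. -/
def density (C : CrossSection) (aτ az : Plane → ℂ) : Fin 3 → Plane → ℂ :=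
  ![fun Q => aτ Q * (C.τ Q 0 : ℂ), fun Q => aτ Q * (C.τ Q 1 : ℂ), az]

lemma current_eq_wave (C : CrossSection) (β : ℝ) (aτ az : Plane → ℂ) (j : Fin 3) :
    (fun r => current C β aτ az r j) = wave β (density C aτ az j) := by
  funext r
  fin_cases j <;> simp [current, wave, density]

lemma integrable_density {C : CrossSection} {aτ az : Plane → ℂ} (hτ : Integrable aτ C.arc)
    (hz : Integrable az C.arc) (j : Fin 3) : Integrable (density C aτ az j) C.arc := by
  fin_cases j
  · exact C.integrable_mul_τ hτ 0
  · exact C.integrable_mul_τ hτ 1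
  · exact hz

/-- The plane single layer potentials of the components of a current. -/
def modePotential (C : CrossSection) (κ : ℂ) (aτ az : Plane → ℂ) (j : Fin 3) : Plane → ℂ :=
  single C κ (density C aτ az j)

section

variable {C : CrossSection} {k κ : ℂ} {β : ℝ} {aτ az : Plane → ℂ}

lemma vecSingle3_current (hk : UpperBranch k) (hκ : κ ^ 2 = k ^ 2 - (β : ℂ) ^ 2)
    (hκ' : UpperBranch κ) (hτ : Integrable aτ C.arc) (hz : Integrable az C.arc) {r : Space}
    (hr : r ∈ C.offCylinder) (j : Fin 3) :
    vecSingle3 C k (current C β aτ az) r j = wave β (modePotential C κ aτ az j) r := by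
  rw [vecSingle3, current_eq_wave]
  exact (single3_wave C hk hκ hκ' (integrable_density hτ hz j) hr).1

lemma converges3_current (hk : UpperBranch k) (hκ : κ ^ 2 = k ^ 2 - (β : ℂ) ^ 2)
    (hκ' : UpperBranch κ) (hτ : Integrable aτ C.arc) (hz : Integrable az C.arc) {r : Space}
    (hr : r ∈ C.offCylinder) (j : Fin 3) :
    Converges3 C k (fun r' => current C β aτ az r' j) r := by
  rw [current_eq_wave]
  exact (single3_wave C hk hκ hκ' (integrable_density hτ hz j) hr).2

lemma contDiffOn_vecSingle3 (hk : UpperBranch k) (hκ : κ ^ 2 = k ^ 2 - (β : ℂ) ^ 2)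
    (hκ' : UpperBranch κ) (hτ : Integrable aτ C.arc) (hz : Integrable az C.arc) :
    ContDiffOn ℝ 2 (vecSingle3 C k (current C β aτ az)) C.offCylinder := by
  rw [contDiffOn_pi]
  intro j
  refine (contDiffOn_wave C β (contDiffOn_single hκ'.ne_zero (integrable_density hτ hz j) 2)).congr
    fun r hr => vecSingle3_current hk hκ hκ' hτ hz hr j

lemma differentiableOn_planeCurl (hκ : κ ≠ 0) (hτ : Integrable aτ C.arc)
    (hz : Integrable az C.arc) (j : Fin 3) :
    DifferentiableOn ℝ (planeCurl β (modePotential C κ aτ az) j) C.Γᶜ := by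
  have h := fun j => differentiableOn_single hκ (integrable_density hτ hz j)
  have h' := fun i j => differentiableOn_pd2_single hκ (integrable_density hτ hz j) i
  fin_cases j
  · exact (h' 1 2).sub ((h 1).const_mul _)
  · exact ((h 0).const_mul _).sub (h' 0 2)
  · exact (h' 0 1).sub (h' 1 0)

lemma curl_vecSingle3 (hk : UpperBranch k) (hκ : κ ^ 2 = k ^ 2 - (β : ℂ) ^ 2)
    (hκ' : UpperBranch κ) (hτ : Integrable aτ C.arc) (hz : Integrable az C.arc) :
    ∀ r ∈ C.offCylinder, ∀ j, curl (vecSingle3 C k (current C β aτ az)) r j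
      = wave β (planeCurl β (modePotential C κ aτ az) j) r :=
  curl_wave C β (fun _ hr j => vecSingle3_current hk hκ hκ' hτ hz hr j)
    fun j => differentiableOn_single hκ'.ne_zero (integrable_density hτ hz j)

lemma curl_curl_vecSingle3 (hk : UpperBranch k) (hκ : κ ^ 2 = k ^ 2 - (β : ℂ) ^ 2)
    (hκ' : UpperBranch κ) (hτ : Integrable aτ C.arc) (hz : Integrable az C.arc) :
    ∀ r ∈ C.offCylinder, ∀ j, curl (curl (vecSingle3 C k (current C β aτ az))) r j
      = wave β (planeCurl β (planeCurl β (modePotential C κ aτ az)) j) r :=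
  curl_wave C β (curl_vecSingle3 hk hκ hκ' hτ hz)
    fun j => differentiableOn_planeCurl hκ'.ne_zero hτ hz j

variable {P : Plane}

lemma planeCurl_modePotential_two (hκ : κ ≠ 0) (hτ : Integrable aτ C.arc) (hP : P ∉ C.Γ) :
    planeCurl β (modePotential C κ aτ az) 2 P = -double C κ aτ P := by
  rw [double_eq hκ hτ hP, neg_neg]
  rfl

/-- The transversal components of `curl curl = grad div - Δ`: the divergence in the plane is minus
the anti-double layer potential, and the Laplacian is given by the Helmholtz equation. -/
lemma planeCurl_planeCurl_transversal (hκ : κ ^ 2 = k ^ 2 - (β : ℂ) ^ 2) (hκ0 : κ ≠ 0)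
    (hτ : Integrable aτ C.arc) (hz : Integrable az C.arc) (hP : P ∉ C.Γ) :
    planeCurl β (planeCurl β (modePotential C κ aτ az)) 0 P
      = -pd2 0 (antiDouble C κ aτ) P + Complex.I * β * pd2 0 (single C κ az) P
        + k ^ 2 * single C κ (fun Q => aτ Q * (C.τ Q 0 : ℂ)) P ∧
    planeCurl β (planeCurl β (modePotential C κ aτ az)) 1 P
      = -pd2 1 (antiDouble C κ aτ) P + Complex.I * β * pd2 1 (single C κ az) P
        + k ^ 2 * single C κ (fun Q => aτ Q * (C.τ Q 1 : ℂ)) P := by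
  have hopen := C.isClosed_Γ.isOpen_compl
  have hd := fun i j =>
    (differentiableOn_pd2_single hκ0 (integrable_density hτ hz j) i).differentiableAt
      (hopen.mem_nhds hP)
  have hA : ∀ i, pd2 i (antiDouble C κ aτ) P =
      -(pd2 i (pd2 0 (single C κ (density C aτ az 0))) P
        + pd2 i (pd2 1 (single C κ (density C aτ az 1))) P) := by
    intro i
    rw [pd2_congr hopen (fun P hP => antiDouble_eq hκ0 hτ hP) i hP, ← pd2_add (hd 0 0) (hd 1 1),
      pd2, fderiv_fun_neg]
    rfl
  have e0 : planeCurl β (planeCurl β (modePotential C κ aτ az)) 0 P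
      = pd2 1 (fun P => pd2 0 (single C κ (density C aτ az 1)) P
          - pd2 1 (single C κ (density C aτ az 0)) P) P
        - Complex.I * β * (Complex.I * β * single C κ (density C aτ az 0) P
          - pd2 0 (single C κ (density C aτ az 2)) P) := rfl
  have e1 : planeCurl β (planeCurl β (modePotential C κ aτ az)) 1 P
      = Complex.I * β * (pd2 1 (single C κ (density C aτ az 2)) P
          - Complex.I * β * single C κ (density C aτ az 1) P)
        - pd2 0 (fun P => pd2 0 (single C κ (density C aτ az 1)) P
          - pd2 1 (single C κ (density C aτ az 0)) P) P := rfl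
  have d0 : (fun Q => aτ Q * (C.τ Q 0 : ℂ)) = density C aτ az 0 := rfl
  have d1 : (fun Q => aτ Q * (C.τ Q 1 : ℂ)) = density C aτ az 1 := rfl
  have d2 : ∀ i, pd2 i (single C κ az) P = pd2 i (single C κ (density C aτ az 2)) P :=
    fun _ => rfl
  have hI : Complex.I ^ 2 = -1 := Complex.I_sq
  have hH := fun j => helmholtz_single hκ0 (integrable_density hτ hz j) hP
  have hS := fun j => pd2_comm_single hκ0 (integrable_density hτ hz j) hP
  rw [e0, e1, pd2_sub (hd 0 1) (hd 1 0), pd2_sub (hd 0 1) (hd 1 0), hA, hA, d0, d1, d2, d2]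
  constructor
  · linear_combination (-hH 0) - hS 1 - β ^ 2 * single C κ (density C aτ az 0) P * hI
      + single C κ (density C aτ az 0) P * hκ
  · linear_combination (-hH 1) + hS 0 - β ^ 2 * single C κ (density C aτ az 1) P * hI
      + single C κ (density C aτ az 1) P * hκ

/-- The longitudinal component of `curl curl`. -/
lemma planeCurl_planeCurl_longitudinal (hκ : κ ^ 2 = k ^ 2 - (β : ℂ) ^ 2) (hκ0 : κ ≠ 0)
    (hτ : Integrable aτ C.arc) (hz : Integrable az C.arc) (hP : P ∉ C.Γ) :
    planeCurl β (planeCurl β (modePotential C κ aτ az)) 2 P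
      = -(Complex.I * β * antiDouble C κ aτ P) + (k ^ 2 - (β : ℂ) ^ 2) * single C κ az P := by
  have hopen := C.isClosed_Γ.isOpen_compl
  have hd := fun i j =>
    (differentiableOn_pd2_single hκ0 (integrable_density hτ hz j) i).differentiableAt
      (hopen.mem_nhds hP)
  have hs := fun j => (differentiableOn_single hκ0 (integrable_density hτ hz j)).differentiableAt
    (hopen.mem_nhds hP)
  have e : planeCurl β (planeCurl β (modePotential C κ aτ az)) 2 P
      = pd2 0 (fun P => Complex.I * β * single C κ (density C aτ az 0) P
          - pd2 0 (single C κ (density C aτ az 2)) P) P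
        - pd2 1 (fun P => pd2 1 (single C κ (density C aτ az 2)) P
          - Complex.I * β * single C κ (density C aτ az 1) P) P := rfl
  have hA : antiDouble C κ aτ P = -(pd2 0 (single C κ (density C aτ az 0)) P
        + pd2 1 (single C κ (density C aτ az 1)) P) := antiDouble_eq hκ0 hτ hP
  have hH : pd2 0 (pd2 0 (single C κ (density C aτ az 2))) P
      + pd2 1 (pd2 1 (single C κ (density C aτ az 2))) P = -κ ^ 2 * single C κ az P :=
    helmholtz_single hκ0 hz hP
  rw [e, pd2_sub ((hs 0).const_mul _) (hd 0 2), pd2_sub (hd 1 2) ((hs 1).const_mul _),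
    pd2_const_mul (hs 0), pd2_const_mul (hs 1), hA]
  linear_combination -hH + single C κ az P * hκ

end

/-- The dual Müller representation reduces to layer potentials in the plane. -/
lemma muller_eq_mode (C : CrossSection) {kv : ℝ} (hkv : 0 < kv) {k κ : ℂ} (hk : UpperBranch k)
    {β : ℝ} (hκ : κ ^ 2 = k ^ 2 - (β : ℂ) ^ 2) (hκ' : UpperBranch κ) {Jτ Jz Mτ Mz : Plane → ℂ}
    (hJτ : Integrable Jτ C.arc) (hJz : Integrable Jz C.arc)
    (hMτ : Integrable Mτ C.arc) (hMz : Integrable Mz C.arc) {r : Space} (hr : r ∈ C.offCylinder) :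
    mullerE C kv k (current C β Jτ Jz) (current C β Mτ Mz) r =
        Complex.exp (Complex.I * β * (r 2 : ℂ)) • modeE C kv k κ β Jτ Jz Mτ Mz (proj r) ∧
    mullerH C kv k (current C β Jτ Jz) (current C β Mτ Mz) r =
        Complex.exp (Complex.I * β * (r 2 : ℂ)) • modeH C kv k κ β Jτ Jz Mτ Mz (proj r) := by
  have hP : proj r ∉ C.Γ := hr
  have hκ0 := hκ'.ne_zero
  have hkv0 : (kv : ℂ) ≠ 0 := by exact_mod_cast hkv.ne'
  have hI : Complex.I ≠ 0 := Complex.I_ne_zero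
  have cJ := curl_vecSingle3 hk hκ hκ' hJτ hJz r hr
  have cM := curl_vecSingle3 hk hκ hκ' hMτ hMz r hr
  have ccJ := curl_curl_vecSingle3 hk hκ hκ' hJτ hJz r hr
  have ccM := curl_curl_vecSingle3 hk hκ hκ' hMτ hMz r hr
  obtain ⟨tJ0, tJ1⟩ := planeCurl_planeCurl_transversal hκ hκ0 hJτ hJz hP
  obtain ⟨tM0, tM1⟩ := planeCurl_planeCurl_transversal hκ hκ0 hMτ hMz hP
  have tJ2 := planeCurl_planeCurl_longitudinal hκ hκ0 hJτ hJz hP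
  have tM2 := planeCurl_planeCurl_longitudinal hκ hκ0 hMτ hMz hP
  have zJ := planeCurl_modePotential_two (β := β) (az := Jz) hκ0 hJτ hP
  have zM := planeCurl_modePotential_two (β := β) (az := Mz) hκ0 hMτ hP
  have p0 : ∀ aτ az, planeCurl β (modePotential C κ aτ az) 0 (proj r)
      = pd2 1 (single C κ az) (proj r)
        - Complex.I * β * single C κ (fun Q => aτ Q * (C.τ Q 1 : ℂ)) (proj r) := fun _ _ => rfl
  have p1 : ∀ aτ az, planeCurl β (modePotential C κ aτ az) 1 (proj r)
      = Complex.I * β * single C κ (fun Q => aτ Q * (C.τ Q 0 : ℂ)) (proj r)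
        - pd2 0 (single C κ az) (proj r) := fun _ _ => rfl
  have hc : 1 / (Complex.I * kv) * (Complex.I * β) = (β / kv : ℂ) := by field_simp
  constructor
  · ext j
    simp only [mullerE, Pi.sub_apply, Pi.smul_apply, smul_eq_mul, ccJ, cM, wave]
    fin_cases j
    · simp only [Fin.zero_eta, modeE, Matrix.cons_val_zero, tJ0, p0, ← hc]; ring
    · simp only [Fin.mk_one, modeE, Matrix.cons_val_one, Matrix.cons_val_zero, tJ1, p1, ← hc]; ring
    · simp only [Fin.reduceFinMk, modeE, Matrix.cons_val, tJ2, zM, ← hc]; ring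
  · ext j
    simp only [mullerH, Pi.sub_apply, Pi.neg_apply, Pi.smul_apply, smul_eq_mul, ccM, cJ, wave]
    fin_cases j
    · simp only [Fin.zero_eta, modeH, Matrix.cons_val_zero, tM0, p0, ← hc]; ring
    · simp only [Fin.mk_one, modeH, Matrix.cons_val_one, Matrix.cons_val_zero, tM1, p1, ← hc]; ring
    · simp only [Fin.reduceFinMk, modeH, Matrix.cons_val, tM2, zJ, ← hc]; ring

end Waveguide

end

theorem theorem1
    (C : Waveguide.CrossSection)
    (kv : ℝ) (hkv : 0 < kv)
    (n : ℂ) (hn : Waveguide.UpperBranch n)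
    (k : ℂ) (hk : k = kv * n)
    (β : ℝ)
    (κ : ℂ) (hκ : κ ^ 2 = k ^ 2 - (β : ℂ) ^ 2) (hκ_branch : Waveguide.UpperBranch κ)
    (Jτ Jz Mτ Mz : Waveguide.Plane → ℂ)
    (hJτ : Integrable Jτ C.arc) (hJz : Integrable Jz C.arc)
    (hMτ : Integrable Mτ C.arc) (hMz : Integrable Mz C.arc)
    (J M : Waveguide.Space → Fin 3 → ℂ)
    (hJ : J = Waveguide.current C β Jτ Jz) (hM : M = Waveguide.current C β Mτ Mz) :
    -- the three-dimensional potentials converge off the cylinder and can be differentiated twice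
    (∀ r ∈ C.offCylinder, ∀ j : Fin 3,
      Waveguide.Converges3 C k (fun r' => J r' j) r ∧
      Waveguide.Converges3 C k (fun r' => M r' j) r) ∧
    ContDiffOn ℝ 2 (Waveguide.vecSingle3 C k J) C.offCylinder ∧
    ContDiffOn ℝ 2 (Waveguide.vecSingle3 C k M) C.offCylinder ∧
    -- the two-dimensional potentials and their derivatives are well defined off the curve
    (∀ σ : Waveguide.Plane → ℂ, Integrable σ C.arc →
      (∀ P ∉ C.Γ,
        Integrable (fun Q => Waveguide.green κ P Q * σ Q) C.arc ∧
        Integrable (fun Q => Waveguide.dGreen κ P Q (C.ν Q) * σ Q) C.arc ∧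
        Integrable (fun Q => Waveguide.dGreen κ P Q (C.τ Q) * σ Q) C.arc) ∧
      DifferentiableOn ℝ (Waveguide.single C κ σ) C.Γᶜ ∧
      DifferentiableOn ℝ (Waveguide.antiDouble C κ σ) C.Γᶜ) ∧
    -- the integral representations of the fields
    (∀ r ∈ C.offCylinder,
      Waveguide.mullerE C kv k J M r =
        Complex.exp (Complex.I * β * (r 2 : ℂ)) •
          Waveguide.modeE C kv k κ β Jτ Jz Mτ Mz (Waveguide.proj r) ∧
      Waveguide.mullerH C kv k J M r =
        Complex.exp (Complex.I * β * (r 2 : ℂ)) •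
          Waveguide.modeH C kv k κ β Jτ Jz Mτ Mz (Waveguide.proj r)) := by
  have hkU : Waveguide.UpperBranch k := by
    rw [hk]
    rcases hn with h | ⟨h1, h2⟩
    · left; simpa using mul_pos hkv h
    · right; simpa [h1] using mul_pos hkv h2
  have hκ0 := hκ_branch.ne_zero
  subst hJ hM
  refine ⟨fun r hr j => ⟨Waveguide.converges3_current hkU hκ hκ_branch hJτ hJz hr j,
      Waveguide.converges3_current hkU hκ hκ_branch hMτ hMz hr j⟩,
    Waveguide.contDiffOn_vecSingle3 hkU hκ hκ_branch hJτ hJz,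
    Waveguide.contDiffOn_vecSingle3 hkU hκ hκ_branch hMτ hMz,
    fun σ hσ => ⟨fun P hP => ⟨Waveguide.integrable_green hκ0 hσ hP,
        Waveguide.integrable_double hκ0 hσ hP, Waveguide.integrable_antiDouble hκ0 hσ hP⟩,
      Waveguide.differentiableOn_single hκ0 hσ, Waveguide.differentiableOn_antiDouble hκ0 hσ⟩,
    fun r hr => Waveguide.muller_eq_mode C hkv hkU hκ hκ_branch hJτ hJz hMτ hMz hr⟩
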